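/- Let $n\ge 2$, $q\in(\frac{n}{n-1},\infty)$ and $p=(n-1)q(q-1)$. Write points of $\mathbb{R}^n_+$ as $(x',x_n)$ with $x'\in\mathbb{R}^{n-1}$, $x_n>0$, and $x=(x',x_n)$. *Data.* Let $\dot{\mathcal S}(\mathbb{R}^{n-1})$ be the space of (complex-valued) Schwartz functions all of whose moments vanish, with the topology of $\mathcal S$, and $\dot{\mathcal S}'(\mathbb{R}^{n-1})$ its dual. Fix a smooth $\varphi:\mathbb{R}^{n-1}\to\mathbb{R}$ with $\varphi=1$ for $|\xi|\le 1$ and $\varphi=0$ for $|\xi|>2$; put $\psi(\xi)=\varphi(\xi)-\varphi(2\xi)$, $\psi_j(\xi)=\psi(2^{-j}\xi)$, $\dot\Delta_jf=\mathcal F^{-1}(\psi_j\mathcal Ff)$, where $\mathcal Fg(\xi)=\int e^{-2\pi i x'\cdot\xi}g(x')\,dx'$. For $f\in\dot{\mathcal S}'$ let $$\|f\|_{\dot F^{-1/q}_{p,q}}=\Big\|\Big[\sum_{j\in\mathbb Z}\big(2^{-j/q}|\dot\Delta_jf|\big)^q\Big]^{1/q}\Big\|_{L^p(\mathbb{R}^{n-1})},$$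 and let $\dot F^{-1/q}_{p,q}(\mathbb{R}^{n-1})$ be the set of $f$ for which it is finite; for a vector $f=(f_1,\dots,f_n)$ let $\|f\|_{\dot F^{-1/q}_{p,q}}=\sum_j\|f_j\|_{\dot F^{-1/q}_{p,q}}$. *Extensions.* Let $\omega$ be the surface area of the unit sphere of $\mathbb{R}^n$ and, for $1\le i,j\le n$, $$K_{ij}(x)=\frac{2n}{\omega}\frac{x_nx_ix_j}{|x|^{n+2}},\qquad \mathrm k_j(x)=\frac1\omega\,\partial_j\frac{4x_n}{|x|^n}.$$ Define $(\mathcal Hf)_i(x',x_n)=\sum_j(K_{ij}(\cdot,x_n)*f_j)(x')$ and $\mathcal Ef(x',x_n)=\sum_j(\mathrm k_j(\cdot,x_n)*f_j)(x')$, where for an integrable kernel $\kappa$ and $g\in\dot{\mathcal S}'$ the function $\kappa*g$ is $\sum_{k\in\mathbb Z}\kappa*\dot\Delta_kg$. *Norms.* For measurable $F$ on $\mathbb{R}^n_+$ let $$\|F\|_{T^{p,q}}=\bigg\|\Big(\iint_{|x'-y'|<y_n}|F(y',y_n)|^q\,y_n^{-(n-1)}\,dy'\,dy_n\Big)^{1/q}\bigg\|_{L^p_{x'}(\mathbb{R}^{n-1})},$$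 $$\|u\|_{\mathbf X^q}=\sup_{x_n>0}x_n^{\frac1{q-1}}\|u(\cdot,x_n)\|_{L^\infty(\mathbb{R}^{n-1})}+\|u\|_{T^{p,q}},\qquad \|\pi\|_{\mathbf Z^q}=\|y_n\,\pi\|_{T^{p,q}}.$$ *Statement.* There is a constant $C>0$, depending only on $n$, $q$ (and the fixed cut-off $\varphi$), such that for every $f\in[\dot F^{-1/q}_{p,q}(\mathbb{R}^{n-1})]^n$ the following holds. The convolutions above are meaningful: for all $x_n>0$, all integrals and series defining $K_{ij}(\cdot,x_n)*f_j$ and $\mathrm k_j(\cdot,x_n)*f_j$ converge absolutely at every $x'\in\mathbb{R}^{n-1}$, and the resulting functions represent the distributional convolutions in $\dot{\mathcal S}'(\mathbb{R}^{n-1})$, i.e. $\int(\kappa*f_j)\,g=\langle f_j,\kappa(-\,\cdot)*g\rangle$ for all $g\in\dot{\mathcal S}(\mathbb{R}^{n-1})$, for each of these kernels $\kappa$. The functions $\mathcal Hf$ and $\mathcal Ef$ are measurable on $\mathbb{R}^n_+$ (up to null sets), and $$\|\mathcal Hf\|_{\mathbf X^q}+\|\mathcal Ef\|_{\mathbf Z^q}+\sup_{x_n>0}x_n^{q/(q-1)}\|\mathcal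 Ef(\cdot,x_n)\|_{L^\infty(\mathbb{R}^{n-1})}\le C\,\|f\|_{\dot F^{-1/q}_{p,q}(\mathbb{R}^{n-1})}.$$ -/

import Mathlib

open MeasureTheory Set
open scoped ENNReal NNReal SchwartzMap FourierTransform ContDiff LineDeriv RealInnerProductSpace

noncomputable section

namespace StokesLin

/-! Throughout, `d = n - 1` is the dimension of the boundary `ℝ^{n-1}` of the half-space
`ℝⁿ₊ = {(x', xₙ) : x' ∈ ℝ^{n-1}, xₙ > 0}`. -/

/-- The boundary `ℝ^{n-1}`, with its Euclidean norm. -/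
abbrev Bd (d : ℕ) := EuclideanSpace ℝ (Fin d)

/-! ### Test functions with vanishing moments and their dual -/

/-- The monomial `z ↦ z^γ`. -/
def monomial {d : ℕ} (γ : Fin d → ℕ) (z : Bd d) : ℝ := ∏ i, z i ^ γ i

theorem monomial_hasTemperateGrowth {d : ℕ} (γ : Fin d → ℕ) :
    (monomial γ).HasTemperateGrowth := by
  have h : ∀ s : Finset (Fin d),
      (fun z : Bd d => ∏ i ∈ s, z i ^ γ i).HasTemperateGrowth := by
    intro s
    induction s using Finset.induction_on with
    | empty => simp only [Finset.prod_empty]; exact Function.HasTemperateGrowth.const (1 : ℝ)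
    | insert a s ha ih =>
      simp only [Finset.prod_insert ha]
      have h1 : (fun z : Bd d => z a).HasTemperateGrowth :=
        (EuclideanSpace.proj (𝕜 := ℝ) a).hasTemperateGrowth
      exact (h1.pow _).mul ih
  exact h Finset.univ

/-- The space `𝒮̇(ℝ^{n-1})` of Schwartz functions all of whose moments vanish, with the topology
inherited from `𝒮(ℝ^{n-1})`. -/
def SDot (d : ℕ) : Submodule ℂ 𝓢(Bd d, ℂ) where
  carrier := {g | ∀ γ : Fin d → ℕ, ∫ z, monomial γ z • g z = 0}
  zero_mem' := by intro γ; simp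
  add_mem' := by
    intro f g hf hg γ
    have key : ∀ h : 𝓢(Bd d, ℂ), Integrable (fun z => monomial γ z • h z) := fun h => by
      have := (SchwartzMap.smulLeftCLM ℂ (monomial γ) h).integrable (μ := volume)
      simpa [SchwartzMap.smulLeftCLM_apply (monomial_hasTemperateGrowth γ)] using this
    have h1 := integral_add (key f) (key g)
    rw [hf γ, hg γ] at h1
    simpa [smul_add] using h1
  smul_mem' := by
    intro c f hf γ
    have h1 : ∀ z, monomial γ z • (c • f) z = c • (monomial γ z • f z) := fun z => by
      rw [smul_apply, smul_comm]
    simp only [h1]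
    rw [integral_smul, hf γ, smul_zero]

/-- The dual space `𝒮̇'(ℝ^{n-1})`. -/
abbrev SDot' (d : ℕ) := SDot d →L[ℂ] ℂ

theorem eventually_fourierInv_smul {d : ℕ} (i : Fin d) (g : 𝓢(Bd d, ℂ))
    (hg : ∀ᶠ ξ in nhds 0, (𝓕⁻ g : 𝓢(Bd d, ℂ)) ξ = 0) :
    ∀ᶠ ξ in nhds 0, (𝓕⁻ (SchwartzMap.smulLeftCLM ℂ (fun z : Bd d => z i) g) : 𝓢(Bd d, ℂ)) ξ
      = 0 := by
  have h1 := SchwartzMap.lineDerivOp_fourierInv_eq g (EuclideanSpace.single i (1 : ℝ))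
  have h2 : (fun z : Bd d => inner ℝ z (EuclideanSpace.single i (1 : ℝ)))
      = fun z : Bd d => z i := by
    funext z; simp [EuclideanSpace.inner_single_right]
  rw [h2, FourierTransform.fourierInv_smul] at h1
  have h3 : ((𝓕⁻ g : 𝓢(Bd d, ℂ)) : Bd d → ℂ) =ᶠ[nhds 0] (fun _ => (0 : ℂ)) := hg
  have h4 := h3.fderiv (𝕜 := ℝ)
  filter_upwards [h4] with ξ hξ
  have h5 := DFunLike.congr_fun h1 ξ
  rw [SchwartzMap.lineDerivOp_apply_eq_fderiv, hξ, smul_apply] at h5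
  have h6 : (2 * (Real.pi : ℂ) * Complex.I) ≠ 0 := by
    simp [Real.pi_ne_zero, Complex.I_ne_zero]
  simp only [fderiv_fun_const, Pi.zero_apply, zero_apply, smul_eq_mul] at h5
  exact (mul_eq_zero.mp h5.symm).resolve_left h6

/-- Schwartz functions whose Fourier transform vanishes near the origin have vanishing moments. -/
theorem mem_SDot_of_eventually {d : ℕ} (g : 𝓢(Bd d, ℂ))
    (hg : ∀ᶠ ξ in nhds 0, (𝓕⁻ g : 𝓢(Bd d, ℂ)) ξ = 0) : g ∈ SDot d := by
  intro γ
  have hc : ∀ i : Fin d, (fun z : Bd d => z i).HasTemperateGrowth := fun i =>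
    (EuclideanSpace.proj (𝕜 := ℝ) i).hasTemperateGrowth
  have hpow : ∀ (i : Fin d) (m : ℕ) (g : 𝓢(Bd d, ℂ)),
      (∀ᶠ ξ in nhds 0, (𝓕⁻ g : 𝓢(Bd d, ℂ)) ξ = 0) →
      ∃ h : 𝓢(Bd d, ℂ), (∀ z, h z = (z i ^ m) • g z) ∧
        ∀ᶠ ξ in nhds 0, (𝓕⁻ h : 𝓢(Bd d, ℂ)) ξ = 0 := by
    intro i m g hg
    induction m with
    | zero => exact ⟨g, by simp, hg⟩
    | succ m ih =>
      obtain ⟨h, h1, h2⟩ := ih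
      refine ⟨SchwartzMap.smulLeftCLM ℂ (fun z : Bd d => z i) h, fun z => ?_,
        eventually_fourierInv_smul i h h2⟩
      rw [SchwartzMap.smulLeftCLM_apply_apply (hc i), h1, smul_smul, pow_succ']
  have hprod : ∀ s : Finset (Fin d), ∃ h : 𝓢(Bd d, ℂ),
      (∀ z, h z = (∏ i ∈ s, z i ^ γ i) • g z) ∧
        ∀ᶠ ξ in nhds 0, (𝓕⁻ h : 𝓢(Bd d, ℂ)) ξ = 0 := by
    intro s
    induction s using Finset.induction_on with
    | empty => exact ⟨g, by simp, hg⟩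
    | insert a s ha ih =>
      obtain ⟨h, h1, h2⟩ := ih
      obtain ⟨k, k1, k2⟩ := hpow a (γ a) h h2
      exact ⟨k, fun z => by rw [k1, h1, smul_smul, Finset.prod_insert ha], k2⟩
  obtain ⟨h, h1, h2⟩ := hprod Finset.univ
  have h3 := h2.self_of_nhds
  rw [SchwartzMap.fourierInv_coe, Real.fourierInv_eq] at h3
  simp only [inner_zero_right, AddChar.map_zero_eq_one, one_smul] at h3
  simpa only [monomial, h1] using h3

/-! ### Littlewood-Paley blocks and the homogeneous Triebel-Lizorkin quasi-norm -/

/-- A smooth cut-off function, equal to `1` for `|ξ| ≤ 1` and to `0` for `|ξ| > 2`. -/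
structure Cutoff (d : ℕ) where
  toFun : Bd d → ℝ
  smooth : ContDiff ℝ ∞ toFun
  eq_one : ∀ ξ, ‖ξ‖ ≤ 1 → toFun ξ = 1
  eq_zero : ∀ ξ, 2 < ‖ξ‖ → toFun ξ = 0

instance (d : ℕ) : Nonempty (Cutoff d) := by
  let b : ContDiffBump (0 : Bd d) := ⟨1, 2, one_pos, one_lt_two⟩
  refine ⟨⟨b, b.contDiff, fun ξ h => b.one_of_mem_closedBall (by simpa using h), fun ξ h => ?_⟩⟩
  exact b.zero_of_le_dist (by simpa using h.le)

variable {d : ℕ}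

/-- `ψ_j(ξ) = ψ(2^{-j} ξ)` with `ψ(ξ) = φ(ξ) - φ(2ξ)`. -/
def psi (φ : Cutoff d) (j : ℤ) (ξ : Bd d) : ℝ :=
  φ.toFun ((2 : ℝ) ^ (-j) • ξ) - φ.toFun ((2 : ℝ) • (2 : ℝ) ^ (-j) • ξ)

theorem psi_contDiff (φ : Cutoff d) (j : ℤ) : ContDiff ℝ ∞ (psi φ j) := by
  unfold psi
  exact (φ.smooth.comp (contDiff_const_smul _)).sub
    (φ.smooth.comp ((contDiff_const_smul _).comp (contDiff_const_smul _)))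

theorem psi_eq_zero_of_large (φ : Cutoff d) (j : ℤ) (ξ : Bd d)
    (h : 2 < (2 : ℝ) ^ (-j) * ‖ξ‖) : psi φ j ξ = 0 := by
  have hp : (0 : ℝ) < (2 : ℝ) ^ (-j) := by positivity
  have h1 : ‖(2 : ℝ) ^ (-j) • ξ‖ = (2 : ℝ) ^ (-j) * ‖ξ‖ := by
    rw [norm_smul, Real.norm_of_nonneg hp.le]
  unfold psi
  rw [φ.eq_zero _ (by rw [h1]; exact h), φ.eq_zero _ (by
    rw [norm_smul, h1, Real.norm_of_nonneg zero_le_two]; linarith), sub_zero]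

theorem psi_eq_zero_of_small (φ : Cutoff d) (j : ℤ) (ξ : Bd d)
    (h : (2 : ℝ) ^ (-j) * ‖ξ‖ ≤ 1 / 2) : psi φ j ξ = 0 := by
  have hp : (0 : ℝ) < (2 : ℝ) ^ (-j) := by positivity
  have h1 : ‖(2 : ℝ) ^ (-j) • ξ‖ = (2 : ℝ) ^ (-j) * ‖ξ‖ := by
    rw [norm_smul, Real.norm_of_nonneg hp.le]
  unfold psi
  rw [φ.eq_one _ (by rw [h1]; linarith), φ.eq_one _ (by
    rw [norm_smul, h1, Real.norm_of_nonneg zero_le_two]; linarith), sub_self]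

theorem psi_hasCompactSupport (φ : Cutoff d) (j : ℤ) : HasCompactSupport (psi φ j) := by
  have hp : (0 : ℝ) < (2 : ℝ) ^ (-j) := by positivity
  refine HasCompactSupport.intro (isCompact_closedBall (0 : Bd d) (2 / (2 : ℝ) ^ (-j)))
    fun ξ hξ => psi_eq_zero_of_large φ j ξ ?_
  have h1 : 2 / (2 : ℝ) ^ (-j) < ‖ξ‖ := by simpa using hξ
  rw [div_lt_iff₀ hp] at h1
  linarith

/-- `ξ ↦ e^{2πi x·ξ} ψ_j(ξ)` as a Schwartz function. -/
def modPsi (φ : Cutoff d) (j : ℤ) (x : Bd d) : 𝓢(Bd d, ℂ) :=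
  HasCompactSupport.toSchwartzMap
    (f := fun ξ => Complex.exp (((2 * Real.pi * ⟪ξ, x⟫ : ℝ) : ℂ) * Complex.I) * (psi φ j ξ : ℂ))
    (((psi_hasCompactSupport φ j).comp_left (g := Complex.ofReal) Complex.ofReal_zero).mul_left)
    (by
      refine ContDiff.mul (ContDiff.cexp (ContDiff.mul ?_ contDiff_const))
        (Complex.ofRealCLM.contDiff.comp (psi_contDiff φ j))
      exact Complex.ofRealCLM.contDiff.comp
        (contDiff_const.mul (contDiff_id.inner ℝ contDiff_const)))

/-- The test function `y ↦ (𝓕⁻¹ψ_j)(x - y)`; see `lpTest_apply`. -/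
def lpTest (φ : Cutoff d) (j : ℤ) (x : Bd d) : SDot d :=
  ⟨𝓕 (modPsi φ j x), mem_SDot_of_eventually _ (by
    have hp : (0 : ℝ) < (2 : ℝ) ^ (-j) := by positivity
    have h0 : ∀ᶠ ξ : Bd d in nhds 0, (2 : ℝ) ^ (-j) * ‖ξ‖ < 1 / 2 := by
      have hc : Continuous fun ξ : Bd d => (2 : ℝ) ^ (-j) * ‖ξ‖ := by fun_prop
      exact hc.continuousAt.eventually_lt continuousAt_const (by simp)
    filter_upwards [h0] with ξ hξ
    rw [FourierTransform.fourierInv_fourier_eq]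
    change Complex.exp _ * (psi φ j ξ : ℂ) = 0
    rw [psi_eq_zero_of_small φ j ξ hξ.le]
    simp)⟩

theorem lpTest_apply (φ : Cutoff d) (j : ℤ) (x y : Bd d) :
    (lpTest φ j x : 𝓢(Bd d, ℂ)) y = 𝓕⁻ (fun ξ => (psi φ j ξ : ℂ)) (x - y) := by
  change (𝓕 (modPsi φ j x) : 𝓢(Bd d, ℂ)) y = _
  rw [SchwartzMap.fourier_coe, Real.fourier_eq', Real.fourierInv_eq']
  congr 1
  funext ξ
  change _ • (Complex.exp _ * (psi φ j ξ : ℂ)) = _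
  rw [smul_eq_mul, smul_eq_mul, ← mul_assoc, ← Complex.exp_add, inner_sub_right]
  congr 2
  push_cast
  ring

/-- The homogeneous Littlewood-Paley block `Δ̇_j f = 𝓕⁻¹(ψ_j 𝓕f)` of `f ∈ 𝒮̇'`, which is the smooth
function `x ↦ ⟨f, (𝓕⁻¹ψ_j)(x - ·)⟩`. -/
def lpBlock (φ : Cutoff d) (j : ℤ) (f : SDot' d) (x : Bd d) : ℂ := f (lpTest φ j x)

/-- The norm `‖f‖_{Ḟ^s_{p,q}} = ‖ (∑_{j ∈ ℤ} (2^{js} |Δ̇_j f|)^q)^{1/q} ‖_{L^p}`, with value `∞` if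
`f` is not in the space. -/
def tlNorm (φ : Cutoff d) (s p q : ℝ) (f : SDot' d) : ℝ≥0∞ :=
  eLpNorm (fun x => (∑' j : ℤ,
    (ENNReal.ofReal ((2 : ℝ) ^ ((j : ℝ) * s)) * ‖lpBlock φ j f x‖ₑ) ^ q) ^ (1 / q))
    (ENNReal.ofReal p) volume

/-! ### Tent spaces -/

/-- The open half-space `ℝⁿ₊`. -/
def halfSpace (d : ℕ) : Set (Bd d × ℝ) := {y | 0 < y.2}

/-- The cone `Γ(x') = {(y', yₙ) ∈ ℝⁿ₊ : |x' - y'| < yₙ}`. -/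
def cone (x : Bd d) : Set (Bd d × ℝ) := {y | 0 < y.2 ∧ ‖x - y.1‖ < y.2}

variable {V : Type*} [NormedAddCommGroup V] [NormedSpace ℝ V]

/-- `𝒜_q F(x') = (∬_{Γ(x')} |F(y', yₙ)|^q yₙ^{-(n-1)} dy' dyₙ)^{1/q}`. -/
def conical (q : ℝ) (F : Bd d × ℝ → V) (x : Bd d) : ℝ≥0∞ :=
  (∫⁻ y in cone x, ‖F y‖ₑ ^ q * ENNReal.ofReal (y.2 ^ (-(d : ℝ)))) ^ (1 / q)

/-- `‖F‖_{T^{p,q}} = ‖𝒜_q F‖_{L^p(ℝ^{n-1})}`. -/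
def tentNorm (p q : ℝ) (F : Bd d × ℝ → V) : ℝ≥0∞ :=
  eLpNorm (conical q F) (ENNReal.ofReal p) volume

/-- `‖F‖_{T^{p,q}_s} = ‖yₙ^{-(n-1)s} F‖_{T^{p,q}}`. -/
def weightedTentNorm (s p q : ℝ) (F : Bd d × ℝ → V) : ℝ≥0∞ :=
  tentNorm p q (fun y => (y.2 ^ (-(d : ℝ) * s)) • F y)

/-- `sup_{xₙ > 0} xₙ^a ‖F(·, xₙ)‖_{L^∞(ℝ^{n-1})}`. -/
def weightedSup (a : ℝ) (F : Bd d × ℝ → V) : ℝ≥0∞ :=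
  ⨆ (t : ℝ) (_ : 0 < t), ENNReal.ofReal (t ^ a) * eLpNorm (fun x => F (x, t)) ∞ volume

/-- The exponent `p = (n-1) q (q-1)`. -/
def expP (d : ℕ) (q : ℝ) : ℝ := d * q * (q - 1)

/-- The norm of `𝐗^q`. -/
def xNorm (q : ℝ) (u : Bd d × ℝ → V) : ℝ≥0∞ :=
  weightedSup (1 / (q - 1)) u + tentNorm (expP d q) q u

/-- The norm of `𝐙^q`. -/
def zNorm (q : ℝ) (π : Bd d × ℝ → V) : ℝ≥0∞ :=
  weightedTentNorm (-1 / (d : ℝ)) (expP d q) q π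

/-! ### The Odqvist kernels -/

/-- The point `(x', xₙ)` of `ℝⁿ`. -/
def point (x : Bd d) (t : ℝ) : EuclideanSpace ℝ (Fin (d + 1)) :=
  WithLp.toLp 2 (Fin.snoc (α := fun _ => ℝ) (fun i => x i) t)

/-- The surface area of the unit sphere of `ℝⁿ`, `n = d + 1`. -/
def sphereArea (d : ℕ) : ℝ :=
  (volume : Measure (EuclideanSpace ℝ (Fin (d + 1)))).toSphere.real univ

/-- `K_{ij}(z) = (2n/ω) zₙ zᵢ zⱼ / |z|^{n+2}`. -/
def velKernel (i j : Fin (d + 1)) (z : EuclideanSpace ℝ (Fin (d + 1))) : ℝ :=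
  2 * ((d : ℝ) + 1) / sphereArea d * (z (Fin.last d) * z i * z j / ‖z‖ ^ (d + 3))

/-- `k_j(z) = (1/ω) ∂_j (4 zₙ / |z|^n)`; see `presKernel_eq` for the explicit form. -/
def presKernel (j : Fin (d + 1)) (z : EuclideanSpace ℝ (Fin (d + 1))) : ℝ :=
  1 / sphereArea d *
    lineDeriv ℝ (fun w : EuclideanSpace ℝ (Fin (d + 1)) => 4 * w (Fin.last d) / ‖w‖ ^ (d + 1)) z
      (EuclideanSpace.single j 1)

theorem presKernel_eq (j : Fin (d + 1)) (z : EuclideanSpace ℝ (Fin (d + 1))) (hz : z ≠ 0) :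
    presKernel j z = 4 / sphereArea d * ((if j = Fin.last d then 1 else 0) / ‖z‖ ^ (d + 1)
      - ((d : ℝ) + 1) * z (Fin.last d) * z j / ‖z‖ ^ (d + 3)) := by
  have hn : ‖z‖ ≠ 0 := norm_ne_zero_iff.mpr hz
  have hl : HasDerivAt
      (fun s : ℝ => z + s • (EuclideanSpace.single j 1 : EuclideanSpace ℝ (Fin (d + 1))))
      (EuclideanSpace.single j 1) 0 := by
    simpa using ((hasDerivAt_id (0 : ℝ)).smul_const
      (EuclideanSpace.single j 1 : EuclideanSpace ℝ (Fin (d + 1)))).const_add z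
  have h1 : HasDerivAt (fun s : ℝ => ‖z + s • (EuclideanSpace.single j 1 :
      EuclideanSpace ℝ (Fin (d + 1)))‖) (z j / ‖z‖) 0 := by
    have h := hl.norm_sq.sqrt (by simpa using hn)
    simp only [Real.sqrt_sq (norm_nonneg _), zero_smul, add_zero] at h
    refine h.congr_deriv ?_
    rw [EuclideanSpace.inner_single_right]
    simp
    field_simp
  have h2 : HasDerivAt (fun s : ℝ => 4 * (z + s • (EuclideanSpace.single j 1 :
      EuclideanSpace ℝ (Fin (d + 1)))) (Fin.last d))
      (4 * (if j = Fin.last d then 1 else 0)) 0 := by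
    have h := (((hasDerivAt_id (0 : ℝ)).mul_const
      ((EuclideanSpace.single j 1 : EuclideanSpace ℝ (Fin (d + 1))) (Fin.last d))).const_add
        (z (Fin.last d))).const_mul 4
    refine h.congr_deriv ?_
    simp [PiLp.single_apply, eq_comm]
  have h3 := h2.div (h1.pow (d + 1)) (by simpa using hn)
  unfold presKernel lineDeriv
  have h4 := h3.deriv
  rw [show (fun s : ℝ => 4 * (z + s • (EuclideanSpace.single j 1 :
      EuclideanSpace ℝ (Fin (d + 1)))) (Fin.last d) /
      ‖z + s • (EuclideanSpace.single j 1 : EuclideanSpace ℝ (Fin (d + 1)))‖ ^ (d + 1)) =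
      (fun s : ℝ => 4 * (z + s • (EuclideanSpace.single j 1 :
      EuclideanSpace ℝ (Fin (d + 1)))) (Fin.last d)) / (fun s : ℝ => ‖z + s •
      (EuclideanSpace.single j 1 : EuclideanSpace ℝ (Fin (d + 1)))‖) ^ (d + 1) from rfl, h4]
  simp only [Pi.pow_apply, zero_smul, add_zero, Nat.add_sub_cancel]
  push_cast
  by_cases hj : j = Fin.last d
  · simp only [hj, if_true]
    field_simp
    ring
  · simp only [hj, if_false]
    field_simp
    ring

/-! ### Convolution of a distribution with an integrable kernel -/

/-- The convolution `κ ∗ f` of `f ∈ 𝒮̇'` with an integrable kernel `κ`, as a function: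
`(κ ∗ f)(x) = ∑_{k ∈ ℤ} (κ ∗ Δ̇_k f)(x)`, the blocks `Δ̇_k f` being functions with
`f = ∑_k Δ̇_k f` in `𝒮̇'`. -/
def conv (φ : Cutoff d) (κ : Bd d → ℝ) (f : SDot' d) (x : Bd d) : ℂ :=
  ∑' k : ℤ, ∫ y, κ (x - y) • lpBlock φ k f y

/-- All the integrals and the series in the definition of `(κ ∗ f)(x)` converge absolutely. -/
def ConvConverges (φ : Cutoff d) (κ : Bd d → ℝ) (f : SDot' d) (x : Bd d) : Prop :=
  (∀ k : ℤ, Integrable fun y => κ (x - y) • lpBlock φ k f y) ∧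
    Summable fun k : ℤ => ‖∫ y, κ (x - y) • lpBlock φ k f y‖

/-- The function `u` is the distributional convolution `κ ∗ f ∈ 𝒮̇'`, that is,
`⟨u, g⟩ = ⟨f, h⟩` with `h = κ(-·) ∗ g`, for all `g ∈ 𝒮̇`. The Odqvist kernels map `𝒮̇` into itself:
their Fourier transforms in `x'` are `e^{-t|ξ|}` times combinations of `1`, `ξᵢ`, `t ξᵢ`, `|ξ|`,
`t |ξ|`, `t ξᵢ ξⱼ / |ξ|`, so such an `h` exists for every `g`. -/
def IsConv (κ : Bd d → ℝ) (f : SDot' d) (u : Bd d → ℂ) : Prop :=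
  ∀ g : SDot d, Integrable (fun x => u x * (g : 𝓢(Bd d, ℂ)) x) ∧
    ∀ h : SDot d, (∀ y, (h : 𝓢(Bd d, ℂ)) y = ∫ x, κ (x - y) • (g : 𝓢(Bd d, ℂ)) x) →
      ∫ x, u x * (g : 𝓢(Bd d, ℂ)) x = f h

/-- The Stokes extension `ℋf(x', xₙ) = (𝒦_{xₙ} ∗ f)(x')`. -/
def stokesExt (φ : Cutoff d) (f : Fin (d + 1) → SDot' d) (y : Bd d × ℝ) :
    EuclideanSpace ℂ (Fin (d + 1)) :=
  WithLp.toLp 2 fun i => ∑ j, conv φ (fun x => velKernel i j (point x y.2)) (f j) y.1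

/-- The pressure extension `ℰf(x', xₙ) = (k_{xₙ} ∗ f)(x')`. -/
def presExt (φ : Cutoff d) (f : Fin (d + 1) → SDot' d) (y : Bd d × ℝ) : ℂ :=
  ∑ j, conv φ (fun x => presKernel j (point x y.2)) (f j) y.1

end StokesLin

end

open StokesLin

/-!
At height `t`, the Odqvist kernels of the half-space in dimension `n = d + 1` are dilates
`κ_t(x) = t^{-d} κ(x/t)` (with a further factor `t⁻¹` for the pressure, absorbed by the weights in
the norms), where `κ` is smooth on `ℝ^d` and, with all its derivatives, dominated by the Poisson
weight `pw 1 x = (1 + |x|)^{-(d+1)}`. The class `KernelClass` records this. Everything rests on one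
estimate for the convolution with a Littlewood-Paley block,
`|κ_t ∗ Δ̇_k f| ≤ C min(1, (2^k t)^{-M}) (pw t ∗ |Δ̇_k f|)`, which is
`exists_enorm_integral_dil_lpBlock_le`. For `2^k t ≤ 1` it is the size of the kernel. For
`2^k t ≥ 1` the block is reproduced by a kernel whose Fourier transform lives in the annulus
`|ξ| ∼ 2^k`; such a function is a divergence of functions of the same kind, so that `M` integrations
by parts put `M` derivatives on `κ_t`, each at the price of a factor `t⁻¹` and a gain of `2^{-k}`.
Summation over `k` bounds velocity and (`t` times the) pressure by the `majorant` of the blocks, and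
both halves of the estimate are statements about majorants.

*Supremum.* The reproducing formula and Jensen's inequality give Bernstein's inequality
`‖Δ̇_k f‖_∞ ≤ C 2^{k/(q-1)} ‖f‖`, because `1/q + d/p = 1/(q-1)` for `p = d q (q-1)`. The dyadic sum
`∑_k min(1, (2^k t)^{-M}) 2^{k/(q-1)}` is of size `t^{-1/(q-1)}`.

*Tent norm.* Jensen's inequality linearises the `q`-th power of the majorant
(`exists_majorant_rpow_le`), and on the cone over `x` the averages against `pw t` are comparable to
their values at `x`. The hypothesis on `q` gives `p > q`, so the `L^{p/q}` norm may be computed by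
duality: the averages are moved to the test function `g`, where they are dominated by its
Hardy-Littlewood maximal function, and integration in `t` turns the weight at frequency `2^k` into
`2^{-k}`, the weight of the norm of `Ḟ^{-1/q}_{p,q}`. The result is
`exists_lintegral_cone_majorant_le`; it uses the maximal theorem for the exponent dual to `p/q`,
which is proved here from Vitali's covering lemma and a dyadic form of Marcinkiewicz interpolation.

*Convolutions.* The same majorant gives absolute convergence, uniformly in `x`, of the series
defining `κ_t ∗ f`. To identify its sum with the distributional convolution (`isConv_dil`), `f` is
extended to a tempered distribution `B` by Hahn-Banach. The pairing of `h ∈ 𝒮` with a block is then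
`B` evaluated at the convolution of `h` with a Schwartz function
(`integral_mul_tempered_compSubConst`), and if all moments of `h` vanish, the sum of these
convolutions over all blocks converges to `h` in `𝒮`: on the Fourier side it is the product of
`𝓕⁻¹h`, which is flat at the origin, with cut-offs to growing annuli.
-/

noncomputable section

namespace StokesLin

variable {d : ℕ}

/-! ### The Hardy-Littlewood maximal function -/

/-- The centred Hardy-Littlewood maximal function of `g ≥ 0` over balls of dyadic radii `2^m`,
normalized by `(2^m)^d` instead of the volume of the ball. Dyadic radii make it a countable
supremum of measurable functions. -/
def maxFn (g : Bd d → ℝ≥0∞) (x : Bd d) : ℝ≥0∞ :=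
  ⨆ m : ℤ, (∫⁻ y in Metric.closedBall x ((2 : ℝ) ^ m), g y) / ENNReal.ofReal (((2 : ℝ) ^ m) ^ d)

theorem volume_closedBall_eq (x : Bd d) {r : ℝ} (hr : 0 ≤ r) :
    volume (Metric.closedBall x r)
      = ENNReal.ofReal (r ^ d) * volume (Metric.ball (0 : Bd d) 1) := by
  rw [Measure.addHaar_closedBall _ _ hr, finrank_euclideanSpace_fin]

theorem measurable_maxFn {g : Bd d → ℝ≥0∞} (hg : Measurable g) : Measurable (maxFn g) := by
  refine Measurable.iSup fun m => Measurable.div_const ?_ _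
  have h1 : ∀ x : Bd d, (∫⁻ y in Metric.closedBall x ((2 : ℝ) ^ m), g y)
      = ∫⁻ y, {z : Bd d × Bd d | dist z.2 z.1 ≤ (2 : ℝ) ^ m}.indicator (fun z => g z.2) (x, y) := by
    intro x
    rw [← lintegral_indicator Metric.isClosed_closedBall.measurableSet]
    rfl
  simp_rw [h1]
  refine Measurable.lintegral_prod_right' (f := fun z =>
    {z : Bd d × Bd d | dist z.2 z.1 ≤ (2 : ℝ) ^ m}.indicator (fun z => g z.2) z) ?_
  exact (hg.comp measurable_snd).indicator
    (measurableSet_le (measurable_snd.dist measurable_fst) measurable_const)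

/-- The weak type `(1,1)` inequality, by the Vitali covering lemma. -/
theorem mul_volume_maxFn_gt_le (hd : 1 ≤ d) (g : Bd d → ℝ≥0∞) (lam : ℝ≥0∞) :
    lam * volume {x | lam < maxFn g x}
      ≤ ENNReal.ofReal (4 ^ d) * volume (Metric.ball (0 : Bd d) 1) * ∫⁻ y, g y := by
  set I := ∫⁻ y, g y with hI
  have hV : volume (Metric.ball (0 : Bd d) 1) ≠ 0 :=
    (Metric.measure_ball_pos volume _ one_pos).ne'
  rcases eq_or_ne I ⊤ with hItop | hItop
  · rw [hItop, ENNReal.mul_top]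
    · exact le_top
    · exact mul_ne_zero (by simp) hV
  rcases eq_or_ne lam 0 with h0 | h0
  · simp [h0]
  rcases eq_or_ne lam ⊤ with htop | htop
  · simp [htop]
  set t := {x | lam < maxFn g x} with ht
  -- at each point of the level set some dyadic ball carries a large average
  have hex : ∀ x ∈ t, ∃ m : ℤ, lam * ENNReal.ofReal (((2 : ℝ) ^ m) ^ d)
      < ∫⁻ y in Metric.closedBall x ((2 : ℝ) ^ m), g y := by
    intro x hx
    obtain ⟨m, hm⟩ := lt_iSup_iff.mp (show lam < maxFn g x from hx)
    refine ⟨m, ?_⟩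
    rwa [ENNReal.lt_div_iff_mul_lt (Or.inl (by simp; positivity))
      (Or.inl ENNReal.ofReal_ne_top)] at hm
  choose! m hm using hex
  -- the radii are bounded because `g` is integrable and `d ≥ 1`
  have hR : ∀ x ∈ t, (2 : ℝ) ^ (m x) ≤ max 1 (I / lam).toReal := by
    intro x hx
    rcases le_total ((2 : ℝ) ^ (m x)) 1 with h | h
    · exact h.trans (le_max_left _ _)
    · refine le_trans ?_ (le_max_right _ _)
      have h1 : lam * ENNReal.ofReal (((2 : ℝ) ^ m x) ^ d) ≤ I :=
        (hm x hx).le.trans (setLIntegral_le_lintegral _ _)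
      have h2 : ENNReal.ofReal (((2 : ℝ) ^ m x) ^ d) ≤ I / lam := by
        rw [ENNReal.le_div_iff_mul_le (Or.inl h0) (Or.inl htop), mul_comm]; exact h1
      have h3 := (ENNReal.ofReal_le_iff_le_toReal (ENNReal.div_ne_top hItop h0)).mp h2
      exact (le_self_pow₀ h (by omega)).trans h3
  obtain ⟨u, hut, hdisj, hcov⟩ := Vitali.exists_disjoint_subfamily_covering_enlargement_closedBall
    t (fun x : Bd d => x) (fun x => (2 : ℝ) ^ (m x)) _ hR 4 (by norm_num)
  have hcount : u.Countable := hdisj.countable_of_nonempty_interior fun x _ => by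
    refine ⟨x, interior_mono Metric.ball_subset_closedBall ?_⟩
    rw [Metric.isOpen_ball.interior_eq]
    exact Metric.mem_ball_self (by positivity)
  have hsub : t ⊆ ⋃ b ∈ u, Metric.closedBall b (4 * (2 : ℝ) ^ (m b)) := by
    intro x hx
    obtain ⟨b, hb, hb2⟩ := hcov x hx
    exact mem_biUnion hb (hb2 (Metric.mem_closedBall_self (by positivity)))
  calc lam * volume t
      ≤ lam * ∑' b : u, volume (Metric.closedBall (b : Bd d) (4 * (2 : ℝ) ^ (m b))) := by
        gcongr
        exact (measure_mono hsub).trans (measure_biUnion_le _ hcount _)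
    _ = ∑' b : u, ENNReal.ofReal (4 ^ d) * volume (Metric.ball (0 : Bd d) 1)
          * (lam * ENNReal.ofReal (((2 : ℝ) ^ m (b : Bd d)) ^ d)) := by
        rw [← ENNReal.tsum_mul_left]
        refine tsum_congr fun b => ?_
        rw [volume_closedBall_eq _ (by positivity), mul_pow, ENNReal.ofReal_mul (by positivity)]
        ring
    _ ≤ ∑' b : u, ENNReal.ofReal (4 ^ d) * volume (Metric.ball (0 : Bd d) 1)
          * ∫⁻ y in Metric.closedBall (b : Bd d) ((2 : ℝ) ^ m (b : Bd d)), g y :=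
        ENNReal.tsum_le_tsum fun b => mul_le_mul_right (hm b (hut b.2)).le _
    _ = ENNReal.ofReal (4 ^ d) * volume (Metric.ball (0 : Bd d) 1)
          * ∫⁻ y in ⋃ b ∈ u, Metric.closedBall (b : Bd d) ((2 : ℝ) ^ m (b : Bd d)), g y := by
        rw [ENNReal.tsum_mul_left, lintegral_biUnion hcount
          (fun b _ => Metric.isClosed_closedBall.measurableSet) hdisj]
    _ ≤ _ := by
        gcongr
        exact setLIntegral_le_lintegral _ _

theorem maxFn_le_of_le {g : Bd d → ℝ≥0∞} {b : ℝ≥0∞} (hg : ∀ y, g y ≤ b) (x : Bd d) :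
    maxFn g x ≤ b * volume (Metric.ball (0 : Bd d) 1) := by
  refine iSup_le fun m => ?_
  refine ENNReal.div_le_of_le_mul ?_
  calc ∫⁻ y in Metric.closedBall x ((2 : ℝ) ^ m), g y
      ≤ ∫⁻ y in Metric.closedBall x ((2 : ℝ) ^ m), b := lintegral_mono fun y => hg y
    _ = _ := by
        rw [setLIntegral_const, volume_closedBall_eq _ (by positivity)]; ring

theorem maxFn_add_le {g h : Bd d → ℝ≥0∞} (hg : Measurable g) (x : Bd d) :
    maxFn (fun y => g y + h y) x ≤ maxFn g x + maxFn h x := by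
  refine iSup_le fun m => ?_
  rw [lintegral_add_left hg, ENNReal.add_div]
  exact add_le_add (le_iSup (fun m : ℤ => (∫⁻ y in Metric.closedBall x ((2 : ℝ) ^ m), g y)
    / ENNReal.ofReal (((2 : ℝ) ^ m) ^ d)) m) (le_iSup (fun m : ℤ =>
    (∫⁻ y in Metric.closedBall x ((2 : ℝ) ^ m), h y) / ENNReal.ofReal (((2 : ℝ) ^ m) ^ d)) m)

/-! ### Dyadic sums -/

/-- The decay factor `min(1, s^{-M})`. -/
def decay (M : ℕ) (s : ℝ) : ℝ := min 1 ((s ^ M)⁻¹)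

theorem decay_nonneg (M : ℕ) {s : ℝ} (hs : 0 < s) : 0 ≤ decay M s :=
  le_min zero_le_one (by positivity)

/-- The dyadic sums `∑_k decay(2^k t) (2^k t)^a` are bounded uniformly in `t`: for `0 < a < M` they
are dominated by two geometric series. -/
theorem exists_tsum_decay_mul_rpow_le {M : ℕ} {a : ℝ} (ha : 0 < a) (haM : a < M) :
    ∃ C : ℝ≥0, ∀ t : ℝ, 0 < t →
      ∑' k : ℤ, ENNReal.ofReal (decay M ((2 : ℝ) ^ k * t) * ((2 : ℝ) ^ k * t) ^ a) ≤ C := by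
  set ρ : ℝ := 2 ^ (-(min a (M - a))) with hρ
  have hmin : 0 < min a (M - a) := lt_min ha (by linarith)
  have hρ0 : 0 < ρ := by positivity
  have hρ1 : ρ < 1 := Real.rpow_lt_one_of_one_lt_of_neg one_lt_two (by linarith)
  have hsum : Summable fun k : ℤ => 2 ^ a * ρ ^ k.natAbs := by
    refine Summable.mul_left _ ?_
    refine Summable.of_nat_of_neg ?_ ?_
    · simpa using summable_geometric_of_lt_one hρ0.le hρ1
    · simpa using summable_geometric_of_lt_one hρ0.le hρ1
  refine ⟨(∑' k : ℤ, 2 ^ a * ρ ^ k.natAbs).toNNReal, fun t ht => ?_⟩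
  -- shifting the index reduces to `t ∈ [1, 2)`
  obtain ⟨n, hn1, hn2⟩ := exists_mem_Ico_zpow (y := (2 : ℝ)) ht one_lt_two
  change _ ≤ ENNReal.ofReal _
  rw [ENNReal.ofReal_tsum_of_nonneg (fun k => by positivity) hsum,
    ← (Equiv.subRight n).tsum_eq (fun k : ℤ =>
      ENNReal.ofReal (decay M ((2 : ℝ) ^ k * t) * ((2 : ℝ) ^ k * t) ^ a))]
  refine ENNReal.tsum_le_tsum fun k => ENNReal.ofReal_le_ofReal ?_
  set τ : ℝ := t / 2 ^ n with hτ
  have h2n : (0 : ℝ) < 2 ^ n := by positivity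
  have hτ1 : 1 ≤ τ := by rw [hτ, le_div_iff₀ h2n]; linarith
  have hτ2 : τ ≤ 2 := by
    rw [hτ, div_le_iff₀ h2n]
    rw [zpow_add_one₀ two_ne_zero] at hn2; linarith
  have hs : (2 : ℝ) ^ ((Equiv.subRight n) k) * t = 2 ^ k * τ := by
    simp only [Equiv.subRight_apply, hτ, zpow_sub₀ (two_ne_zero' ℝ)]; ring
  rw [hs]
  have hτ0 : 0 < τ := by linarith
  have hk0 : (0 : ℝ) < 2 ^ k := by positivity
  rcases le_total 0 k with hk | hk
  · obtain ⟨j, rfl⟩ := Int.eq_ofNat_of_zero_le hk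
    have e1 : decay M ((2 : ℝ) ^ (j : ℤ) * τ) * ((2 : ℝ) ^ (j : ℤ) * τ) ^ a
        ≤ ((2 : ℝ) ^ (j : ℤ) * τ) ^ (-((M : ℝ) - a)) := by
      calc _ ≤ (((2 : ℝ) ^ (j : ℤ) * τ) ^ M)⁻¹ * ((2 : ℝ) ^ (j : ℤ) * τ) ^ a := by
            gcongr; exact min_le_right _ _
        _ = _ := by
            rw [← Real.rpow_natCast, ← Real.rpow_neg (by positivity),
              ← Real.rpow_add (by positivity)]
            congr 1; ring
    refine e1.trans ?_
    calc ((2 : ℝ) ^ (j : ℤ) * τ) ^ (-((M : ℝ) - a)) ≤ ((2 : ℝ) ^ (j : ℤ)) ^ (-((M : ℝ) - a)) := by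
          refine Real.rpow_le_rpow_of_nonpos hk0 ?_ (by linarith)
          exact le_mul_of_one_le_right hk0.le hτ1
      _ = (2 ^ (-((M : ℝ) - a))) ^ j := by
          rw [zpow_natCast, ← Real.rpow_natCast, ← Real.rpow_mul zero_le_two, mul_comm,
            Real.rpow_mul zero_le_two, Real.rpow_natCast]
      _ ≤ ρ ^ j := by
          exact pow_le_pow_left₀ (by positivity) (Real.rpow_le_rpow_of_exponent_le one_le_two
            (neg_le_neg (min_le_right _ _))) _
      _ ≤ 2 ^ a * ρ ^ (j : ℤ).natAbs := by
          rw [Int.natAbs_natCast]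
          exact le_mul_of_one_le_left (by positivity) (Real.one_le_rpow one_le_two ha.le)
  · obtain ⟨j, hj⟩ := Int.eq_ofNat_of_zero_le (neg_nonneg.mpr hk)
    have hkj : k = -(j : ℤ) := by omega
    subst hkj
    calc decay M ((2 : ℝ) ^ (-(j : ℤ)) * τ) * ((2 : ℝ) ^ (-(j : ℤ)) * τ) ^ a
        ≤ 1 * ((2 : ℝ) ^ (-(j : ℤ)) * 2) ^ a := by
          gcongr
          exact min_le_left _ _
      _ = 2 ^ a * (2 ^ (-a)) ^ j := by
          rw [one_mul, Real.mul_rpow (by positivity) zero_le_two, mul_comm]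
          congr 1
          rw [← Real.rpow_intCast, ← Real.rpow_mul zero_le_two, ← Real.rpow_natCast,
            ← Real.rpow_mul zero_le_two]
          congr 1; push_cast; ring
      _ ≤ 2 ^ a * ρ ^ (-(j : ℤ)).natAbs := by
          rw [Int.natAbs_neg, Int.natAbs_natCast]
          exact mul_le_mul_of_nonneg_left (pow_le_pow_left₀ (by positivity)
            (Real.rpow_le_rpow_of_exponent_le one_le_two (neg_le_neg (min_le_left _ _))) _)
            (by positivity)

/-- `∑_{2^k < X} 2^{kβ}` is comparable to its last term. -/
theorem exists_tsum_indicator_zpow_le {β : ℝ} (hβ : 0 < β) :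
    ∃ C : ℝ≥0, ∀ X : ℝ≥0∞, ∑' k : ℤ, (if ENNReal.ofReal ((2 : ℝ) ^ k) < X then
      ENNReal.ofReal (((2 : ℝ) ^ k) ^ β) else 0) ≤ C * X ^ β := by
  obtain ⟨M, hM⟩ := exists_nat_gt β
  obtain ⟨C, hC⟩ := exists_tsum_decay_mul_rpow_le hβ hM
  refine ⟨C + 1, fun X => ?_⟩
  rcases eq_or_ne X ⊤ with rfl | hX
  · rw [ENNReal.top_rpow_of_pos hβ, ENNReal.mul_top (by simp)]; exact le_top
  rcases eq_or_ne X 0 with rfl | hX0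
  · simp
  have hx : 0 < X.toReal := ENNReal.toReal_pos hX0 hX
  calc ∑' k : ℤ, (if ENNReal.ofReal ((2 : ℝ) ^ k) < X then
      ENNReal.ofReal (((2 : ℝ) ^ k) ^ β) else 0)
      ≤ ∑' k : ℤ, ENNReal.ofReal (decay M ((2 : ℝ) ^ k * (X.toReal)⁻¹)
          * ((2 : ℝ) ^ k * (X.toReal)⁻¹) ^ β) * X ^ β := by
        refine ENNReal.tsum_le_tsum fun k => ?_
        split_ifs with h
        · have h1 : (2 : ℝ) ^ k < X.toReal :=
            (ENNReal.ofReal_lt_iff_lt_toReal (by positivity) hX).mp h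
          have h2 : decay M ((2 : ℝ) ^ k * (X.toReal)⁻¹) = 1 := by
            refine min_eq_left (one_le_inv_iff₀.mpr ⟨by positivity, pow_le_one₀ (by positivity) ?_⟩)
            rw [← div_eq_mul_inv]; exact (div_le_one hx).mpr h1.le
          rw [h2, one_mul, Real.mul_rpow (by positivity) (by positivity),
            ENNReal.ofReal_mul (by positivity), Real.inv_rpow hx.le,
            ENNReal.ofReal_inv_of_pos (by positivity), mul_assoc,
            ← ENNReal.ofReal_rpow_of_pos hx, ENNReal.ofReal_toReal hX,
            ENNReal.inv_mul_cancel, mul_one]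
          · simp [hX0, hX]
          · exact ENNReal.rpow_ne_top_of_nonneg hβ.le hX
        · exact zero_le
    _ ≤ C * X ^ β := by
        rw [ENNReal.tsum_mul_right]; gcongr; exact hC _ (by positivity)
    _ ≤ _ := by gcongr; simp

/-! ### The maximal theorem -/

/-- A dyadic form of the layer-cake formula. -/
theorem rpow_le_tsum_zpow (X : ℝ≥0∞) {r : ℝ} (hr : 0 < r) :
    X ^ r ≤ ∑' k : ℤ, (if ENNReal.ofReal ((2 : ℝ) ^ k) < X then
      ENNReal.ofReal (((2 : ℝ) ^ (k + 1)) ^ r) else 0) := by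
  rcases eq_or_ne X 0 with rfl | hX0
  · simp [hr]
  rcases eq_or_ne X ⊤ with rfl | hX
  · refine le_of_forall_lt fun c hc => ?_
    have hc' : c ≠ ⊤ := by
      rw [ENNReal.top_rpow_of_pos hr] at hc; exact hc.ne
    have hlim : Filter.Tendsto (fun n : ℕ => ((2 : ℝ) ^ r) ^ (n + 1)) Filter.atTop Filter.atTop :=
      (tendsto_pow_atTop_atTop_of_one_lt (Real.one_lt_rpow one_lt_two hr)).comp
        (Filter.tendsto_add_atTop_nat 1)
    obtain ⟨n, hn⟩ := (hlim.eventually_gt_atTop c.toReal).exists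
    refine lt_of_lt_of_le ?_ (ENNReal.le_tsum (n : ℤ))
    rw [if_pos ENNReal.ofReal_lt_top]
    rw [ENNReal.lt_ofReal_iff_toReal_lt hc']
    have e : ((2 : ℝ) ^ ((n : ℤ) + 1)) ^ r = ((2 : ℝ) ^ r) ^ (n + 1) := by
      rw [show ((n : ℤ) + 1) = ((n + 1 : ℕ) : ℤ) by push_cast; rfl, zpow_natCast,
        ← Real.rpow_natCast, ← Real.rpow_natCast, ← Real.rpow_mul zero_le_two,
        ← Real.rpow_mul zero_le_two, mul_comm]
    rwa [e]
  · have hx : 0 < X.toReal := ENNReal.toReal_pos hX0 hX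
    obtain ⟨n, hn1, hn2⟩ := exists_mem_Ioc_zpow (y := (2 : ℝ)) hx one_lt_two
    refine le_trans ?_ (ENNReal.le_tsum n)
    rw [if_pos ((ENNReal.ofReal_lt_iff_lt_toReal (by positivity) hX).mpr hn1),
      ← ENNReal.ofReal_rpow_of_pos (by positivity)]
    gcongr
    exact (ENNReal.le_ofReal_iff_toReal_le hX (by positivity)).mpr hn2

/-- The maximal function is bounded on `L^r`, `1 < r < ∞`: Marcinkiewicz interpolation between
the weak type `(1,1)` bound and the trivial `L^∞` bound, over dyadic levels. -/
theorem exists_lintegral_maxFn_rpow_le (hd : 1 ≤ d) {r : ℝ} (hr : 1 < r) :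
    ∃ C : ℝ≥0, ∀ g : Bd d → ℝ≥0∞, Measurable g →
      ∫⁻ x, maxFn g x ^ r ≤ C * ∫⁻ x, g x ^ r := by
  obtain ⟨C₀, hC₀⟩ := exists_tsum_indicator_zpow_le (β := r - 1) (by linarith)
  set V := volume (Metric.ball (0 : Bd d) 1) with hVdef
  have hV0 : V ≠ 0 := (Metric.measure_ball_pos volume _ one_pos).ne'
  have hVt : V ≠ ⊤ := Metric.isBounded_ball.measure_lt_top.ne
  set K := ENNReal.ofReal (4 ^ d) * V with hK
  have hKt : K ≠ ⊤ := ENNReal.mul_ne_top ENNReal.ofReal_ne_top hVt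
  set D := ENNReal.ofReal (2 * 2 ^ r) * K * (C₀ * (2 * V) ^ (r - 1)) with hD
  have hDt : D ≠ ⊤ := by
    refine ENNReal.mul_ne_top (ENNReal.mul_ne_top ENNReal.ofReal_ne_top hKt)
      (ENNReal.mul_ne_top ENNReal.coe_ne_top (ENNReal.rpow_ne_top_of_nonneg (by linarith)
        (ENNReal.mul_ne_top (by simp) hVt)))
  refine ⟨D.toNNReal, fun g hg => ?_⟩
  rw [ENNReal.coe_toNNReal hDt]
  have hM := measurable_maxFn hg
  -- the part of `g` above the level `λ/(2V)` carries the maximal function above the level `λ`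
  have hlevel : ∀ k : ℤ, ENNReal.ofReal ((2 : ℝ) ^ k)
      * volume {x | ENNReal.ofReal ((2 : ℝ) ^ k) < maxFn g x}
      ≤ 2 * K * ∫⁻ y, {y | ENNReal.ofReal ((2 : ℝ) ^ k) < 2 * V * g y}.indicator g y := by
    intro k
    set lam := ENNReal.ofReal ((2 : ℝ) ^ k) with hlam
    have hS : MeasurableSet {y | lam < 2 * V * g y} :=
      measurableSet_lt measurable_const (hg.const_mul _)
    set S := {y | lam < 2 * V * g y} with hSdef
    have hsub : {x | lam < maxFn g x} ⊆ {x | lam / 2 < maxFn (S.indicator g) x} := by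
      intro x hx
      by_contra hcon
      have h1 : maxFn (S.indicator g) x ≤ lam / 2 := not_lt.mp hcon
      have h2 : maxFn (Sᶜ.indicator g) x ≤ lam / 2 := by
        have := maxFn_le_of_le (g := Sᶜ.indicator g) (b := lam / (2 * V)) (fun y => ?_) x
        · refine this.trans_eq ?_
          rw [← hVdef, ENNReal.div_eq_inv_mul,
            ENNReal.mul_inv (Or.inl (by simp)) (Or.inl (by simp)), ENNReal.div_eq_inv_mul]
          calc 2⁻¹ * V⁻¹ * lam * V = 2⁻¹ * lam * (V⁻¹ * V) := by ring
            _ = _ := by rw [ENNReal.inv_mul_cancel hV0 hVt, mul_one]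
        · by_cases hy : y ∈ S
          · simp [hy]
          · rw [indicator_of_mem (by exact hy)]
            rw [ENNReal.le_div_iff_mul_le (Or.inl (by simp [hV0]))
              (Or.inl (ENNReal.mul_ne_top (by simp) hVt)), mul_comm]
            exact not_lt.mp hy
      have h3 : maxFn g x ≤ lam := by
        have h4 : g = fun y => S.indicator g y + Sᶜ.indicator g y := by
          funext y; exact (congrFun (indicator_self_add_compl S g) y).symm
        rw [h4]
        exact (maxFn_add_le (hg.indicator hS) x).trans
          ((add_le_add h1 h2).trans_eq (ENNReal.add_halves lam))
      exact absurd hx (not_lt.mpr h3)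
    have h5 := mul_volume_maxFn_gt_le hd (S.indicator g) (lam / 2)
    calc lam * volume {x | lam < maxFn g x}
        = 2 * (lam / 2 * volume {x | lam < maxFn g x}) := by
          rw [← mul_assoc, ENNReal.mul_div_cancel (by simp) (by simp)]
      _ ≤ 2 * (lam / 2 * volume {x | lam / 2 < maxFn (S.indicator g) x}) := by gcongr
      _ ≤ 2 * (K * ∫⁻ y, S.indicator g y) := by gcongr
      _ = _ := by ring
  calc ∫⁻ x, maxFn g x ^ r
      ≤ ∫⁻ x, ∑' k : ℤ, (if ENNReal.ofReal ((2 : ℝ) ^ k) < maxFn g x then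
          ENNReal.ofReal (((2 : ℝ) ^ (k + 1)) ^ r) else 0) :=
        lintegral_mono fun x => rpow_le_tsum_zpow _ (by linarith)
    _ = ∑' k : ℤ, ENNReal.ofReal (((2 : ℝ) ^ (k + 1)) ^ r)
          * volume {x | ENNReal.ofReal ((2 : ℝ) ^ k) < maxFn g x} := by
        rw [lintegral_tsum fun k => (Measurable.ite (measurableSet_lt measurable_const hM)
          measurable_const measurable_const).aemeasurable]
        refine tsum_congr fun k => ?_
        rw [← lintegral_indicator_const (measurableSet_lt measurable_const hM)]
        refine lintegral_congr fun x => ?_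
        simp only [indicator_apply, mem_ofPred_eq]
    _ ≤ ∑' k : ℤ, ENNReal.ofReal (2 * 2 ^ r) * K * ∫⁻ y, g y *
          (if ENNReal.ofReal ((2 : ℝ) ^ k) < 2 * V * g y then
            ENNReal.ofReal (((2 : ℝ) ^ k) ^ (r - 1)) else 0) := by
        refine ENNReal.tsum_le_tsum fun k => ?_
        have hk0 : (0 : ℝ) < 2 ^ k := by positivity
        have e1 : ENNReal.ofReal (((2 : ℝ) ^ (k + 1)) ^ r)
            = ENNReal.ofReal (2 ^ r) * ENNReal.ofReal (((2 : ℝ) ^ k) ^ (r - 1))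
              * ENNReal.ofReal ((2 : ℝ) ^ k) := by
          rw [← ENNReal.ofReal_mul (by positivity), ← ENNReal.ofReal_mul (by positivity)]
          congr 1
          rw [zpow_add_one₀ two_ne_zero, Real.mul_rpow hk0.le zero_le_two,
            Real.rpow_sub_one hk0.ne']
          field_simp
        rw [e1, mul_assoc]
        refine (mul_le_mul_right (hlevel k) _).trans_eq ?_
        rw [ENNReal.ofReal_mul zero_le_two, ENNReal.ofReal_ofNat]
        have e2 : ∫⁻ y, g y * (if ENNReal.ofReal ((2 : ℝ) ^ k) < 2 * V * g y then
            ENNReal.ofReal (((2 : ℝ) ^ k) ^ (r - 1)) else 0)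
            = ENNReal.ofReal (((2 : ℝ) ^ k) ^ (r - 1)) *
              ∫⁻ y, {y | ENNReal.ofReal ((2 : ℝ) ^ k) < 2 * V * g y}.indicator g y := by
          rw [← lintegral_const_mul' _ _ ENNReal.ofReal_ne_top]
          refine lintegral_congr fun y => ?_
          by_cases h : ENNReal.ofReal ((2 : ℝ) ^ k) < 2 * V * g y
          · rw [if_pos h, indicator_of_mem (by exact h), mul_comm]
          · rw [if_neg h, indicator_of_notMem (by exact h), mul_zero, mul_zero]
        rw [e2]; ring
    _ = ENNReal.ofReal (2 * 2 ^ r) * K * ∫⁻ y, g y * ∑' k : ℤ,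
          (if ENNReal.ofReal ((2 : ℝ) ^ k) < 2 * V * g y then
            ENNReal.ofReal (((2 : ℝ) ^ k) ^ (r - 1)) else 0) := by
        rw [ENNReal.tsum_mul_left]
        congr 1
        have e4 := lintegral_tsum (μ := (volume : Measure (Bd d))) (f := fun (k : ℤ) y => g y *
          (if ENNReal.ofReal ((2 : ℝ) ^ k) < 2 * V * g y then
            ENNReal.ofReal (((2 : ℝ) ^ k) ^ (r - 1)) else 0)) fun k =>
          (hg.mul (Measurable.ite (measurableSet_lt measurable_const
            (hg.const_mul _)) measurable_const measurable_const)).aemeasurable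
        rw [← e4]
        exact lintegral_congr fun y => ENNReal.tsum_mul_left
    _ ≤ ENNReal.ofReal (2 * 2 ^ r) * K * ∫⁻ y, (C₀ * (2 * V) ^ (r - 1)) * g y ^ r := by
        refine mul_le_mul_right (lintegral_mono fun y => ?_) _
        refine (mul_le_mul_right (hC₀ _) _).trans_eq ?_
        rw [ENNReal.mul_rpow_of_nonneg _ _ (by linarith : 0 ≤ r - 1)]
        have e3 : g y ^ r = g y * g y ^ (r - 1) := by
          have e4 := ENNReal.rpow_add_of_nonneg (x := g y) 1 (r - 1) zero_le_one (by linarith)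
          rw [ENNReal.rpow_one] at e4
          rw [← e4]
          congr 1; ring
        rw [e3]; ring
    _ = D * ∫⁻ x, g x ^ r := by
        rw [lintegral_const_mul _ (hg.pow_const _), ← mul_assoc]

/-! ### Duality and Jensen's inequality -/

/-- If `∫ u g ≤ K ‖g‖_{s'}` for all `g`, then `‖u‖_s ≤ K`. -/
theorem lintegral_rpow_le_of_forall_lintegral_mul_le {s s' : ℝ} (hs : s.HolderConjugate s')
    {u : Bd d → ℝ≥0∞} (hu : Measurable u) {K : ℝ≥0∞}
    (h : ∀ g : Bd d → ℝ≥0∞, Measurable g → ∫⁻ x, u x * g x ≤ K * (∫⁻ x, g x ^ s') ^ (1 / s')) :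
    (∫⁻ x, u x ^ s) ^ (1 / s) ≤ K := by
  have hs0 : 0 < s := hs.pos
  have hs0' : 0 < s' := hs.symm.pos
  -- truncations of `u` have finite norm, so that `g = u^{s-1}` may be used for them
  set v : ℕ → Bd d → ℝ≥0∞ := fun N => (Metric.closedBall 0 N).indicator fun x => min (u x) N
    with hv
  have hvm : ∀ N, Measurable (v N) := fun N =>
    (hu.min measurable_const).indicator Metric.isClosed_closedBall.measurableSet
  have hvu : ∀ N x, v N x ≤ u x := fun N x =>
    (indicator_le_self _ _ x).trans (min_le_left _ _)
  have hvfin : ∀ N, ∫⁻ x, v N x ^ s ≠ ⊤ := by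
    intro N
    refine ne_top_of_le_ne_top ?_ (lintegral_mono (g := (Metric.closedBall (0 : Bd d) N).indicator
      fun _ => (N : ℝ≥0∞) ^ s) fun x => ?_)
    · rw [lintegral_indicator_const Metric.isClosed_closedBall.measurableSet]
      exact ENNReal.mul_ne_top (ENNReal.rpow_ne_top_of_nonneg hs0.le (by simp))
        Metric.isBounded_closedBall.measure_lt_top.ne
    · by_cases hx : x ∈ Metric.closedBall (0 : Bd d) N
      · simp only [hv, indicator_of_mem hx]
        gcongr; exact min_le_right _ _
      · simp [hv, indicator_of_notMem hx, hs0]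
  have hvK : ∀ N, ∫⁻ x, v N x ^ s ≤ K ^ s := by
    intro N
    set J := ∫⁻ x, v N x ^ s with hJ
    rcases eq_or_ne J 0 with h0 | h0
    · rw [h0]; exact zero_le
    have e0 : (s - 1) * s' = s := by
      have := hs.sub_one_mul_conj; linarith
    have h1 : J ≤ K * J ^ (1 / s') := by
      calc J = ∫⁻ x, v N x * v N x ^ (s - 1) := by
            refine lintegral_congr fun x => ?_
            nth_rewrite 2 [← ENNReal.rpow_one (v N x)]
            rw [← ENNReal.rpow_add_of_nonneg _ _ zero_le_one hs.sub_one_pos.le]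
            congr 1; ring
        _ ≤ ∫⁻ x, u x * v N x ^ (s - 1) := by
            gcongr with x; exact hvu N x
        _ ≤ K * (∫⁻ x, (v N x ^ (s - 1)) ^ s') ^ (1 / s') := h _ ((hvm N).pow_const _)
        _ = K * J ^ (1 / s') := by
            simp_rw [← ENNReal.rpow_mul, e0, hJ]
    have h2 : J ^ (1 / s) ≤ K := by
      have h3 : J = J ^ (1 / s) * J ^ (1 / s') := by
        rw [← ENNReal.rpow_add _ _ h0 (hvfin N), one_div, one_div, hs.inv_add_inv_eq_one,
          ENNReal.rpow_one]
      have hp0 : J ^ (1 / s') ≠ 0 := by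
        rw [Ne, ENNReal.rpow_eq_zero_iff]
        rintro (⟨h, -⟩ | ⟨h, -⟩)
        exacts [h0 h, hvfin N h]
      have hpt : J ^ (1 / s') ≠ ⊤ := ENNReal.rpow_ne_top_of_nonneg (by positivity) (hvfin N)
      rw [h3] at h1
      exact (ENNReal.mul_le_mul_iff_left hp0 hpt).mp (by rw [← h3] at h1 ⊢; exact h1)
    calc J = (J ^ (1 / s)) ^ s := by
          rw [← ENNReal.rpow_mul, one_div, inv_mul_cancel₀ hs0.ne', ENNReal.rpow_one]
      _ ≤ K ^ s := by gcongr
  have hlim : ∫⁻ x, u x ^ s = ⨆ N, ∫⁻ x, v N x ^ s := by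
    rw [← lintegral_iSup (fun N => (hvm N).pow_const _)]
    · refine lintegral_congr fun x => ?_
      refine le_antisymm ?_ (iSup_le fun N => by gcongr; exact hvu N x)
      obtain ⟨N₀, hN₀⟩ := exists_nat_ge ‖x‖
      have hmem : ∀ N, N₀ ≤ N → v N x = min (u x) N := fun N hN => by
        simp only [hv]
        rw [indicator_of_mem]
        rw [mem_closedBall_zero_iff]
        exact hN₀.trans (by exact_mod_cast hN)
      rcases eq_or_ne (u x) ⊤ with htop | htop
      · rw [htop, ENNReal.top_rpow_of_pos hs0]
        refine le_of_forall_lt fun c hc => ?_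
        obtain ⟨n, hn⟩ := ENNReal.exists_nat_gt (r := c ^ (1 / s))
          (ENNReal.rpow_ne_top_of_nonneg (by positivity) hc.ne)
        refine lt_of_lt_of_le ?_ (le_iSup _ (max n N₀))
        rw [hmem _ (le_max_right _ _), htop, min_eq_right le_top]
        calc c = (c ^ (1 / s)) ^ s := by
              rw [← ENNReal.rpow_mul, one_div, inv_mul_cancel₀ hs0.ne', ENNReal.rpow_one]
          _ < (n : ℝ≥0∞) ^ s := ENNReal.rpow_lt_rpow hn hs0
          _ ≤ _ := by gcongr; exact le_max_left _ _
      · obtain ⟨n, hn⟩ := ENNReal.exists_nat_gt htop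
        refine le_trans ?_ (le_iSup _ (max n N₀))
        rw [hmem _ (le_max_right _ _), min_eq_left]
        exact hn.le.trans (by exact_mod_cast le_max_left _ _)
    · intro N N' hN x
      dsimp only
      gcongr
      have hN' : (N : ℝ≥0∞) ≤ N' := by exact_mod_cast hN
      have a1 : v N x ≤ (Metric.closedBall (0 : Bd d) N).indicator (fun x => min (u x) N') x :=
        indicator_le_indicator (min_le_min le_rfl hN')
      exact a1.trans (indicator_le_indicator_of_subset (Metric.closedBall_subset_closedBall
          (by exact_mod_cast hN)) (fun _ => zero_le) x)
  rw [hlim, one_div, ENNReal.rpow_inv_le_iff hs0]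
  exact iSup_le hvK

/-- Jensen's inequality for a weight of finite total mass, from Hölder's inequality. -/
theorem lintegral_mul_rpow_le {α : Type*} [MeasurableSpace α] (μ : Measure α) {r : ℝ} (hr : 1 < r)
    {w v : α → ℝ≥0∞} (hw : AEMeasurable w μ) (hv : AEMeasurable v μ) :
    (∫⁻ x, w x * v x ∂μ) ^ r ≤ (∫⁻ x, w x ∂μ) ^ (r - 1) * ∫⁻ x, w x * v x ^ r ∂μ := by
  have hc : r.HolderConjugate (r / (r - 1)) := Real.HolderConjugate.conjExponent hr
  have hr0 : 0 < r := by linarith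
  have hr1 : 0 < r - 1 := by linarith
  have h1 := ENNReal.lintegral_mul_le_Lp_mul_Lq μ hc.symm (hw.pow_const (1 / (r / (r - 1))))
    ((hw.pow_const (1 / r)).mul hv)
  have e1 : ∀ x, w x ^ (1 / (r / (r - 1))) * (w x ^ (1 / r) * v x) = w x * v x := fun x => by
    rw [← mul_assoc, ← ENNReal.rpow_add_of_nonneg _ _ (by positivity) (by positivity)]
    have : 1 / (r / (r - 1)) + 1 / r = 1 := by field_simp; ring
    rw [this, ENNReal.rpow_one]
  simp only [Pi.mul_apply] at h1
  simp_rw [e1] at h1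
  have e2 : ∀ x, (w x ^ (1 / (r / (r - 1)))) ^ (r / (r - 1)) = w x := fun x => by
    rw [← ENNReal.rpow_mul, one_div, inv_mul_cancel₀ (by positivity), ENNReal.rpow_one]
  have e3 : ∀ x, (w x ^ (1 / r) * v x) ^ r = w x * v x ^ r := fun x => by
    rw [ENNReal.mul_rpow_of_nonneg _ _ hr0.le, ← ENNReal.rpow_mul, one_div,
      inv_mul_cancel₀ hr0.ne', ENNReal.rpow_one]
  simp_rw [e2, e3] at h1
  calc (∫⁻ x, w x * v x ∂μ) ^ r
      ≤ ((∫⁻ x, w x ∂μ) ^ (1 / (r / (r - 1))) * (∫⁻ x, w x * v x ^ r ∂μ) ^ (1 / r)) ^ r := by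
        gcongr
    _ = _ := by
        rw [ENNReal.mul_rpow_of_nonneg _ _ hr0.le, ← ENNReal.rpow_mul, ← ENNReal.rpow_mul, one_div,
          one_div, inv_mul_cancel₀ hr0.ne', ENNReal.rpow_one]
        congr 2; field_simp

/-! ### Averages against the Poisson weight -/

/-- The weight `t / (t + |x|)^{d+1} = t^{-d} (1 + |x|/t)^{-(d+1)}`, comparable to the Poisson kernel
of the half-space. -/
def pw (t : ℝ) (x : Bd d) : ℝ := t / (t + ‖x‖) ^ (d + 1)

theorem pw_nonneg {t : ℝ} (ht : 0 < t) (x : Bd d) : 0 ≤ pw t x := by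
  unfold pw; positivity

theorem measurable_pw : Measurable fun z : ℝ × Bd d => pw z.1 z.2 := by
  unfold pw; fun_prop

theorem measurable_pw_sub (t : ℝ) : Measurable fun z : Bd d × Bd d => pw t (z.1 - z.2) := by
  unfold pw; fun_prop

theorem measurable_ofReal_pw_sub (t : ℝ) (x : Bd d) :
    Measurable fun y => ENNReal.ofReal (pw t (x - y)) := by
  unfold pw; fun_prop

theorem pw_neg (t : ℝ) (x : Bd d) : pw t (-x) = pw t x := by
  unfold pw; rw [norm_neg]

theorem pw_sub_comm (t : ℝ) (x y : Bd d) : pw t (x - y) = pw t (y - x) := by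
  rw [← pw_neg, neg_sub]

theorem pw_le_inv_pow {t : ℝ} (ht : 0 < t) (x : Bd d) : pw t x ≤ (t ^ d)⁻¹ := by
  unfold pw
  rw [div_le_iff₀ (by positivity), ← div_eq_inv_mul, le_div_iff₀ (by positivity)]
  calc t * t ^ d = t ^ (d + 1) := by ring
    _ ≤ (t + ‖x‖) ^ (d + 1) := by gcongr; linarith [norm_nonneg x]

theorem pw_eq_scale {t : ℝ} (ht : 0 < t) (x : Bd d) :
    pw t x = (t ^ d)⁻¹ * ((1 + ‖t⁻¹ • x‖) ^ (d + 1))⁻¹ := by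
  have h : 1 + ‖t⁻¹ • x‖ = (t + ‖x‖) / t := by
    rw [norm_smul, norm_inv, Real.norm_of_nonneg ht.le]; field_simp
  rw [h, pw, div_pow]
  field_simp
  ring

/-- Harnack's inequality for the weight: on the cone over `x` it is comparable to its value
over the vertex. -/
theorem pw_sub_le_of_norm_sub_lt {t : ℝ} {x y : Bd d} (hxy : ‖x - y‖ < t) (z : Bd d) :
    pw t (y - z) ≤ 2 ^ (d + 1) * pw t (x - z) := by
  have ht : 0 < t := (norm_nonneg _).trans_lt hxy
  unfold pw
  rw [← mul_div_assoc, div_le_div_iff₀ (by positivity) (by positivity)]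
  have h : t + ‖x - z‖ ≤ 2 * (t + ‖y - z‖) := by
    have : ‖x - z‖ ≤ ‖x - y‖ + ‖y - z‖ := by simpa using norm_add_le (x - y) (y - z)
    linarith [norm_nonneg (y - z)]
  calc t * (t + ‖x - z‖) ^ (d + 1) ≤ t * (2 * (t + ‖y - z‖)) ^ (d + 1) := by gcongr
    _ = _ := by rw [mul_pow]; ring

/-- The average of `v ≥ 0` with the weight `pw t`. -/
def pwConv (t : ℝ) (v : Bd d → ℝ≥0∞) (x : Bd d) : ℝ≥0∞ :=
  ∫⁻ y, ENNReal.ofReal (pw t (x - y)) * v y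

theorem measurable_pwConv {v : Bd d → ℝ≥0∞} (hv : Measurable v) :
    Measurable fun z : ℝ × Bd d => pwConv z.1 v z.2 := by
  unfold pwConv
  refine Measurable.lintegral_prod_right'
    (f := fun w : (ℝ × Bd d) × Bd d => ENNReal.ofReal (pw w.1.1 (w.1.2 - w.2)) * v w.2) ?_
  refine Measurable.mul (ENNReal.measurable_ofReal.comp ?_) (hv.comp measurable_snd)
  exact measurable_pw.comp ((measurable_fst.comp measurable_fst).prodMk
    ((measurable_snd.comp measurable_fst).sub measurable_snd))

/-- The average with weight `pw t` is dominated by the maximal function: decompose the weight over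
the dyadic balls of radius `2^m t`, on which it is at most `2^{-m}` times the normalized measure. -/
theorem pwConv_le_maxFn {t : ℝ} (ht : 0 < t) {v : Bd d → ℝ≥0∞} (hv : Measurable v) (x : Bd d) :
    pwConv t v x ≤ ENNReal.ofReal (2 ^ (d + 2)) * maxFn v x := by
  obtain ⟨n, hn1, hn2⟩ := exists_mem_Ioc_zpow (y := (2 : ℝ)) ht one_lt_two
  set m₀ := n + 1 with hm₀
  have h2 : ∀ k : ℤ, (0 : ℝ) < 2 ^ k := fun k => by positivity
  have hm₀2 : (2 : ℝ) ^ m₀ ≤ 2 * t := by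
    rw [hm₀, zpow_add_one₀ two_ne_zero]; linarith
  -- decompose the weight over dyadic balls
  have hpt : ∀ y, ENNReal.ofReal (pw t (x - y)) ≤ ∑' i : ℕ,
      (Metric.closedBall x ((2 : ℝ) ^ (m₀ + i))).indicator (fun _ => ENNReal.ofReal
        (2 ^ (d + 1) * (1 / 2) ^ i * (((2 : ℝ) ^ (m₀ + i)) ^ d)⁻¹)) y := by
    intro y
    by_cases hy : ‖x - y‖ ≤ (2 : ℝ) ^ m₀
    · refine le_trans ?_ (ENNReal.le_tsum 0)
      rw [indicator_of_mem (by simpa [dist_eq_norm, norm_sub_rev] using hy)]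
      refine ENNReal.ofReal_le_ofReal ((pw_le_inv_pow ht _).trans ?_)
      simp only [pow_zero, mul_one, Nat.cast_zero, add_zero]
      rw [← div_eq_mul_inv, le_div_iff₀ (by positivity), ← div_eq_inv_mul,
        div_le_iff₀ (by positivity)]
      calc ((2 : ℝ) ^ m₀) ^ d ≤ (2 * t) ^ d := by gcongr
        _ = 2 ^ d * t ^ d := mul_pow _ _ _
        _ ≤ 2 ^ (d + 1) * t ^ d := by gcongr <;> norm_num
    · have hy' : (2 : ℝ) ^ m₀ < ‖x - y‖ := not_le.mp hy
      have hr : 0 < ‖x - y‖ := (h2 _).trans hy'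
      obtain ⟨k, hk1, hk2⟩ := exists_mem_Ioc_zpow (y := (2 : ℝ)) hr one_lt_two
      have hkm : m₀ < k + 1 := (zpow_lt_zpow_iff_right₀ one_lt_two).mp (hy'.trans_le hk2)
      obtain ⟨i, hi⟩ := Int.eq_ofNat_of_zero_le (show 0 ≤ k + 1 - m₀ by omega)
      have hki : k + 1 = m₀ + i := by omega
      refine le_trans ?_ (ENNReal.le_tsum i)
      rw [indicator_of_mem (by
        rw [← hki, Metric.mem_closedBall, dist_eq_norm, norm_sub_rev]; exact hk2)]
      refine ENNReal.ofReal_le_ofReal ?_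
      have e1 : (2 : ℝ) ^ (m₀ + (i : ℤ)) = 2 ^ m₀ * 2 ^ i := by
        rw [zpow_add₀ two_ne_zero, zpow_natCast]
      have e2 : (2 : ℝ) ^ m₀ * 2 ^ i ≤ 2 * ‖x - y‖ := by
        rw [← e1, ← hki, zpow_add_one₀ two_ne_zero]; linarith
      calc pw t (x - y) ≤ 2 ^ m₀ / ‖x - y‖ ^ (d + 1) := by
            unfold pw
            gcongr
            linarith
        _ ≤ 2 ^ m₀ / ((2 : ℝ) ^ m₀ * 2 ^ i / 2) ^ (d + 1) := by
            gcongr; linarith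
        _ = 2 ^ (d + 1) * (1 / 2) ^ i * (((2 : ℝ) ^ (m₀ + (i : ℤ))) ^ d)⁻¹ := by
            rw [e1]
            have := h2 m₀
            rw [div_pow, div_pow, one_pow, pow_succ ((2 : ℝ) ^ m₀ * 2 ^ i) d]
            field_simp
  calc pwConv t v x
      ≤ ∫⁻ y, ∑' i : ℕ, (Metric.closedBall x ((2 : ℝ) ^ (m₀ + i))).indicator
          (fun z => ENNReal.ofReal (2 ^ (d + 1) * (1 / 2) ^ i * (((2 : ℝ) ^ (m₀ + i)) ^ d)⁻¹)
            * v z) y := by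
        refine lintegral_mono fun y => ?_
        refine (mul_le_mul_left (hpt y) (v y)).trans_eq ?_
        rw [← ENNReal.tsum_mul_right]
        refine tsum_congr fun i => ?_
        by_cases hy : y ∈ Metric.closedBall x ((2 : ℝ) ^ (m₀ + i))
        · simp only [indicator_of_mem hy]
        · simp only [indicator_of_notMem hy, zero_mul]
    _ = ∑' i : ℕ, ENNReal.ofReal (2 ^ (d + 1) * (1 / 2) ^ i) *
          ((∫⁻ y in Metric.closedBall x ((2 : ℝ) ^ (m₀ + i)), v y)
            / ENNReal.ofReal (((2 : ℝ) ^ (m₀ + (i : ℤ))) ^ d)) := by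
        rw [lintegral_tsum fun i => ((hv.const_mul _).indicator
          Metric.isClosed_closedBall.measurableSet).aemeasurable]
        refine tsum_congr fun i => ?_
        have := h2 (m₀ + i)
        rw [lintegral_indicator Metric.isClosed_closedBall.measurableSet,
          lintegral_const_mul _ hv, ENNReal.ofReal_mul (by positivity),
          ENNReal.ofReal_inv_of_pos (by positivity), ENNReal.div_eq_inv_mul, mul_assoc]
    _ ≤ ∑' i : ℕ, ENNReal.ofReal (2 ^ (d + 1) * (1 / 2) ^ i) * maxFn v x := by
        refine ENNReal.tsum_le_tsum fun i => ?_
        gcongr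
        exact le_iSup (fun m : ℤ => (∫⁻ y in Metric.closedBall x ((2 : ℝ) ^ m), v y)
          / ENNReal.ofReal (((2 : ℝ) ^ m) ^ d)) _
    _ = _ := by
        rw [ENNReal.tsum_mul_right, ← ENNReal.ofReal_tsum_of_nonneg (fun i => by positivity)
          (summable_geometric_two.mul_left _), tsum_mul_left, tsum_geometric_two, ← pow_succ]

/-- An upper bound for the mass of the weight `pw t`, independent of `t`. -/
def pwMass (d : ℕ) : ℝ≥0∞ := ENNReal.ofReal (2 ^ (d + 2)) * volume (Metric.ball (0 : Bd d) 1)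

theorem pwMass_ne_top : pwMass d ≠ ⊤ :=
  ENNReal.mul_ne_top ENNReal.ofReal_ne_top Metric.isBounded_ball.measure_lt_top.ne

theorem lintegral_pw_sub_le {t : ℝ} (ht : 0 < t) (x : Bd d) :
    ∫⁻ y, ENNReal.ofReal (pw t (x - y)) ≤ pwMass d := by
  have h := pwConv_le_maxFn ht (v := fun _ : Bd d => (1 : ℝ≥0∞)) measurable_const x
  simp only [pwConv, mul_one] at h
  refine h.trans (mul_le_mul_right ?_ _)
  simpa using maxFn_le_of_le (g := fun _ : Bd d => (1 : ℝ≥0∞)) (fun _ => le_rfl) x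

theorem integrable_pw {t : ℝ} (ht : 0 < t) : Integrable (fun y : Bd d => pw t y) := by
  refine ⟨(measurable_pw.comp measurable_prodMk_left).aestronglyMeasurable, ?_⟩
  have h := lintegral_pw_sub_le ht (0 : Bd d)
  simp only [zero_sub, pw_neg] at h
  rw [hasFiniteIntegral_iff_ofReal (Filter.Eventually.of_forall fun y => pw_nonneg ht y)]
  exact h.trans_lt pwMass_ne_top.lt_top

theorem pwConv_rpow_le {t : ℝ} (ht : 0 < t) {r : ℝ} (hr : 1 < r) {v : Bd d → ℝ≥0∞}
    (hv : Measurable v) (x : Bd d) :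
    pwConv t v x ^ r ≤ pwMass d ^ (r - 1) * pwConv t (fun y => v y ^ r) x := by
  refine (lintegral_mul_rpow_le volume hr ?_ hv.aemeasurable).trans ?_
  · exact (ENNReal.measurable_ofReal.comp
      ((measurable_pw_sub t).comp measurable_prodMk_left)).aemeasurable
  · refine mul_le_mul_left (ENNReal.rpow_le_rpow (lintegral_pw_sub_le ht x) (by linarith)) _

/-- Averaging with weight `pw t` is symmetric. -/
theorem lintegral_pwConv_mul (t : ℝ) {u g : Bd d → ℝ≥0∞} (hu : Measurable u) (hg : Measurable g) :
    ∫⁻ x, pwConv t u x * g x = ∫⁻ x, u x * pwConv t g x := by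
  have hm : Measurable fun z : Bd d × Bd d => ENNReal.ofReal (pw t (z.1 - z.2)) :=
    ENNReal.measurable_ofReal.comp (measurable_pw_sub t)
  calc ∫⁻ x, pwConv t u x * g x
      = ∫⁻ x, ∫⁻ y, ENNReal.ofReal (pw t (x - y)) * u y * g x := by
        refine lintegral_congr fun x => ?_
        rw [pwConv, lintegral_mul_const]
        exact (hm.comp measurable_prodMk_left).mul hu
    _ = ∫⁻ y, ∫⁻ x, ENNReal.ofReal (pw t (x - y)) * u y * g x := by
        refine lintegral_lintegral_swap (Measurable.aemeasurable ?_)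
        exact (hm.mul (hu.comp measurable_snd)).mul (hg.comp measurable_fst)
    _ = _ := by
        refine lintegral_congr fun y => ?_
        rw [pwConv, ← lintegral_const_mul]
        · refine lintegral_congr fun x => ?_
          rw [pw_sub_comm]; ring
        · exact (hm.comp measurable_prodMk_left).mul hg

theorem pwConv_le_of_norm_sub_lt {t : ℝ} {x y : Bd d} (hxy : ‖x - y‖ < t)
    (v : Bd d → ℝ≥0∞) :
    pwConv t v y ≤ ENNReal.ofReal (2 ^ (d + 1)) * pwConv t v x := by
  rw [pwConv, pwConv, ← lintegral_const_mul' _ _ ENNReal.ofReal_ne_top]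
  refine lintegral_mono fun z => ?_
  rw [← mul_assoc, ← ENNReal.ofReal_mul (by positivity)]
  gcongr
  exact pw_sub_le_of_norm_sub_lt hxy z

/-! ### The tent-space estimate for majorants -/

/-- The majorant `∑_k min(1, (2^k t)^{-M}) (pw_t * v_k)` of the extension at height `t`, where `v_k`
stands for the modulus of the `k`-th Littlewood-Paley block. -/
def majorant (M : ℕ) (v : ℤ → Bd d → ℝ≥0∞) (t : ℝ) (x : Bd d) : ℝ≥0∞ :=
  ∑' k : ℤ, ENNReal.ofReal (decay M ((2 : ℝ) ^ k * t)) * pwConv t (v k) x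

theorem pwConv_le_of_le {t : ℝ} (ht : 0 < t) {v : Bd d → ℝ≥0∞} {b : ℝ≥0∞} (hv : ∀ y, v y ≤ b)
    (x : Bd d) : pwConv t v x ≤ pwMass d * b := by
  calc pwConv t v x ≤ ∫⁻ y, ENNReal.ofReal (pw t (x - y)) * b := by
        refine lintegral_mono fun y => ?_
        gcongr
        exact hv y
    _ = (∫⁻ y, ENNReal.ofReal (pw t (x - y))) * b :=
        lintegral_mul_const _ (measurable_ofReal_pw_sub t x)
    _ ≤ _ := by gcongr; exact lintegral_pw_sub_le ht x

theorem exists_tsum_decay_mul_le {M : ℕ} {a : ℝ} (ha : 0 < a) (haM : a < M) :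
    ∃ C : ℝ≥0, ∀ t : ℝ, 0 < t → ∑' k : ℤ, ENNReal.ofReal (decay M ((2 : ℝ) ^ k * t)) *
      ENNReal.ofReal (((2 : ℝ) ^ k) ^ a) ≤ C * ENNReal.ofReal (t ^ (-a)) := by
  obtain ⟨C, hC⟩ := exists_tsum_decay_mul_rpow_le ha haM
  refine ⟨C, fun t ht => ?_⟩
  calc _ = ∑' k : ℤ, ENNReal.ofReal (decay M ((2 : ℝ) ^ k * t) * ((2 : ℝ) ^ k * t) ^ a)
          * ENNReal.ofReal (t ^ (-a)) := by
        refine tsum_congr fun k => ?_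
        have hk : (0 : ℝ) < 2 ^ k := by positivity
        have hdec := decay_nonneg M (s := (2 : ℝ) ^ k * t) (by positivity)
        rw [← ENNReal.ofReal_mul hdec, ← ENNReal.ofReal_mul (by positivity)]
        congr 1
        rw [Real.mul_rpow hk.le ht.le, Real.rpow_neg ht.le]
        field_simp
    _ ≤ _ := by rw [ENNReal.tsum_mul_right]; gcongr; exact hC t ht

/-- The bound behind the weighted supremum norms: blocks of size `2^{ka}` with `0 < a < M` have a
majorant of size `t^{-a}`. -/
theorem exists_majorant_le {M : ℕ} {a : ℝ} (ha : 0 < a) (haM : a < M) :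
    ∃ C : ℝ≥0, ∀ (v : ℤ → Bd d → ℝ≥0∞) (N : ℝ≥0∞),
      (∀ k y, v k y ≤ ENNReal.ofReal (((2 : ℝ) ^ k) ^ a) * N) → ∀ t : ℝ, 0 < t → ∀ x,
        majorant M v t x ≤ C * ENNReal.ofReal (t ^ (-a)) * N := by
  obtain ⟨C, hC⟩ := exists_tsum_decay_mul_le ha haM
  refine ⟨C * (pwMass d).toNNReal, fun v N hv t ht x => ?_⟩
  rw [ENNReal.coe_mul, ENNReal.coe_toNNReal pwMass_ne_top]
  calc majorant M v t x
      ≤ ∑' k : ℤ, (ENNReal.ofReal (decay M ((2 : ℝ) ^ k * t)) * ENNReal.ofReal (((2 : ℝ) ^ k) ^ a))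
          * (pwMass d * N) := by
        refine ENNReal.tsum_le_tsum fun k => ?_
        refine (mul_le_mul_right (pwConv_le_of_le ht (hv k) x) _).trans_eq ?_
        ring
    _ ≤ (C * ENNReal.ofReal (t ^ (-a))) * (pwMass d * N) := by
        rw [ENNReal.tsum_mul_right]; gcongr; exact hC t ht
    _ = _ := by ring

/-- The weight `min(1, s^{-M}) s^{-1/2}`, integrable over `(0, ∞)` for `M ≥ 1`. It is what remains
of the decay factor after summation over the frequencies; see `exists_majorant_rpow_le`. -/
def tentWeight (M : ℕ) (s : ℝ) : ℝ := decay M s * s ^ (-(1 / 2) : ℝ)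

theorem measurable_tentWeight (M : ℕ) : Measurable (tentWeight M) := by
  unfold tentWeight decay; fun_prop

/-- The `q`-th power of the majorant, linearised. With `s = 2^k t` and `δ = 1/(2(q-1))`, split
`decay M s = (decay M s * s^δ) * s^{-δ}` and apply Jensen's inequality with respect to the first
factor, whose sum over `k` is bounded; the second one leaves the exponent `δ - δq = -1/2`. -/
theorem exists_majorant_rpow_le {M : ℕ} {q : ℝ} (hq : 1 < q) (hM : 1 / (2 * (q - 1)) < M) :
    ∃ C : ℝ≥0, ∀ v : ℤ → Bd d → ℝ≥0∞, (∀ k, Measurable (v k)) → ∀ t : ℝ, 0 < t → ∀ x,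
      majorant M v t x ^ q ≤ C * ∑' k : ℤ, ENNReal.ofReal (tentWeight M ((2 : ℝ) ^ k * t))
        * pwConv t (fun y => v k y ^ q) x := by
  have hq1 : 0 < q - 1 := by linarith
  set δ : ℝ := 1 / (2 * (q - 1)) with hδ
  have hδ0 : 0 < δ := by positivity
  obtain ⟨C, hC⟩ := exists_tsum_decay_mul_rpow_le hδ0 hM
  refine ⟨((C : ℝ≥0∞) ^ (q - 1) * pwMass d ^ (q - 1)).toNNReal, fun v hv t ht x => ?_⟩
  rw [ENNReal.coe_toNNReal (ENNReal.mul_ne_top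
    (ENNReal.rpow_ne_top_of_nonneg hq1.le ENNReal.coe_ne_top)
    (ENNReal.rpow_ne_top_of_nonneg hq1.le pwMass_ne_top))]
  have hl : ∀ k : ℤ, (0 : ℝ) < 2 ^ k * t := fun k => by positivity
  have hdec := fun k : ℤ => decay_nonneg M (hl k)
  set W : ℤ → ℝ≥0∞ := fun k =>
    ENNReal.ofReal (decay M ((2 : ℝ) ^ k * t) * ((2 : ℝ) ^ k * t) ^ δ) with hW
  set Y : ℤ → ℝ≥0∞ := fun k =>
    ENNReal.ofReal (((2 : ℝ) ^ k * t) ^ (-δ)) * pwConv t (v k) x with hY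
  have h1 := lintegral_mul_rpow_le (Measure.count : Measure ℤ) hq (w := W) (v := Y)
    (Measurable.of_discrete).aemeasurable (Measurable.of_discrete).aemeasurable
  simp only [lintegral_count] at h1
  have e1 : ∀ k, W k * Y k = ENNReal.ofReal (decay M ((2 : ℝ) ^ k * t)) * pwConv t (v k) x := by
    intro k
    have := hdec k
    have := hl k
    rw [hW, hY]
    dsimp only
    rw [← mul_assoc, ← ENNReal.ofReal_mul (by positivity), mul_assoc (decay _ _),
      ← Real.rpow_add (hl k), add_neg_cancel, Real.rpow_zero, mul_one]
  have e2 : ∀ k, W k * Y k ^ q ≤ pwMass d ^ (q - 1) *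
      (ENNReal.ofReal (tentWeight M ((2 : ℝ) ^ k * t)) * pwConv t (fun y => v k y ^ q) x) := by
    intro k
    have := hdec k
    have := hl k
    rw [hW, hY]
    dsimp only
    rw [ENNReal.mul_rpow_of_nonneg _ _ (by linarith), ENNReal.ofReal_rpow_of_pos (by positivity),
      ← mul_assoc, ← ENNReal.ofReal_mul (by positivity), mul_assoc (decay _ _),
      ← Real.rpow_mul (hl k).le, ← Real.rpow_add (hl k)]
    have : δ + -δ * q = -(1 / 2) := by rw [hδ]; field_simp; ring
    rw [this]
    refine (mul_le_mul_right (pwConv_rpow_le ht hq (hv k) x) _).trans_eq ?_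
    rw [tentWeight]; ring
  calc majorant M v t x ^ q = (∑' k, W k * Y k) ^ q := by
        rw [majorant]; simp_rw [e1]
    _ ≤ (∑' k, W k) ^ (q - 1) * ∑' k, W k * Y k ^ q := h1
    _ ≤ (C : ℝ≥0∞) ^ (q - 1) * ∑' k, pwMass d ^ (q - 1) *
        (ENNReal.ofReal (tentWeight M ((2 : ℝ) ^ k * t)) * pwConv t (fun y => v k y ^ q) x) :=
        mul_le_mul' (ENNReal.rpow_le_rpow (hC t ht) hq1.le) (ENNReal.tsum_le_tsum e2)
    _ = _ := by rw [ENNReal.tsum_mul_left, mul_assoc]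

/-- By scaling; the two pieces `t ≤ 1/c` and `t > 1/c` contribute at most `2/c` and `1/c`. -/
theorem lintegral_tentWeight_le {M : ℕ} (hM : 2 ≤ M) {c : ℝ} (hc : 0 < c) :
    ∫⁻ t in Ioi (0 : ℝ), ENNReal.ofReal (tentWeight M (c * t)) ≤ 3 * ENNReal.ofReal (c⁻¹) := by
  have hci : 0 < c⁻¹ := inv_pos.mpr hc
  have hlow : ∫⁻ t in Ioc 0 c⁻¹, ENNReal.ofReal (tentWeight M (c * t))
      ≤ 2 * ENNReal.ofReal c⁻¹ := by
    have h1 : IntegrableOn (fun t : ℝ => c ^ (-(1 / 2) : ℝ) * t ^ (-(1 / 2) : ℝ)) (Ioc 0 c⁻¹) := by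
      have := (intervalIntegral.intervalIntegrable_rpow' (a := 0) (b := c⁻¹)
        (r := (-(1 / 2) : ℝ)) (by norm_num))
      rw [intervalIntegrable_iff_integrableOn_Ioc_of_le hci.le] at this
      exact this.const_mul _
    calc ∫⁻ t in Ioc 0 c⁻¹, ENNReal.ofReal (tentWeight M (c * t))
        ≤ ∫⁻ t in Ioc 0 c⁻¹, ENNReal.ofReal (c ^ (-(1 / 2) : ℝ) * t ^ (-(1 / 2) : ℝ)) := by
          refine setLIntegral_mono' measurableSet_Ioc fun t ht => ENNReal.ofReal_le_ofReal ?_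
          have ht0 : 0 < t := ht.1
          rw [tentWeight, ← Real.mul_rpow hc.le ht0.le]
          exact mul_le_of_le_one_left (by positivity) (min_le_left _ _)
      _ = ENNReal.ofReal (∫ t in Ioc 0 c⁻¹, c ^ (-(1 / 2) : ℝ) * t ^ (-(1 / 2) : ℝ)) := by
          rw [ofReal_integral_eq_lintegral_ofReal h1]
          filter_upwards [ae_restrict_mem measurableSet_Ioc] with t ht
          have : 0 < t := ht.1
          positivity
      _ = 2 * ENNReal.ofReal c⁻¹ := by
          rw [← intervalIntegral.integral_of_le hci.le, intervalIntegral.integral_const_mul,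
            integral_rpow (Or.inl (by norm_num)), Real.zero_rpow (by norm_num), sub_zero,
            ← ENNReal.ofReal_ofNat 2, ← ENNReal.ofReal_mul (by positivity)]
          congr 1
          rw [Real.inv_rpow hc.le, Real.rpow_neg hc.le, show (-(1 / 2) + 1 : ℝ) = 1 / 2 by norm_num,
            ← Real.sqrt_eq_rpow]
          field_simp
          rw [Real.sq_sqrt hc.le]
  have hhigh : ∫⁻ t in Ioi c⁻¹, ENNReal.ofReal (tentWeight M (c * t)) ≤ ENNReal.ofReal c⁻¹ := by
    have h1 : IntegrableOn (fun t : ℝ => c ^ (-2 : ℝ) * t ^ (-2 : ℝ)) (Ioi c⁻¹) :=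
      (integrableOn_Ioi_rpow_of_lt (by norm_num) hci).const_mul _
    calc ∫⁻ t in Ioi c⁻¹, ENNReal.ofReal (tentWeight M (c * t))
        ≤ ∫⁻ t in Ioi c⁻¹, ENNReal.ofReal (c ^ (-2 : ℝ) * t ^ (-2 : ℝ)) := by
          refine setLIntegral_mono' measurableSet_Ioi fun t ht => ENNReal.ofReal_le_ofReal ?_
          have ht0 : 0 < t := hci.trans ht
          have hct : 1 ≤ c * t := by
            have := mul_le_mul_of_nonneg_left (le_of_lt ht) hc.le
            rwa [mul_inv_cancel₀ hc.ne'] at this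
          rw [tentWeight, ← Real.mul_rpow hc.le ht0.le]
          have e1 : decay M (c * t) ≤ (c * t) ^ (-2 : ℝ) := by
            refine (min_le_right _ _).trans ?_
            rw [Real.rpow_neg (by positivity), Real.rpow_ofNat]
            gcongr
          have e2 : (c * t) ^ (-(1 / 2) : ℝ) ≤ 1 :=
            Real.rpow_le_one_of_one_le_of_nonpos hct (by norm_num)
          calc _ ≤ (c * t) ^ (-2 : ℝ) * 1 :=
                mul_le_mul e1 e2 (by positivity) (by positivity)
            _ = _ := mul_one _
      _ = ENNReal.ofReal (∫ t in Ioi c⁻¹, c ^ (-2 : ℝ) * t ^ (-2 : ℝ)) := by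
          rw [ofReal_integral_eq_lintegral_ofReal h1]
          filter_upwards [ae_restrict_mem measurableSet_Ioi] with t ht
          have : 0 < t := hci.trans ht
          positivity
      _ = ENNReal.ofReal c⁻¹ := by
          rw [integral_const_mul, integral_Ioi_rpow_of_lt (by norm_num) hci]
          congr 1
          rw [show (-2 + 1 : ℝ) = -1 by norm_num, Real.rpow_neg_one, inv_inv,
            Real.rpow_neg hc.le, Real.rpow_ofNat]
          field_simp
  rw [← Ioc_union_Ioi_eq_Ioi hci.le, lintegral_union measurableSet_Ioi
    (Ioc_disjoint_Ioi le_rfl)]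
  refine (add_le_add hlow hhigh).trans_eq ?_
  ring

theorem measurableSet_cone (x : Bd d) : MeasurableSet (cone x) := by
  unfold cone
  exact (measurableSet_lt measurable_const measurable_snd).inter
    (measurableSet_lt (measurable_const.sub measurable_fst).norm measurable_snd)

/-- Integration over a cone of a function of the height. -/
theorem lintegral_cone_le (x : Bd d) {H : ℝ → ℝ≥0∞} (hH : Measurable H) :
    ∫⁻ y in cone x, H y.2 * ENNReal.ofReal (y.2 ^ (-(d : ℝ)))
      ≤ volume (Metric.ball (0 : Bd d) 1) * ∫⁻ t in Ioi (0 : ℝ), H t := by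
  have hp : Measurable fun t : ℝ => ENNReal.ofReal (t ^ (-(d : ℝ))) := by fun_prop
  have hm : Measurable fun y : Bd d × ℝ => H y.2 * ENNReal.ofReal (y.2 ^ (-(d : ℝ))) :=
    (hH.comp measurable_snd).mul (hp.comp measurable_snd)
  rw [← lintegral_indicator (measurableSet_cone x), Measure.volume_eq_prod,
    lintegral_prod_symm _ ((hm.indicator (measurableSet_cone x)).aemeasurable),
    ← lintegral_indicator measurableSet_Ioi,
    ← lintegral_const_mul _ (hH.indicator measurableSet_Ioi)]
  refine lintegral_mono fun t => ?_
  by_cases ht : 0 < t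
  · calc ∫⁻ y, (cone x).indicator (fun y => H y.2 * ENNReal.ofReal (y.2 ^ (-(d : ℝ)))) (y, t)
        ≤ ∫⁻ y, (Metric.closedBall x t).indicator
            (fun _ => H t * ENNReal.ofReal (t ^ (-(d : ℝ)))) y := by
          refine lintegral_mono fun y => ?_
          by_cases hy : (y, t) ∈ cone x
          · rw [indicator_of_mem hy, indicator_of_mem]
            rw [Metric.mem_closedBall, dist_comm, dist_eq_norm]
            exact hy.2.le
          · rw [indicator_of_notMem hy]; exact zero_le
      _ = volume (Metric.ball (0 : Bd d) 1) * H t *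
            (ENNReal.ofReal (t ^ (-(d : ℝ))) * ENNReal.ofReal (t ^ d)) := by
          rw [lintegral_indicator_const Metric.isClosed_closedBall.measurableSet,
            volume_closedBall_eq _ ht.le]
          ring
      _ = _ := by
          rw [← ENNReal.ofReal_mul (by positivity), Real.rpow_neg ht.le, Real.rpow_natCast,
            inv_mul_cancel₀ (by positivity), ENNReal.ofReal_one, mul_one,
            indicator_of_mem (by exact ht)]
  · refine (lintegral_eq_zero_of_ae_eq_zero (Filter.Eventually.of_forall fun y => ?_)).trans_le
      zero_le
    exact indicator_of_notMem (fun hy => ht hy.1) _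

/-- The tent-space norm of a majorant is controlled by the Triebel-Lizorkin-type norm of the
sequence `v`. The proof is by duality: a test function `g` is moved onto the maximal function
`maxFn g`, and integration in the height `t` turns the weight at frequency `2^k` into `2^{-k}`. -/
theorem exists_lintegral_cone_majorant_le (hd : 1 ≤ d) {M : ℕ} {q s : ℝ} (hq : 1 < q) (hs : 1 < s)
    (hM : 1 / (2 * (q - 1)) < M) (hM2 : 2 ≤ M) :
    ∃ C : ℝ≥0, ∀ v : ℤ → Bd d → ℝ≥0∞, (∀ k, Measurable (v k)) →
      (∫⁻ x, (∫⁻ y in cone x, majorant M v y.2 y.1 ^ q * ENNReal.ofReal (y.2 ^ (-(d : ℝ)))) ^ s)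
        ^ (1 / s) ≤ C * (∫⁻ x, (∑' k : ℤ, ENNReal.ofReal (((2 : ℝ) ^ k)⁻¹) * v k x ^ q) ^ s)
          ^ (1 / s) := by
  obtain ⟨C₁, hC₁⟩ := exists_majorant_rpow_le (d := d) hq hM
  have hc : s.HolderConjugate (s / (s - 1)) := Real.HolderConjugate.conjExponent hs
  set s' := s / (s - 1) with hs'
  obtain ⟨C₂, hC₂⟩ := exists_lintegral_maxFn_rpow_le (d := d) hd hc.symm.lt
  set V := volume (Metric.ball (0 : Bd d) 1) with hV
  have hVt : V ≠ ⊤ := Metric.isBounded_ball.measure_lt_top.ne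
  set D₁ : ℝ≥0∞ := V * (C₁ * ENNReal.ofReal (2 ^ (d + 1))) with hD₁
  set D₂ : ℝ≥0∞ := ENNReal.ofReal (2 ^ (d + 2)) * 3 * (C₂ : ℝ≥0∞) ^ (1 / s') with hD₂
  have hs0' : 0 < s' := hc.symm.pos
  have hD₁t : D₁ ≠ ⊤ := ENNReal.mul_ne_top hVt
    (ENNReal.mul_ne_top ENNReal.coe_ne_top ENNReal.ofReal_ne_top)
  have hD₂t : D₂ ≠ ⊤ := ENNReal.mul_ne_top (ENNReal.mul_ne_top ENNReal.ofReal_ne_top (by simp))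
    (ENNReal.rpow_ne_top_of_nonneg (by positivity) ENNReal.coe_ne_top)
  refine ⟨(D₁ * D₂).toNNReal, fun v hv => ?_⟩
  rw [ENNReal.coe_toNNReal (ENNReal.mul_ne_top hD₁t hD₂t)]
  set u : ℤ → Bd d → ℝ≥0∞ := fun k y => v k y ^ q with hu
  have hum : ∀ k, Measurable (u k) := fun k => (hv k).pow_const _
  have hwm : ∀ k : ℤ, Measurable fun t : ℝ => ENNReal.ofReal (tentWeight M ((2 : ℝ) ^ k * t)) :=
    fun k => ENNReal.measurable_ofReal.comp
      ((measurable_tentWeight M).comp (measurable_const_mul _))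
  set S : Bd d → ℝ≥0∞ := fun x => ∑' k : ℤ, ENNReal.ofReal (((2 : ℝ) ^ k)⁻¹) * u k x with hS
  have hSm : Measurable S := Measurable.tsum fun k => (hum k).const_mul _
  have hjm : Measurable fun z : ℝ × Bd d => ∑' k : ℤ,
      ENNReal.ofReal (tentWeight M ((2 : ℝ) ^ k * z.1)) * pwConv z.1 (u k) z.2 :=
    Measurable.tsum fun k => ((hwm k).comp measurable_fst).mul (measurable_pwConv (hum k))
  set U : Bd d → ℝ≥0∞ := fun x => ∫⁻ t in Ioi (0 : ℝ), ∑' k : ℤ,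
      ENNReal.ofReal (tentWeight M ((2 : ℝ) ^ k * t)) * pwConv t (u k) x with hU
  have hUm : Measurable U := Measurable.lintegral_prod_left' hjm
  -- on the cone over `x`, the averages at `y` are comparable to those at `x`
  have hpoint : ∀ x, ∫⁻ y in cone x, majorant M v y.2 y.1 ^ q * ENNReal.ofReal (y.2 ^ (-(d : ℝ)))
      ≤ D₁ * U x := by
    intro x
    set H : ℝ → ℝ≥0∞ := fun t => C₁ * ENNReal.ofReal (2 ^ (d + 1)) * ∑' k : ℤ,
      ENNReal.ofReal (tentWeight M ((2 : ℝ) ^ k * t)) * pwConv t (u k) x with hH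
    have hHm : Measurable H := (hjm.comp measurable_prodMk_right).const_mul _
    calc _ ≤ ∫⁻ y in cone x, H y.2 * ENNReal.ofReal (y.2 ^ (-(d : ℝ))) := by
          refine setLIntegral_mono' (measurableSet_cone x) fun y hy => ?_
          gcongr
          refine (hC₁ v hv y.2 hy.1 y.1).trans ?_
          simp only [hH]
          rw [mul_assoc, ← ENNReal.tsum_mul_left (a := ENNReal.ofReal _)]
          refine mul_le_mul_right (ENNReal.tsum_le_tsum fun k => ?_) _
          rw [mul_left_comm]
          gcongr
          exact pwConv_le_of_norm_sub_lt hy.2 _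
      _ ≤ V * ∫⁻ t in Ioi (0 : ℝ), H t := lintegral_cone_le x hHm
      _ = D₁ * U x := by
          rw [hH, lintegral_const_mul' _ _ (ENNReal.mul_ne_top ENNReal.coe_ne_top
            ENNReal.ofReal_ne_top), ← mul_assoc]
  have hdual : (∫⁻ x, U x ^ s) ^ (1 / s) ≤ D₂ * (∫⁻ x, S x ^ s) ^ (1 / s) := by
    refine lintegral_rpow_le_of_forall_lintegral_mul_le hc hUm fun g hg => ?_
    have hMg := measurable_maxFn hg
    calc ∫⁻ x, U x * g x
        = ∫⁻ x, ∫⁻ t in Ioi (0 : ℝ), ∑' k : ℤ,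
            ENNReal.ofReal (tentWeight M ((2 : ℝ) ^ k * t)) * pwConv t (u k) x * g x := by
          refine lintegral_congr fun x => ?_
          have hx : Measurable fun t : ℝ => ∑' k : ℤ,
              ENNReal.ofReal (tentWeight M ((2 : ℝ) ^ k * t)) * pwConv t (u k) x :=
            hjm.comp measurable_prodMk_right
          simp only [hU]
          rw [← lintegral_mul_const _ hx]
          exact lintegral_congr fun t => ENNReal.tsum_mul_right.symm
      _ = ∫⁻ t in Ioi (0 : ℝ), ∫⁻ x, ∑' k : ℤ,
            ENNReal.ofReal (tentWeight M ((2 : ℝ) ^ k * t)) * pwConv t (u k) x * g x := by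
          refine lintegral_lintegral_swap (Measurable.aemeasurable ?_)
          refine Measurable.tsum fun k => Measurable.mul ?_ (hg.comp measurable_fst)
          exact ((hwm k).comp measurable_snd).mul ((measurable_pwConv (hum k)).comp measurable_swap)
      _ ≤ ∫⁻ t in Ioi (0 : ℝ), ∑' k : ℤ, ENNReal.ofReal (tentWeight M ((2 : ℝ) ^ k * t)) *
            (ENNReal.ofReal (2 ^ (d + 2)) * ∫⁻ x, u k x * maxFn g x) := by
          refine setLIntegral_mono' measurableSet_Ioi fun t ht => ?_
          have hk : ∀ k : ℤ, Measurable fun x => ENNReal.ofReal (tentWeight M ((2 : ℝ) ^ k * t))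
              * pwConv t (u k) x * g x := fun k =>
            (((measurable_pwConv (hum k)).comp measurable_prodMk_left).const_mul _).mul hg
          rw [lintegral_tsum fun k => (hk k).aemeasurable]
          refine ENNReal.tsum_le_tsum fun k => ?_
          simp_rw [mul_assoc]
          rw [lintegral_const_mul' _ _ ENNReal.ofReal_ne_top, lintegral_pwConv_mul t (hum k) hg]
          refine mul_le_mul_right ?_ _
          rw [← lintegral_const_mul' _ _ ENNReal.ofReal_ne_top]
          refine lintegral_mono fun x => ?_
          rw [mul_left_comm]
          exact mul_le_mul_right (pwConv_le_maxFn ht hg x) _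
      _ = ∑' k : ℤ, (∫⁻ t in Ioi (0 : ℝ), ENNReal.ofReal (tentWeight M ((2 : ℝ) ^ k * t))) *
            (ENNReal.ofReal (2 ^ (d + 2)) * ∫⁻ x, u k x * maxFn g x) := by
          rw [lintegral_tsum fun k => ((hwm k).mul_const _).aemeasurable]
          exact tsum_congr fun k => lintegral_mul_const _ (hwm k)
      _ ≤ ∑' k : ℤ, (3 * ENNReal.ofReal (((2 : ℝ) ^ k)⁻¹)) *
            (ENNReal.ofReal (2 ^ (d + 2)) * ∫⁻ x, u k x * maxFn g x) := by
          refine ENNReal.tsum_le_tsum fun k => ?_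
          exact mul_le_mul_left (lintegral_tentWeight_le hM2 (by positivity)) _
      _ = ENNReal.ofReal (2 ^ (d + 2)) * 3 * ∫⁻ x, S x * maxFn g x := by
          have hk : ∀ k : ℤ, Measurable fun x => ENNReal.ofReal (((2 : ℝ) ^ k)⁻¹) * u k x
              * maxFn g x := fun k => ((hum k).const_mul _).mul hMg
          rw [hS]
          simp_rw [← ENNReal.tsum_mul_right]
          rw [lintegral_tsum fun k => (hk k).aemeasurable, ← ENNReal.tsum_mul_left]
          refine tsum_congr fun k => ?_
          simp_rw [mul_assoc]
          rw [lintegral_const_mul' _ _ ENNReal.ofReal_ne_top]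
          ring
      _ ≤ ENNReal.ofReal (2 ^ (d + 2)) * 3 * ((∫⁻ x, S x ^ s) ^ (1 / s)
            * (∫⁻ x, maxFn g x ^ s') ^ (1 / s')) := by
          exact mul_le_mul_right (ENNReal.lintegral_mul_le_Lp_mul_Lq volume hc hSm.aemeasurable
            hMg.aemeasurable) _
      _ ≤ ENNReal.ofReal (2 ^ (d + 2)) * 3 * ((∫⁻ x, S x ^ s) ^ (1 / s)
            * (C₂ * ∫⁻ x, g x ^ s') ^ (1 / s')) := by
          gcongr
          exact hC₂ g hg
      _ = D₂ * (∫⁻ x, S x ^ s) ^ (1 / s) * (∫⁻ x, g x ^ s') ^ (1 / s') := by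
          rw [ENNReal.mul_rpow_of_nonneg _ _ (by positivity), hD₂]; ring
  have hs0 : 0 < s := by linarith
  calc _ ≤ (∫⁻ x, (D₁ * U x) ^ s) ^ (1 / s) := by
        gcongr with x
        exact hpoint x
    _ = D₁ * (∫⁻ x, U x ^ s) ^ (1 / s) := by
        simp_rw [ENNReal.mul_rpow_of_nonneg _ _ hs0.le]
        rw [lintegral_const_mul _ (hUm.pow_const _), ENNReal.mul_rpow_of_nonneg _ _ (by positivity),
          ← ENNReal.rpow_mul, mul_one_div_cancel hs0.ne', ENNReal.rpow_one]
    _ ≤ D₁ * (D₂ * (∫⁻ x, S x ^ s) ^ (1 / s)) := by gcongr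
    _ = _ := (mul_assoc _ _ _).symm

/-! ### Superpositions of translates of a Schwartz function -/

theorem exists_seminorm_compSubConst_sub_le (Ξ : 𝓢(Bd d, ℂ)) (k n : ℕ) (x₀ : Bd d) :
    ∃ C : ℝ, 0 ≤ C ∧ ∀ x : Bd d, ‖x - x₀‖ ≤ 1 →
      SchwartzMap.seminorm ℂ k n (Ξ.compSubConstCLM ℂ x - Ξ.compSubConstCLM ℂ x₀)
        ≤ C * ‖x - x₀‖ := by
  set R : ℝ := ‖x₀‖ + 1 with hR
  have hR0 : 0 ≤ R := by positivity
  set A : ℝ := 2 ^ k * (Finset.Iic (k, n + 1)).sup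
    (fun m => SchwartzMap.seminorm ℂ m.1 m.2) Ξ with hA
  have hA0 : 0 ≤ A := by positivity
  refine ⟨A * (1 + R) ^ k, by positivity, fun x hx => ?_⟩
  refine SchwartzMap.seminorm_le_bound ℂ k n _ (by positivity) fun y => ?_
  have hxR : ‖x‖ ≤ R := by
    have : ‖x‖ ≤ ‖x - x₀‖ + ‖x₀‖ := by simpa using norm_add_le (x - x₀) x₀
    linarith
  have e1 : iteratedFDeriv ℝ n (Ξ.compSubConstCLM ℂ x - Ξ.compSubConstCLM ℂ x₀ : 𝓢(Bd d, ℂ)) y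
      = iteratedFDeriv ℝ n Ξ (y - x) - iteratedFDeriv ℝ n Ξ (y - x₀) := by
    have h1 : ((Ξ.compSubConstCLM ℂ x - Ξ.compSubConstCLM ℂ x₀ : 𝓢(Bd d, ℂ)) : Bd d → ℂ)
        = (fun z => Ξ (z - x)) - fun z => Ξ (z - x₀) := rfl
    have hs : ∀ w : Bd d, ContDiff ℝ n fun z => Ξ (z - w) := fun w =>
      (Ξ.smooth n).comp (contDiff_id.sub contDiff_const)
    rw [h1, iteratedFDeriv_sub_apply (hs x).contDiffAt (hs x₀).contDiffAt,
      iteratedFDeriv_comp_sub, iteratedFDeriv_comp_sub]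
  have hderiv : ∀ z ∈ segment ℝ (y - x₀) (y - x),
      ‖fderiv ℝ (iteratedFDeriv ℝ n Ξ) z‖ ≤ A * (1 + R) ^ k / (1 + ‖y‖) ^ k := by
    intro z hz
    rw [norm_fderiv_iteratedFDeriv, le_div_iff₀ (by positivity)]
    have hzy : ‖y - z‖ ≤ R := by
      have hball : segment ℝ (y - x₀) (y - x) ⊆ Metric.closedBall y R := by
        refine (convex_closedBall y R).segment_subset ?_ ?_
        · simp only [Metric.mem_closedBall, dist_eq_norm, sub_sub_cancel_left, norm_neg]; linarith
        · simpa only [Metric.mem_closedBall, dist_eq_norm, sub_sub_cancel_left, norm_neg] using hxR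
      have := hball hz
      rwa [Metric.mem_closedBall, dist_eq_norm, norm_sub_rev] at this
    have hyz : 1 + ‖y‖ ≤ (1 + R) * (1 + ‖z‖) := by
      have : ‖y‖ ≤ ‖y - z‖ + ‖z‖ := by simpa using norm_add_le (y - z) z
      nlinarith [norm_nonneg z]
    have h3 := SchwartzMap.one_add_le_sup_seminorm_apply (𝕜 := ℂ) (m := (k, n + 1)) (k := k)
      (n := n + 1) le_rfl le_rfl Ξ z
    calc ‖iteratedFDeriv ℝ (n + 1) Ξ z‖ * (1 + ‖y‖) ^ k
        ≤ ‖iteratedFDeriv ℝ (n + 1) Ξ z‖ * ((1 + R) * (1 + ‖z‖)) ^ k := by gcongr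
      _ = (1 + ‖z‖) ^ k * ‖iteratedFDeriv ℝ (n + 1) Ξ z‖ * (1 + R) ^ k := by
          rw [mul_pow]; ring
      _ ≤ A * (1 + R) ^ k := by gcongr
  have hmv := (convex_segment (𝕜 := ℝ) (y - x₀) (y - x)).norm_image_sub_le_of_norm_fderiv_le
    (f := iteratedFDeriv ℝ n Ξ) (fun z _ =>
      ((Ξ.smooth ⊤).differentiable_iteratedFDeriv
        (mod_cast ENat.natCast_lt_top n)).differentiableAt)
    hderiv (left_mem_segment ℝ _ _) (right_mem_segment ℝ _ _)
  have e2 : y - x - (y - x₀) = -(x - x₀) := by abel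
  rw [e2, norm_neg] at hmv
  rw [e1]
  calc ‖y‖ ^ k * ‖iteratedFDeriv ℝ n Ξ (y - x) - iteratedFDeriv ℝ n Ξ (y - x₀)‖
      ≤ (1 + ‖y‖) ^ k * (A * (1 + R) ^ k / (1 + ‖y‖) ^ k * ‖x - x₀‖) := by
        gcongr; linarith
    _ = A * (1 + R) ^ k * ‖x - x₀‖ := by field_simp

theorem continuous_compSubConst (Ξ : 𝓢(Bd d, ℂ)) :
    Continuous fun x : Bd d => Ξ.compSubConstCLM ℂ x := by
  refine continuous_iff_continuousAt.mpr fun x₀ => ?_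
  rw [ContinuousAt, (schwartz_withSeminorms ℂ (Bd d) ℂ).tendsto_nhds]
  rintro ⟨k, n⟩ ε hε
  obtain ⟨C, hC0, hC⟩ := exists_seminorm_compSubConst_sub_le Ξ k n x₀
  have h1 : ∀ᶠ x in nhds x₀, ‖x - x₀‖ ≤ 1 ∧ C * ‖x - x₀‖ < ε := by
    have hc1 : Filter.Tendsto (fun x : Bd d => ‖x - x₀‖) (nhds x₀) (nhds 0) := by
      have : Continuous fun x : Bd d => ‖x - x₀‖ := by fun_prop
      simpa using this.tendsto x₀
    refine (hc1.eventually (ge_mem_nhds zero_lt_one)).and ?_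
    have hc2 := hc1.const_mul C
    rw [mul_zero] at hc2
    exact hc2.eventually (gt_mem_nhds hε)
  filter_upwards [h1] with x hx
  exact (hC x hx.1).trans_lt hx.2

theorem exists_seminorm_compSubConst_le (Ξ : 𝓢(Bd d, ℂ)) (k n : ℕ) :
    ∃ C : ℝ, 0 ≤ C ∧ ∀ x : Bd d,
      SchwartzMap.seminorm ℂ k n (Ξ.compSubConstCLM ℂ x) ≤ C * (1 + ‖x‖) ^ k := by
  set A : ℝ := 2 ^ k * (Finset.Iic (k, n)).sup
    (fun m => SchwartzMap.seminorm ℂ m.1 m.2) Ξ with hA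
  have hA0 : 0 ≤ A := by positivity
  refine ⟨A, hA0, fun x => SchwartzMap.seminorm_le_bound ℂ k n _ (by positivity) fun y => ?_⟩
  have e1 : iteratedFDeriv ℝ n (Ξ.compSubConstCLM ℂ x : 𝓢(Bd d, ℂ)) y
      = iteratedFDeriv ℝ n Ξ (y - x) := by
    have h1 : (Ξ.compSubConstCLM ℂ x : Bd d → ℂ) = fun z => Ξ (z - x) := rfl
    rw [h1, iteratedFDeriv_comp_sub]
  have h3 := SchwartzMap.one_add_le_sup_seminorm_apply (𝕜 := ℂ) (m := (k, n)) (k := k)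
    (n := n) le_rfl le_rfl Ξ (y - x)
  have hyz : ‖y‖ ≤ (1 + ‖x‖) * (1 + ‖y - x‖) := by
    have : ‖y‖ ≤ ‖y - x‖ + ‖x‖ := by simpa using norm_add_le (y - x) x
    nlinarith [norm_nonneg x, norm_nonneg (y - x)]
  rw [e1]
  calc ‖y‖ ^ k * ‖iteratedFDeriv ℝ n Ξ (y - x)‖
      ≤ ((1 + ‖x‖) * (1 + ‖y - x‖)) ^ k * ‖iteratedFDeriv ℝ n Ξ (y - x)‖ := by gcongr
    _ = (1 + ‖y - x‖) ^ k * ‖iteratedFDeriv ℝ n Ξ (y - x)‖ * (1 + ‖x‖) ^ k := by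
        rw [mul_pow]; ring
    _ ≤ A * (1 + ‖x‖) ^ k := by gcongr

/-- Bounded continuous functions with values in a normed group. -/
abbrev BddCont (d : ℕ) (F : Type*) [NormedAddCommGroup F] := BoundedContinuousFunction (Bd d) F

/-- The map `g ↦ |y|^k D^n g(y)` into a Banach space of bounded continuous functions, whose norm is
the Schwartz seminorm of index `(k, n)`. -/
def weightedDerivCLM (d k n : ℕ) :
    𝓢(Bd d, ℂ) →L[ℂ] BddCont d ((Bd d) [×n]→L[ℝ] ℂ) :=
  SchwartzMap.mkCLMtoNormedSpace (σ := RingHom.id ℂ)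
    (fun g => BoundedContinuousFunction.ofNormedAddCommGroup
      (fun y => ‖y‖ ^ k • iteratedFDeriv ℝ n g y)
      ((continuous_norm.pow k).smul ((g.smooth n).continuous_iteratedFDeriv le_rfl))
      (SchwartzMap.seminorm ℂ k n g) (fun y => by
        rw [norm_smul, norm_pow, norm_norm]
        exact SchwartzMap.le_seminorm ℂ k n g y))
    (fun f g => by
      ext1 y
      change ‖y‖ ^ k • iteratedFDeriv ℝ n ((f : Bd d → ℂ) + (g : Bd d → ℂ)) y
        = ‖y‖ ^ k • iteratedFDeriv ℝ n f y + ‖y‖ ^ k • iteratedFDeriv ℝ n g y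
      rw [iteratedFDeriv_add_apply (f.smooth n).contDiffAt (g.smooth n).contDiffAt, smul_add])
    (fun c g => by
      ext1 y
      rw [RingHom.id_apply, BoundedContinuousFunction.smul_apply]
      change ‖y‖ ^ k • iteratedFDeriv ℝ n (c • (g : Bd d → ℂ)) y
        = c • (‖y‖ ^ k • iteratedFDeriv ℝ n g y)
      rw [iteratedFDeriv_const_smul_apply (g.smooth n).contDiffAt, smul_comm])
    ⟨{(k, n)}, 1, zero_le_one, fun g => by
      rw [one_mul, Finset.sup_singleton]
      exact BoundedContinuousFunction.norm_ofNormedAddCommGroup_le _ (apply_nonneg _ _)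
        (fun y => by
          rw [norm_smul, norm_pow, norm_norm]
          exact SchwartzMap.le_seminorm ℂ k n g y)⟩

theorem weightedDerivCLM_apply (k n : ℕ) (g : 𝓢(Bd d, ℂ)) (y : Bd d) :
    weightedDerivCLM d k n g y = ‖y‖ ^ k • iteratedFDeriv ℝ n g y := rfl

theorem norm_weightedDerivCLM_le (k n : ℕ) (g : 𝓢(Bd d, ℂ)) :
    ‖weightedDerivCLM d k n g‖ ≤ SchwartzMap.seminorm ℂ k n g :=
  BoundedContinuousFunction.norm_ofNormedAddCommGroup_le _ (apply_nonneg _ _) fun y => by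
    rw [norm_smul, norm_pow, norm_norm]
    exact SchwartzMap.le_seminorm ℂ k n g y

theorem seminorm_le_norm_weightedDerivCLM (k n : ℕ) (g : 𝓢(Bd d, ℂ)) :
    SchwartzMap.seminorm ℂ k n g ≤ ‖weightedDerivCLM d k n g‖ := by
  refine SchwartzMap.seminorm_le_bound ℂ k n g (norm_nonneg (weightedDerivCLM d k n g)) fun y => ?_
  have := (weightedDerivCLM d k n g).norm_coe_le_norm y
  rwa [weightedDerivCLM_apply, norm_smul, norm_pow, norm_norm] at this

/-- A functional dominated by the norm of `J` factors through `J`, by Hahn-Banach. -/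
theorem exists_continuousLinearMap_comp_eq {X E : Type*} [AddCommGroup X] [Module ℂ X]
    [NormedAddCommGroup E] [NormedSpace ℂ E] (J : X →ₗ[ℂ] E) (B : X →ₗ[ℂ] ℂ) (C : ℝ≥0)
    (hBJ : ∀ g, ‖B g‖ ≤ C * ‖J g‖) : ∃ Bt : E →L[ℂ] ℂ, ∀ g, Bt (J g) = B g := by
  have hker : LinearMap.ker J ≤ LinearMap.ker B := by
    intro g hg
    have h1 := hBJ g
    rw [LinearMap.mem_ker.mp hg, norm_zero, mul_zero] at h1
    exact norm_le_zero_iff.mp h1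
  let f₀ : LinearMap.range J →ₗ[ℂ] ℂ :=
    ((LinearMap.ker J).liftQ B hker).comp J.quotKerEquivRange.symm.toLinearMap
  have hf₀ : ∀ g, f₀ ⟨J g, ⟨g, rfl⟩⟩ = B g := by
    intro g
    have h1 := J.quotKerEquivRange_symm_apply_image g ⟨g, rfl⟩
    change (LinearMap.ker J).liftQ B hker (J.quotKerEquivRange.symm ⟨J g, _⟩) = _
    rw [h1]
    rfl
  have hcont : Continuous (C • normSeminorm ℂ E) := continuous_norm.const_smul C
  obtain ⟨Bt, hBt, -⟩ := Module.Dual.exists_continuous_extension_of_le_seminorm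
    (LinearMap.range J) f₀ hcont (by
      rintro ⟨_, g, rfl⟩
      exact (congrArg norm (hf₀ g)).trans_le (hBJ g))
  exact ⟨Bt, fun g => by rw [hBt ⟨J g, ⟨g, rfl⟩⟩, hf₀]⟩

/-- A functional `B` controlled by finitely many maps `J i` into Banach spaces commutes with
integrals that exist in each of these spaces: by Hahn-Banach, `B` factors through their product. -/
theorem integral_apply_of_norm_le {X ι : Type*} [AddCommGroup X] [Module ℂ X] [TopologicalSpace X]
    [Fintype ι] {E : ι → Type*} [∀ i, NormedAddCommGroup (E i)] [∀ i, NormedSpace ℂ (E i)]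
    [∀ i, CompleteSpace (E i)] (J : ∀ i, X →L[ℂ] E i) (B : X →L[ℂ] ℂ) (C : ℝ≥0)
    (hBJ : ∀ g b, 0 ≤ b → (∀ i, ‖J i g‖ ≤ b) → ‖B g‖ ≤ C * b) {G : Bd d → X}
    (hJG : ∀ i, Integrable fun x => J i (G x)) (v : X) (hJv : ∀ i, ∫ x, J i (G x) = J i v) :
    (Integrable fun x => B (G x)) ∧ ∫ x, B (G x) = B v := by
  let J' : X →ₗ[ℂ] (i : ι) → E i := LinearMap.pi fun i => (J i).toLinearMap
  obtain ⟨Bt, hBtJ⟩ := exists_continuousLinearMap_comp_eq J' B.toLinearMap C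
    (fun g => hBJ g _ (norm_nonneg (J' g)) fun i => norm_le_pi_norm (J' g) i)
  change ∀ g, Bt (J' g) = B g at hBtJ
  have hJ' : Integrable fun x => J' (G x) := Integrable.of_eval hJG
  have hv : ∫ x, J' (G x) = J' v := by
    funext i
    exact (eval_integral hJG i).trans (hJv i)
  refine ⟨?_, ?_⟩
  · have := Bt.integrable_comp hJ'
    simpa only [hBtJ] using this
  · have := Bt.integral_comp_comm hJ'
    simpa only [hBtJ, hv] using this

/-- A tempered distribution commutes with the integral of a continuous family of Schwartz functions
that is integrable in every seminorm. The distribution is controlled by finitely many seminorms, so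
by Hahn-Banach it extends to a Banach space, where Bochner's integral is available. -/
theorem integral_tempered_apply (B : 𝓢(Bd d, ℂ) →L[ℂ] ℂ) (G : Bd d → 𝓢(Bd d, ℂ))
    (hG : Continuous G) (hint : ∀ k n, Integrable fun x => SchwartzMap.seminorm ℂ k n (G x))
    (v : 𝓢(Bd d, ℂ))
    (hv : ∀ n y, iteratedFDeriv ℝ n v y = ∫ x, iteratedFDeriv ℝ n (G x) y) :
    (Integrable fun x => B (G x)) ∧ ∫ x, B (G x) = B v := by
  obtain ⟨s, C, -, hB⟩ := Seminorm.bound_of_continuous (schwartz_withSeminorms ℂ (Bd d) ℂ)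
    B.toLinearMap.toSeminorm B.continuous.norm
  have hJG : ∀ k n, Integrable fun x => weightedDerivCLM d k n (G x) := by
    intro k n
    exact (hint k n).mono' ((weightedDerivCLM d k n).continuous.comp hG).aestronglyMeasurable
      (Filter.Eventually.of_forall fun x => norm_weightedDerivCLM_le k n (G x))
  refine integral_apply_of_norm_le (fun i : s => weightedDerivCLM d i.1.1 i.1.2) B C ?_
    (fun i => hJG _ _) v fun i => ?_
  · intro g b hb h
    refine (hB g).trans ?_
    rw [smul_apply, NNReal.smul_def, smul_eq_mul]
    gcongr
    exact Seminorm.finset_sup_apply_le hb fun i hi =>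
      (seminorm_le_norm_weightedDerivCLM i.1 i.2 g).trans (h ⟨i, hi⟩)
  · ext1 y
    have h1 := (BoundedContinuousFunction.evalCLM ℂ y).integral_comp_comm (hJG i.1.1 i.1.2)
    change BoundedContinuousFunction.evalCLM ℂ y (∫ x, weightedDerivCLM d i.1.1 i.1.2 (G x)) = _
    rw [← h1]
    change ∫ x, ‖y‖ ^ i.1.1 • iteratedFDeriv ℝ i.1.2 (G x) y
      = ‖y‖ ^ i.1.1 • iteratedFDeriv ℝ i.1.2 v y
    rw [integral_smul, hv]

/-- Convolution of Schwartz functions. -/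
abbrev sconv (h Ξ : 𝓢(Bd d, ℂ)) : 𝓢(Bd d, ℂ) :=
  SchwartzMap.convolution (ContinuousLinearMap.mul ℂ ℂ) h Ξ

theorem sconv_apply (h Ξ : 𝓢(Bd d, ℂ)) (y : Bd d) : sconv h Ξ y = ∫ x, h x * Ξ (y - x) := by
  rw [sconv, SchwartzMap.convolution_apply, convolution_def]
  rfl

theorem fourierInv_sconv_apply (h Ξ : 𝓢(Bd d, ℂ)) (ξ : Bd d) :
    (𝓕⁻ (sconv h Ξ) : 𝓢(Bd d, ℂ)) ξ = (𝓕⁻ h : 𝓢(Bd d, ℂ)) ξ * (𝓕⁻ Ξ : 𝓢(Bd d, ℂ)) ξ := by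
  have hneg : ∀ g : 𝓢(Bd d, ℂ), (𝓕⁻ g : 𝓢(Bd d, ℂ)) ξ = (𝓕 g : 𝓢(Bd d, ℂ)) (-ξ) := fun g => by
    rw [SchwartzMap.fourierInv_coe, SchwartzMap.fourier_coe, Real.fourierInv_eq_fourier_neg]
  rw [hneg, hneg, hneg, SchwartzMap.fourier_convolution, SchwartzMap.pairing_apply_apply]
  rfl

theorem lineDerivOp_sconv (h Ξ : 𝓢(Bd d, ℂ)) (m : Bd d) :
    ∂_{m} (sconv h Ξ) = sconv h (∂_{m} Ξ) := by
  have hm : (fun ξ : Bd d => (inner ℝ ξ m : ℝ)).HasTemperateGrowth :=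
    ((innerSL ℝ).flip m).hasTemperateGrowth
  have h1 : ∀ g : 𝓢(Bd d, ℂ), sconv h g
      = 𝓕⁻ (SchwartzMap.pairing (ContinuousLinearMap.mul ℂ ℂ) (𝓕 h) (𝓕 g)) := fun g => by
    rw [← SchwartzMap.fourier_convolution, FourierTransform.fourierInv_fourier_eq]
  rw [h1 Ξ, h1 (∂_{m} Ξ), SchwartzMap.lineDerivOp_fourierInv_eq, SchwartzMap.fourier_lineDerivOp_eq]
  congr 1
  ext ξ
  simp only [smul_apply, SchwartzMap.smulLeftCLM_apply_apply hm, SchwartzMap.pairing_apply_apply,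
    ContinuousLinearMap.mul_apply', smul_eq_mul, Complex.real_smul]
  ring

theorem iteratedLineDerivOp_sconv (h Ξ : 𝓢(Bd d, ℂ)) {n : ℕ} (m : Fin n → Bd d) :
    ∂^{m} (sconv h Ξ) = sconv h (∂^{m} Ξ) := by
  induction n with
  | zero => simp
  | succ n ih =>
    rw [LineDeriv.iteratedLineDerivOp_succ_left, LineDeriv.iteratedLineDerivOp_succ_left, ih,
      lineDerivOp_sconv]

/-- `∫ h(x) ⟨B, Ξ(· - x)⟩ dx = ⟨B, h ∗ Ξ⟩`. -/
theorem integral_mul_tempered_compSubConst (B : 𝓢(Bd d, ℂ) →L[ℂ] ℂ) (h Ξ : 𝓢(Bd d, ℂ)) :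
    (Integrable fun x => h x * B (Ξ.compSubConstCLM ℂ x)) ∧
      ∫ x, h x * B (Ξ.compSubConstCLM ℂ x) = B (sconv h Ξ) := by
  have hderiv : ∀ (n : ℕ) (x y : Bd d),
      iteratedFDeriv ℝ n (h x • Ξ.compSubConstCLM ℂ x : 𝓢(Bd d, ℂ)) y
      = h x • iteratedFDeriv ℝ n Ξ (y - x) := by
    intro n x y
    have h1 : ((h x • Ξ.compSubConstCLM ℂ x : 𝓢(Bd d, ℂ)) : Bd d → ℂ)
        = h x • fun z => Ξ (z - x) := rfl
    have hs : ContDiff ℝ n fun z => Ξ (z - x) :=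
      (Ξ.smooth n).comp (contDiff_id.sub contDiff_const)
    rw [h1, iteratedFDeriv_const_smul_apply hs.contDiffAt, iteratedFDeriv_comp_sub]
  have key := integral_tempered_apply B (fun x => h x • Ξ.compSubConstCLM ℂ x)
    (h.continuous.smul (continuous_compSubConst Ξ)) (fun k n => ?_) (sconv h Ξ) (fun n y => ?_)
  · simpa only [map_smul, smul_eq_mul] using key
  · obtain ⟨C, hC0, hC⟩ := exists_seminorm_compSubConst_le Ξ k n
    have hdom : Integrable fun x => ‖h x‖ * (C * (1 + ‖x‖) ^ k) := by
      have hb : ∀ x : Bd d, ‖h x‖ * (C * (1 + ‖x‖) ^ k)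
          ≤ C * 2 ^ k * (‖h x‖ + ‖x‖ ^ k * ‖h x‖) := by
        intro x
        have h2 : (1 + ‖x‖) ^ k ≤ 2 ^ k * (1 + ‖x‖ ^ k) := by
          rcases le_total ‖x‖ 1 with hx | hx
          · calc (1 + ‖x‖) ^ k ≤ 2 ^ k := by gcongr; linarith
              _ ≤ 2 ^ k * (1 + ‖x‖ ^ k) := le_mul_of_one_le_right (by positivity)
                  (by linarith [pow_nonneg (norm_nonneg x) k])
          · calc (1 + ‖x‖) ^ k ≤ (2 * ‖x‖) ^ k := by gcongr; linarith
              _ ≤ 2 ^ k * (1 + ‖x‖ ^ k) := by rw [mul_pow]; gcongr; linarith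
        calc ‖h x‖ * (C * (1 + ‖x‖) ^ k) ≤ ‖h x‖ * (C * (2 ^ k * (1 + ‖x‖ ^ k))) := by gcongr
          _ = _ := by ring
      refine Integrable.mono' (((h.integrable (μ := volume)).norm.add
        (h.integrable_pow_mul volume k)).const_mul (C * 2 ^ k)) ?_
        (Filter.Eventually.of_forall fun x => ?_)
      · exact (h.continuous.norm.mul (continuous_const.mul
          ((continuous_const.add continuous_norm).pow k))).aestronglyMeasurable
      · rw [Real.norm_of_nonneg (by positivity)]
        exact hb x
    refine hdom.mono' ?_ (Filter.Eventually.of_forall fun x => ?_)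
    · have hc := (schwartz_withSeminorms ℂ (Bd d) ℂ).continuous_seminorm (k, n)
      exact (hc.comp (h.continuous.smul (continuous_compSubConst Ξ))).aestronglyMeasurable
    · rw [Real.norm_of_nonneg (apply_nonneg _ _), map_smul_eq_mul]
      gcongr
      exact hC x
  · simp_rw [hderiv]
    have hi : Integrable fun x => h x • iteratedFDeriv ℝ n Ξ (y - x) := by
      refine Integrable.mono' ((h.integrable (μ := volume)).norm.mul_const
        (SchwartzMap.seminorm ℂ 0 n Ξ)) ?_ (Filter.Eventually.of_forall fun x => ?_)
      · exact (h.continuous.smul (((Ξ.smooth n).continuous_iteratedFDeriv le_rfl).comp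
          (continuous_const.sub continuous_id))).aestronglyMeasurable
      · rw [norm_smul]
        gcongr
        exact SchwartzMap.norm_iteratedFDeriv_le_seminorm ℂ Ξ n _
    ext m
    have h1 := (ContinuousMultilinearMap.apply ℝ (fun _ : Fin n => Bd d) ℂ m).integral_comp_comm hi
    change _ = ContinuousMultilinearMap.apply ℝ (fun _ : Fin n => Bd d) ℂ m _
    rw [← h1, ← SchwartzMap.iteratedLineDerivOp_eq_iteratedFDeriv, iteratedLineDerivOp_sconv,
      sconv_apply]
    refine integral_congr_ae (Filter.Eventually.of_forall fun x => ?_)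
    simp only [SchwartzMap.iteratedLineDerivOp_eq_iteratedFDeriv]
    rfl

/-! ### Littlewood-Paley blocks of a distribution -/

/-- `ξ ↦ e^{2πi x·ξ} m(ξ)` as a Schwartz function, for a smooth compactly supported `m`. -/
def modulate (m : Bd d → ℂ) (hm : ContDiff ℝ ∞ m) (hc : HasCompactSupport m) (x : Bd d) :
    𝓢(Bd d, ℂ) :=
  HasCompactSupport.toSchwartzMap
    (f := fun ξ => Complex.exp (((2 * Real.pi * ⟪ξ, x⟫ : ℝ) : ℂ) * Complex.I) * m ξ)
    hc.mul_left
    (by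
      refine ContDiff.mul (ContDiff.cexp (ContDiff.mul ?_ contDiff_const)) hm
      exact Complex.ofRealCLM.contDiff.comp
        (contDiff_const.mul (contDiff_id.inner ℝ contDiff_const)))

theorem fourier_modulate_apply (m : Bd d → ℂ) (hm : ContDiff ℝ ∞ m) (hc : HasCompactSupport m)
    (x y : Bd d) : (𝓕 (modulate m hm hc x) : 𝓢(Bd d, ℂ)) y = 𝓕⁻ m (x - y) := by
  rw [SchwartzMap.fourier_coe, Real.fourier_eq', Real.fourierInv_eq']
  congr 1
  funext ξ
  change _ • (Complex.exp _ * m ξ) = _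
  rw [smul_eq_mul, smul_eq_mul, ← mul_assoc, ← Complex.exp_add, inner_sub_right]
  congr 2
  push_cast
  ring

theorem fourierInv_lpTest_apply (φ : Cutoff d) (k : ℤ) (x ξ : Bd d) :
    (𝓕⁻ (lpTest φ k x : 𝓢(Bd d, ℂ)) : 𝓢(Bd d, ℂ)) ξ
      = Complex.exp (((2 * Real.pi * ⟪ξ, x⟫ : ℝ) : ℂ) * Complex.I) * (psi φ k ξ : ℂ) := by
  change (𝓕⁻ (𝓕 (modPsi φ k x)) : 𝓢(Bd d, ℂ)) ξ = _
  rw [FourierTransform.fourierInv_fourier_eq]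
  rfl

theorem fourierInv_lpTest_zero_apply (φ : Cutoff d) (k : ℤ) (ξ : Bd d) :
    (𝓕⁻ (lpTest φ k 0 : 𝓢(Bd d, ℂ)) : 𝓢(Bd d, ℂ)) ξ = (psi φ k ξ : ℂ) := by
  rw [fourierInv_lpTest_apply, inner_zero_right]
  simp

theorem lpTest_eq_compSubConst (φ : Cutoff d) (k : ℤ) (x : Bd d) :
    (lpTest φ k x : 𝓢(Bd d, ℂ)) = (lpTest φ k 0 : 𝓢(Bd d, ℂ)).compSubConstCLM ℂ x := by
  ext y
  rw [SchwartzMap.compSubConstCLM_apply, lpTest_apply, lpTest_apply]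
  abel_nf

theorem fourierInv_injective : Function.Injective fun g : 𝓢(Bd d, ℂ) => (𝓕⁻ g : 𝓢(Bd d, ℂ)) :=
  fun g h hgh => by
    have h1 := congrArg (fun u : 𝓢(Bd d, ℂ) => (𝓕 u : 𝓢(Bd d, ℂ))) hgh
    simpa only [FourierTransform.fourier_fourierInv_eq] using h1

/-- The test function defining `Δ̇_k` at `x` is reproduced by convolution with the Fourier transform
of any multiplier equal to `1` on the support of `ψ_k`. -/
theorem sconv_fourier_modulate (φ : Cutoff d) (k : ℤ) (x : Bd d) (m : Bd d → ℂ)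
    (hm : ContDiff ℝ ∞ m) (hc : HasCompactSupport m) (h1 : ∀ ξ, psi φ k ξ ≠ 0 → m ξ = 1) :
    sconv (𝓕 (modulate m hm hc x)) (lpTest φ k 0 : 𝓢(Bd d, ℂ)) = lpTest φ k x := by
  apply fourierInv_injective
  ext ξ
  change (𝓕⁻ (sconv _ _) : 𝓢(Bd d, ℂ)) ξ = (𝓕⁻ (lpTest φ k x : 𝓢(Bd d, ℂ)) : 𝓢(Bd d, ℂ)) ξ
  rw [fourierInv_sconv_apply, FourierTransform.fourierInv_fourier_eq, fourierInv_lpTest_zero_apply,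
    fourierInv_lpTest_apply]
  change Complex.exp _ * m ξ * _ = _
  by_cases h : psi φ k ξ = 0
  · simp [h]
  · rw [h1 ξ h, mul_one]

/-- A functional on `𝒮̇` extends to a tempered distribution, by Hahn-Banach. -/
theorem exists_tempered_extension (f : SDot' d) :
    ∃ B : 𝓢(Bd d, ℂ) →L[ℂ] ℂ, ∀ g : SDot d, B g = f g :=
  haveI := (schwartz_withSeminorms ℂ (Bd d) ℂ).toPolynormableSpace
  StrongDual.exists_extension (SDot d) f

theorem lpBlock_eq (φ : Cutoff d) (k : ℤ) {f : SDot' d} {B : 𝓢(Bd d, ℂ) →L[ℂ] ℂ}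
    (hB : ∀ g : SDot d, B g = f g) (x : Bd d) :
    lpBlock φ k f x = B ((lpTest φ k 0 : 𝓢(Bd d, ℂ)).compSubConstCLM ℂ x) := by
  rw [lpBlock, ← hB, lpTest_eq_compSubConst]

theorem continuous_lpBlock (φ : Cutoff d) (k : ℤ) (f : SDot' d) : Continuous (lpBlock φ k f) := by
  obtain ⟨B, hB⟩ := exists_tempered_extension f
  simp_rw [funext (lpBlock_eq φ k hB)]
  exact B.continuous.comp (continuous_compSubConst _)

/-- Pairing a block of `f` with a Schwartz function `h`; on `𝒮̇` the functional `B` agrees with `f`.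
-/
theorem integral_mul_lpBlock (φ : Cutoff d) (k : ℤ) {f : SDot' d} {B : 𝓢(Bd d, ℂ) →L[ℂ] ℂ}
    (hB : ∀ g : SDot d, B g = f g) (h : 𝓢(Bd d, ℂ)) :
    (Integrable fun y => h y * lpBlock φ k f y) ∧
      ∫ y, h y * lpBlock φ k f y = B (sconv h (lpTest φ k 0 : 𝓢(Bd d, ℂ))) := by
  simp_rw [lpBlock_eq φ k hB]
  exact integral_mul_tempered_compSubConst B h _

/-- A smooth function equal to `1` on the support of `ψ_0`, supported in an annulus. -/
def wide (φ : Cutoff d) (ξ : Bd d) : ℂ :=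
  ((φ.toFun ((2 : ℝ)⁻¹ • ξ) - φ.toFun ((4 : ℝ) • ξ) : ℝ) : ℂ)

theorem contDiff_wide (φ : Cutoff d) : ContDiff ℝ ∞ (wide φ) :=
  Complex.ofRealCLM.contDiff.comp
    ((φ.smooth.comp (contDiff_const_smul _)).sub (φ.smooth.comp (contDiff_const_smul _)))

theorem hasCompactSupport_wide (φ : Cutoff d) : HasCompactSupport (wide φ) := by
  refine HasCompactSupport.intro (isCompact_closedBall (0 : Bd d) 4) fun ξ hξ => ?_
  have h1 : 4 < ‖ξ‖ := by simpa using hξ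
  rw [wide, φ.eq_zero, φ.eq_zero, sub_zero, Complex.ofReal_zero] <;>
    rw [norm_smul] <;> norm_num <;> linarith

theorem wide_eventually_eq_zero (φ : Cutoff d) : ∀ᶠ ξ in nhds 0, wide φ ξ = 0 := by
  filter_upwards [Metric.ball_mem_nhds (0 : Bd d) (ε := 1 / 4) (by norm_num)] with ξ hξ
  have h1 : ‖ξ‖ < 1 / 4 := by simpa using hξ
  rw [wide, φ.eq_one, φ.eq_one, sub_self, Complex.ofReal_zero] <;>
    rw [norm_smul] <;> norm_num <;> linarith

theorem wide_eq_one (φ : Cutoff d) (k : ℤ) (ξ : Bd d) (h : psi φ k ξ ≠ 0) :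
    wide φ ((2 : ℝ) ^ (-k) • ξ) = 1 := by
  have hp : (0 : ℝ) < (2 : ℝ) ^ (-k) := by positivity
  have h1 : ‖(2 : ℝ) ^ (-k) • ξ‖ = (2 : ℝ) ^ (-k) * ‖ξ‖ := by
    rw [norm_smul, Real.norm_of_nonneg hp.le]
  have h2 : (2 : ℝ) ^ (-k) * ‖ξ‖ ≤ 2 := by
    by_contra hlt
    exact h (psi_eq_zero_of_large φ k ξ (not_le.mp hlt))
  have h3 : 1 / 2 < (2 : ℝ) ^ (-k) * ‖ξ‖ := by
    by_contra hlt
    exact h (psi_eq_zero_of_small φ k ξ (not_lt.mp hlt))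
  rw [wide, φ.eq_one, φ.eq_zero, sub_zero, Complex.ofReal_one] <;>
    rw [norm_smul, h1, Real.norm_of_nonneg (by norm_num)] <;> linarith

/-- The inverse Fourier transform of `wide φ`. -/
def wideKer (φ : Cutoff d) : 𝓢(Bd d, ℂ) :=
  𝓕⁻ ((hasCompactSupport_wide φ).toSchwartzMap (contDiff_wide φ))

theorem fourierInv_wide_smul (φ : Cutoff d) (k : ℤ) (x : Bd d) :
    𝓕⁻ (fun ξ => wide φ ((2 : ℝ) ^ (-k) • ξ)) x
      = (((2 : ℝ) ^ k) ^ d : ℝ) * wideKer φ ((2 : ℝ) ^ k • x) := by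
  have hp : (0 : ℝ) < (2 : ℝ) ^ (-k) := by positivity
  rw [wideKer, SchwartzMap.fourierInv_coe, Real.fourierInv_eq', Real.fourierInv_eq']
  have h1 : (fun ξ : Bd d => Complex.exp (((2 * Real.pi * ⟪ξ, x⟫ : ℝ) : ℂ) * Complex.I) •
        wide φ ((2 : ℝ) ^ (-k) • ξ))
      = fun ξ => (fun η : Bd d => Complex.exp (((2 * Real.pi * ⟪η, (2 : ℝ) ^ k • x⟫ : ℝ) : ℂ) *
        Complex.I) • wide φ η) ((2 : ℝ) ^ (-k) • ξ) := by
    funext ξ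
    simp only [inner_smul_left, inner_smul_right]
    have : (starRingEnd ℝ) ((2 : ℝ) ^ (-k)) * ((2 : ℝ) ^ k * ⟪ξ, x⟫) = ⟪ξ, x⟫ := by
      rw [conj_trivial, ← mul_assoc, ← zpow_add₀ two_ne_zero, neg_add_cancel, zpow_zero, one_mul]
    rw [mul_left_comm ((2 : ℝ) ^ k), this]
  have h2 := Measure.integral_comp_smul (volume : Measure (Bd d)) (fun η : Bd d => Complex.exp
    (((2 * Real.pi * ⟪η, (2 : ℝ) ^ k • x⟫ : ℝ) : ℂ) * Complex.I) • wide φ η) ((2 : ℝ) ^ (-k))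
  rw [h1, h2, finrank_euclideanSpace, Fintype.card_fin,
    abs_of_nonneg (by positivity), Complex.real_smul, zpow_neg, inv_pow, inv_inv]
  rfl

/-- The block `Δ̇_k f` is reproduced by convolution with the dilated kernel `2^{kd} Φ(2^k ·)`. -/
theorem lpBlock_eq_integral (φ : Cutoff d) (k : ℤ) (f : SDot' d) (x : Bd d) :
    (Integrable fun y => (((2 : ℝ) ^ k) ^ d : ℝ) * wideKer φ ((2 : ℝ) ^ k • (x - y)) *
        lpBlock φ k f y) ∧
      ∫ y, (((2 : ℝ) ^ k) ^ d : ℝ) * wideKer φ ((2 : ℝ) ^ k • (x - y)) * lpBlock φ k f y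
        = lpBlock φ k f x := by
  obtain ⟨B, hB⟩ := exists_tempered_extension f
  have hp : (2 : ℝ) ^ (-k) ≠ 0 := by positivity
  have hm : ContDiff ℝ ∞ fun ξ => wide φ ((2 : ℝ) ^ (-k) • ξ) :=
    (contDiff_wide φ).comp (contDiff_const_smul _)
  have hc : HasCompactSupport fun ξ => wide φ ((2 : ℝ) ^ (-k) • ξ) :=
    (hasCompactSupport_wide φ).comp_smul hp
  have h1 := integral_mul_lpBlock φ k hB (𝓕 (modulate _ hm hc x))
  rw [sconv_fourier_modulate φ k x _ hm hc (wide_eq_one φ k), hB] at h1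
  simp only [fourier_modulate_apply, fourierInv_wide_smul] at h1
  exact h1

/-- The dilates `s^d Φ(s ·)` of a Schwartz function are controlled by the Poisson weight, even after
multiplication by a power of `1 + |s x|`. -/
theorem exists_weighted_dilate_le_pw (Φ : 𝓢(Bd d, ℂ)) (N : ℕ) : ∃ C : ℝ, 0 ≤ C ∧
    ∀ s : ℝ, 0 < s → ∀ x : Bd d, (1 + ‖s • x‖) ^ N * (s ^ d * ‖Φ (s • x)‖) ≤ C * pw s⁻¹ x := by
  refine ⟨2 ^ (d + 1 + N) * (Finset.Iic (d + 1 + N, 0)).sup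
    (fun m => SchwartzMap.seminorm ℂ m.1 m.2) Φ, by positivity, fun s hs x => ?_⟩
  have h := SchwartzMap.one_add_le_sup_seminorm_apply (𝕜 := ℂ) (m := (d + 1 + N, 0))
    (k := d + 1 + N) (n := 0) le_rfl le_rfl Φ (s • x)
  rw [norm_iteratedFDeriv_zero] at h
  rw [pw_eq_scale (inv_pos.mpr hs), inv_inv, inv_pow, inv_inv, mul_left_comm,
    mul_left_comm _ (s ^ d)]
  refine mul_le_mul_of_nonneg_left ?_ (by positivity)
  rw [← div_eq_mul_inv, le_div_iff₀ (by positivity)]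
  refine le_trans (le_of_eq ?_) h
  rw [pow_add]
  ring

theorem exists_dilate_le_pw (Φ : 𝓢(Bd d, ℂ)) : ∃ C : ℝ≥0, ∀ (s : ℝ), 0 < s → ∀ x : Bd d,
    s ^ d * ‖Φ (s • x)‖ ≤ C * pw s⁻¹ x := by
  obtain ⟨C, hC0, hC⟩ := exists_weighted_dilate_le_pw Φ 0
  refine ⟨NNReal.mk C hC0, fun s hs x => ?_⟩
  simpa only [pow_zero, one_mul, NNReal.coe_mk] using hC s hs x

/-- The sub-mean-value property of a block: its modulus is controlled by its average at scale
`2^{-k}`, because the block is reproduced by `lpBlock_eq_integral`. -/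
theorem exists_enorm_lpBlock_le_pwConv (φ : Cutoff d) :
    ∃ C : ℝ≥0, ∀ (f : SDot' d) (k : ℤ) (x : Bd d),
    ‖lpBlock φ k f x‖ₑ ≤ C * pwConv ((2 : ℝ) ^ k)⁻¹ (fun y => ‖lpBlock φ k f y‖ₑ) x := by
  obtain ⟨C, hC⟩ := exists_dilate_le_pw (wideKer φ)
  refine ⟨C, fun f k x => ?_⟩
  rw [← (lpBlock_eq_integral φ k f x).2]
  refine (enorm_integral_le_lintegral_enorm _).trans ?_
  rw [pwConv, ← lintegral_const_mul' _ _ ENNReal.coe_ne_top]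
  refine lintegral_mono fun y => ?_
  rw [enorm_mul, ← mul_assoc]
  refine mul_le_mul_left ?_ _
  rw [← ENNReal.ofReal_coe_nnreal, ← ENNReal.ofReal_mul C.coe_nonneg, ← ofReal_norm]
  refine ENNReal.ofReal_le_ofReal ?_
  rw [norm_mul, Complex.norm_real, Real.norm_of_nonneg (by positivity)]
  exact hC _ (by positivity) (x - y)

/-! ### Pointwise bounds of the blocks in terms of the Triebel-Lizorkin norm -/

theorem tlNorm_rpow (φ : Cutoff d) {σ p q : ℝ} (hp : 0 < p) (f : SDot' d) :
    tlNorm φ σ p q f ^ p = ∫⁻ x, ((∑' j : ℤ,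
      (ENNReal.ofReal ((2 : ℝ) ^ ((j : ℝ) * σ)) * ‖lpBlock φ j f x‖ₑ) ^ q) ^ (1 / q)) ^ p := by
  have hp0 : ENNReal.ofReal p ≠ 0 := by simpa using hp
  rw [tlNorm, eLpNorm_eq_lintegral_rpow_enorm_toReal hp0 ENNReal.ofReal_ne_top,
    ENNReal.toReal_ofReal hp.le, ← ENNReal.rpow_mul, one_div_mul_cancel hp.ne', ENNReal.rpow_one]
  simp only [enorm_eq_self]

theorem lintegral_enorm_lpBlock_rpow_le (φ : Cutoff d) {σ p q : ℝ} (hp : 0 < p) (hq : 0 < q)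
    (f : SDot' d) (k : ℤ) :
    ∫⁻ y, ‖lpBlock φ k f y‖ₑ ^ p
      ≤ ENNReal.ofReal ((2 : ℝ) ^ (-((k : ℝ) * σ))) ^ p * tlNorm φ σ p q f ^ p := by
  rw [tlNorm_rpow φ hp, ← lintegral_const_mul' _ _
    (ENNReal.rpow_ne_top_of_nonneg hp.le ENNReal.ofReal_ne_top)]
  refine lintegral_mono fun y => ?_
  rw [← ENNReal.mul_rpow_of_nonneg _ _ hp.le]
  refine ENNReal.rpow_le_rpow ?_ hp.le
  have h1 : ENNReal.ofReal ((2 : ℝ) ^ ((k : ℝ) * σ)) * ‖lpBlock φ k f y‖ₑ ≤ (∑' j : ℤ,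
      (ENNReal.ofReal ((2 : ℝ) ^ ((j : ℝ) * σ)) * ‖lpBlock φ j f y‖ₑ) ^ q) ^ (1 / q) := by
    rw [one_div, ENNReal.le_rpow_inv_iff hq]
    exact ENNReal.le_tsum k
  refine le_trans ?_ (mul_le_mul_right h1 _)
  rw [← mul_assoc, ← ENNReal.ofReal_mul (by positivity), ← Real.rpow_add two_pos, neg_add_cancel,
    Real.rpow_zero, ENNReal.ofReal_one, one_mul]

/-- The hypothesis `q > (d+1)/d` enters only through these inequalities, where `p = d q (q-1)`. -/
theorem one_lt_expP (hd : 1 ≤ d) {q : ℝ} (hq : ((d : ℝ) + 1) / d < q) :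
    1 < q ∧ 1 < (d : ℝ) * (q - 1) ∧ q < expP d q := by
  have hd0 : (1 : ℝ) ≤ d := by exact_mod_cast hd
  rw [div_lt_iff₀ (by linarith)] at hq
  have h1 : 1 < (d : ℝ) * (q - 1) := by linarith
  have h2 : 1 < q := by nlinarith
  refine ⟨h2, h1, ?_⟩
  have : expP d q = q * ((d : ℝ) * (q - 1)) := by rw [expP]; ring
  rw [this]
  nlinarith

/-- Bernstein's inequality: `‖Δ̇_k f‖_∞ ≤ C 2^{k/(q-1)} ‖f‖` for the norm of `Ḟ^{-1/q}_{p,q}`, since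
`1/q + d/p = 1/(q-1)`. By the sub-mean-value property and Jensen's inequality, `|Δ̇_k f|^p` is at
most `2^{kd}` times the integral of `|Δ̇_k f|^p`. -/
theorem exists_enorm_lpBlock_le (hd : 1 ≤ d) {q : ℝ} (hq : ((d : ℝ) + 1) / d < q) (φ : Cutoff d) :
    ∃ C : ℝ≥0, ∀ (f : SDot' d) (k : ℤ) (x : Bd d),
      ‖lpBlock φ k f x‖ₑ ≤ ENNReal.ofReal (((2 : ℝ) ^ k) ^ (1 / (q - 1))) *
        (C * tlNorm φ (-1 / q) (expP d q) q f) := by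
  obtain ⟨hq1, hdq, hqp⟩ := one_lt_expP hd hq
  set p := expP d q with hpdef
  have hp1 : 1 < p := hq1.trans hqp
  have hp0 : 0 < p := by linarith
  obtain ⟨C, hC⟩ := exists_enorm_lpBlock_le_pwConv φ
  have hM : pwMass d ^ ((p - 1) / p) ≠ ⊤ :=
    ENNReal.rpow_ne_top_of_nonneg (div_nonneg (by linarith) hp0.le) pwMass_ne_top
  refine ⟨C * (pwMass d ^ ((p - 1) / p)).toNNReal, fun f k x => ?_⟩
  set T := tlNorm φ (-1 / q) p q f
  set t : ℝ := ((2 : ℝ) ^ k)⁻¹ with ht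
  have ht0 : 0 < t := by positivity
  have hv : Measurable fun y => ‖lpBlock φ k f y‖ₑ := (continuous_lpBlock φ k f).measurable.enorm
  refine (hC f k x).trans ?_
  rw [ENNReal.coe_mul, ENNReal.coe_toNNReal hM, mul_assoc, mul_left_comm]
  refine mul_le_mul_right ?_ _
  rw [← ENNReal.rpow_le_rpow_iff hp0]
  refine (pwConv_rpow_le ht0 hp1 hv x).trans ?_
  have h1 : pwConv t (fun y => ‖lpBlock φ k f y‖ₑ ^ p) x
      ≤ ENNReal.ofReal (t ^ d)⁻¹ * ∫⁻ y, ‖lpBlock φ k f y‖ₑ ^ p := by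
    rw [pwConv, ← lintegral_const_mul' _ _ ENNReal.ofReal_ne_top]
    exact lintegral_mono fun y =>
      mul_le_mul_left (ENNReal.ofReal_le_ofReal (pw_le_inv_pow ht0 _)) _
  have h2 := lintegral_enorm_lpBlock_rpow_le φ (σ := -1 / q) hp0 (by linarith : 0 < q) f k
  rw [ENNReal.mul_rpow_of_nonneg _ _ hp0.le, ENNReal.mul_rpow_of_nonneg _ _ hp0.le,
    ← ENNReal.rpow_mul, div_mul_cancel₀ _ hp0.ne', mul_left_comm]
  refine mul_le_mul_right ((h1.trans (mul_le_mul_right h2 _)).trans ?_) _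
  rw [← mul_assoc]
  refine mul_le_mul_left (le_of_eq ?_) _
  have h2k : (0 : ℝ) < 2 ^ k := by positivity
  rw [ENNReal.ofReal_rpow_of_pos (by positivity), ENNReal.ofReal_rpow_of_pos (by positivity),
    ← ENNReal.ofReal_mul (by positivity)]
  congr 1
  have e1 : (t ^ d)⁻¹ = ((2 : ℝ) ^ k) ^ (d : ℝ) := by
    rw [ht, inv_pow, inv_inv, Real.rpow_natCast]
  have e2 : (2 : ℝ) ^ (-((k : ℝ) * (-1 / q))) = ((2 : ℝ) ^ k) ^ (1 / q) := by
    rw [← Real.rpow_intCast, ← Real.rpow_mul zero_le_two]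
    congr 1
    ring
  rw [e1, e2, ← Real.rpow_mul h2k.le, ← Real.rpow_mul h2k.le, ← Real.rpow_add h2k]
  congr 1
  have hq2 : q - 1 ≠ 0 := by linarith
  have hq0 : q ≠ 0 := by linarith
  rw [hpdef, expP]
  field_simp
  ring

/-! ### The Littlewood-Paley decomposition in `𝒮̇` -/

theorem norm_iteratedFDeriv_comp_smul_le {g : Bd d → ℝ} (hg : ContDiff ℝ ∞ g) (R : ℝ) (n : ℕ)
    (x : Bd d) :
    ‖iteratedFDeriv ℝ n (fun y => g (R • y)) x‖ ≤ ‖iteratedFDeriv ℝ n g (R • x)‖ * |R| ^ n := by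
  set L : Bd d →L[ℝ] Bd d := R • ContinuousLinearMap.id ℝ (Bd d)
  have h1 := L.iteratedFDeriv_comp_right (i := n) hg x (mod_cast le_top)
  have h2 : (fun y => g (R • y)) = g ∘ L := rfl
  have h3 : ‖L‖ ≤ |R| := by
    refine L.opNorm_le_bound (abs_nonneg R) fun y => ?_
    change ‖R • y‖ ≤ _
    rw [norm_smul, Real.norm_eq_abs]
  rw [h2, h1]
  refine (ContinuousMultilinearMap.norm_compContinuousLinearMap_le _ _).trans ?_
  rw [Finset.prod_const, Finset.card_univ, Fintype.card_fin]
  gcongr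
  exact le_rfl

theorem Cutoff.iteratedFDeriv_eq_zero (φ : Cutoff d) (n : ℕ) {x : Bd d} (hx : 2 < ‖x‖) :
    iteratedFDeriv ℝ n φ.toFun x = 0 := by
  have h1 : φ.toFun =ᶠ[nhds x] fun _ => (0 : ℝ) := by
    filter_upwards [continuous_norm.continuousAt.eventually (lt_mem_nhds hx)] with y hy
    exact φ.eq_zero y hy
  rw [(h1.iteratedFDeriv ℝ n).self_of_nhds, iteratedFDeriv_fun_zero]
  rfl

theorem Cutoff.exists_norm_iteratedFDeriv_le (φ : Cutoff d) (n : ℕ) :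
    ∃ C : ℝ, 0 ≤ C ∧ ∀ x, ‖iteratedFDeriv ℝ n φ.toFun x‖ ≤ C := by
  have hc : HasCompactSupport φ.toFun :=
    HasCompactSupport.intro (isCompact_closedBall (0 : Bd d) 2) fun ξ hξ =>
      φ.eq_zero ξ (by simpa using hξ)
  obtain ⟨C, hC⟩ := (hc.iteratedFDeriv (𝕜 := ℝ) n).exists_bound_of_continuous
    (φ.smooth.continuous_iteratedFDeriv (mod_cast le_top))
  exact ⟨C, (norm_nonneg _).trans (hC 0), hC⟩

/-- The complementary cut-off `1 - φ`, which vanishes on the unit ball. -/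
def Cutoff.compl (φ : Cutoff d) (x : Bd d) : ℝ := 1 - φ.toFun x

theorem Cutoff.contDiff_compl (φ : Cutoff d) : ContDiff ℝ ∞ φ.compl := contDiff_const.sub φ.smooth

theorem Cutoff.iteratedFDeriv_compl_eq_zero (φ : Cutoff d) (n : ℕ) {x : Bd d} (hx : ‖x‖ < 1) :
    iteratedFDeriv ℝ n φ.compl x = 0 := by
  have h1 : φ.compl =ᶠ[nhds x] fun _ => (0 : ℝ) := by
    filter_upwards [continuous_norm.continuousAt.eventually (gt_mem_nhds hx)] with y hy
    rw [Cutoff.compl, φ.eq_one y (le_of_lt hy), sub_self]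
  rw [(h1.iteratedFDeriv ℝ n).self_of_nhds, iteratedFDeriv_fun_zero]
  rfl

theorem Cutoff.exists_norm_iteratedFDeriv_compl_le (φ : Cutoff d) (n : ℕ) :
    ∃ C : ℝ, 0 ≤ C ∧ ∀ x, ‖iteratedFDeriv ℝ n φ.compl x‖ ≤ C := by
  obtain ⟨C, hC0, hC⟩ := φ.exists_norm_iteratedFDeriv_le n
  refine ⟨‖iteratedFDeriv ℝ n (fun _ : Bd d => (1 : ℝ)) 0‖ + C, by positivity, fun x => ?_⟩
  have h1 : φ.compl = (fun _ : Bd d => (1 : ℝ)) - φ.toFun := rfl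
  rw [h1, iteratedFDeriv_sub_apply contDiff_const.contDiffAt
    (φ.smooth.of_le (mod_cast le_top)).contDiffAt]
  refine (norm_sub_le _ _).trans (add_le_add ?_ (hC x))
  cases n with
  | zero => simp [norm_iteratedFDeriv_zero]
  | succ n => simp [iteratedFDeriv_succ_const]

/-- By Leibniz' rule, `a_R u` tends to `0` in `𝒮` at rate `1/R` if the products of derivatives do.
-/
theorem exists_norm_iteratedFDeriv_smul_le (u : 𝓢(Bd d, ℂ)) (a : ℝ → Bd d → ℝ)
    (ha : ∀ R, ContDiff ℝ ∞ (a R)) (k n : ℕ)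
    (h : ∀ i j, ∃ C : ℝ, ∀ R, 1 ≤ R → ∀ ξ,
      ‖ξ‖ ^ k * (‖iteratedFDeriv ℝ i (a R) ξ‖ * ‖iteratedFDeriv ℝ j u ξ‖) ≤ C / R) :
    ∃ C : ℝ, ∀ R, 1 ≤ R → ∀ ξ,
      ‖ξ‖ ^ k * ‖iteratedFDeriv ℝ n (fun y => a R y • u y) ξ‖ ≤ C / R := by
  choose C hC using h
  refine ⟨∑ i ∈ Finset.range (n + 1), (n.choose i : ℝ) * C i (n - i), fun R hR ξ => ?_⟩
  calc ‖ξ‖ ^ k * ‖iteratedFDeriv ℝ n (fun y => a R y • u y) ξ‖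
      ≤ ‖ξ‖ ^ k * ∑ i ∈ Finset.range (n + 1),
        (n.choose i : ℝ) * ‖iteratedFDeriv ℝ i (a R) ξ‖ * ‖iteratedFDeriv ℝ (n - i) u ξ‖ := by
        gcongr
        exact norm_iteratedFDeriv_smul_le (ha R) (u.smooth ⊤) ξ (mod_cast le_top)
    _ = ∑ i ∈ Finset.range (n + 1), (n.choose i : ℝ) *
        (‖ξ‖ ^ k * (‖iteratedFDeriv ℝ i (a R) ξ‖ * ‖iteratedFDeriv ℝ (n - i) u ξ‖)) := by
        rw [Finset.mul_sum]
        exact Finset.sum_congr rfl fun i _ => by ring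
    _ ≤ ∑ i ∈ Finset.range (n + 1), (n.choose i : ℝ) * (C i (n - i) / R) := by
        gcongr with i _
        exact hC i (n - i) R hR ξ
    _ = _ := by
        rw [Finset.sum_div]
        exact Finset.sum_congr rfl fun i _ => by ring

/-- The part of `u` in `|ξ| ≥ R` is negligible: there `1 ≤ |ξ|/R`, at the cost of one power of
`|ξ|`. -/
theorem exists_norm_iteratedFDeriv_high_le (φ : Cutoff d) (u : 𝓢(Bd d, ℂ)) (k n : ℕ) :
    ∃ C : ℝ, ∀ R, 1 ≤ R → ∀ ξ,
      ‖ξ‖ ^ k * ‖iteratedFDeriv ℝ n (fun y => φ.compl (R⁻¹ • y) • u y) ξ‖ ≤ C / R := by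
  refine exists_norm_iteratedFDeriv_smul_le u (fun R y => φ.compl (R⁻¹ • y))
    (fun R => φ.contDiff_compl.comp (contDiff_const_smul _)) k n fun i j => ?_
  obtain ⟨C, hC0, hC⟩ := φ.exists_norm_iteratedFDeriv_compl_le i
  refine ⟨C * SchwartzMap.seminorm ℂ (k + 1) j u, fun R hR ξ => ?_⟩
  have hR0 : 0 < R := by linarith
  have h1 := norm_iteratedFDeriv_comp_smul_le φ.contDiff_compl R⁻¹ i ξ
  have h2 : ‖R⁻¹ • ξ‖ = R⁻¹ * ‖ξ‖ := by rw [norm_smul, Real.norm_of_nonneg (by positivity)]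
  rcases lt_or_ge ‖R⁻¹ • ξ‖ 1 with hlt | hge
  · rw [φ.iteratedFDeriv_compl_eq_zero i hlt, norm_zero, zero_mul] at h1
    rw [le_antisymm h1 (norm_nonneg _), zero_mul, mul_zero]
    positivity
  · have h3 : 1 ≤ ‖ξ‖ / R := by rw [h2] at hge; rwa [div_eq_inv_mul]
    have h4 : ‖iteratedFDeriv ℝ i (fun y => φ.compl (R⁻¹ • y)) ξ‖ ≤ C := by
      refine h1.trans ?_
      have h5 : |R⁻¹| ^ i ≤ 1 := by
        rw [abs_of_pos (by positivity)]
        exact pow_le_one₀ (by positivity) (inv_le_one_of_one_le₀ hR)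
      calc _ ≤ C * 1 := by gcongr; exact hC _
        _ = C := mul_one C
    calc ‖ξ‖ ^ k * (‖iteratedFDeriv ℝ i (fun y => φ.compl (R⁻¹ • y)) ξ‖ * ‖iteratedFDeriv ℝ j u ξ‖)
        ≤ ‖ξ‖ ^ k * (C * ‖iteratedFDeriv ℝ j u ξ‖) := by gcongr
      _ ≤ ‖ξ‖ ^ k * (C * ‖iteratedFDeriv ℝ j u ξ‖) * (‖ξ‖ / R) :=
          le_mul_of_one_le_right (by positivity) h3
      _ = C * (‖ξ‖ ^ (k + 1) * ‖iteratedFDeriv ℝ j u ξ‖) / R := by rw [pow_succ]; ring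
      _ ≤ C * SchwartzMap.seminorm ℂ (k + 1) j u / R := by
          gcongr
          exact SchwartzMap.le_seminorm ℂ (k + 1) j u ξ

/-- A Schwartz function all of whose derivatives vanish at the origin. -/
def IsFlat (u : 𝓢(Bd d, ℂ)) : Prop := ∀ n, iteratedFDeriv ℝ n u 0 = 0

/-- Every derivative of a flat function vanishes to infinite order at the origin: integrate the
bound for the next derivative. -/
theorem IsFlat.exists_norm_iteratedFDeriv_le {u : 𝓢(Bd d, ℂ)} (hu : IsFlat u) (n l : ℕ) :
    ∃ C : ℝ, 0 ≤ C ∧ ∀ ξ, ‖iteratedFDeriv ℝ l u ξ‖ ≤ C * ‖ξ‖ ^ n := by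
  induction n generalizing l with
  | zero =>
    exact ⟨SchwartzMap.seminorm ℂ 0 l u, apply_nonneg _ _, fun ξ => by
      simpa using SchwartzMap.norm_iteratedFDeriv_le_seminorm ℂ u l ξ⟩
  | succ n ih =>
    obtain ⟨C, hC0, hC⟩ := ih (l + 1)
    refine ⟨C, hC0, fun ξ => ?_⟩
    have h1 := (convex_closedBall (0 : Bd d) ‖ξ‖).norm_image_sub_le_of_norm_fderiv_le
      (f := iteratedFDeriv ℝ l u) (𝕜 := ℝ) (C := C * ‖ξ‖ ^ n) (x := 0) (y := ξ)
      (fun z _ => ((u.smooth ⊤).differentiable_iteratedFDeriv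
        (mod_cast ENat.natCast_lt_top l)).differentiableAt)
      (fun z hz => by
        rw [norm_fderiv_iteratedFDeriv]
        refine (hC z).trans ?_
        have : ‖z‖ ≤ ‖ξ‖ := by simpa using hz
        gcongr) (by simp) (by simp)
    rw [hu l, sub_zero, sub_zero] at h1
    rw [pow_succ, ← mul_assoc]
    exact h1

/-- The part of a flat function `u` in `|ξ| ≤ 2/R` is negligible: the powers of `R` lost by
differentiating the cut-off are absorbed by the vanishing of `u` at the origin. -/
theorem exists_norm_iteratedFDeriv_low_le (φ : Cutoff d) {u : 𝓢(Bd d, ℂ)} (hu : IsFlat u)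
    (k n : ℕ) : ∃ C : ℝ, ∀ R, 1 ≤ R → ∀ ξ,
      ‖ξ‖ ^ k * ‖iteratedFDeriv ℝ n (fun y => φ.toFun (R • y) • u y) ξ‖ ≤ C / R := by
  refine exists_norm_iteratedFDeriv_smul_le u (fun R y => φ.toFun (R • y))
    (fun R => φ.smooth.comp (contDiff_const_smul _)) k n fun i j => ?_
  obtain ⟨C, hC0, hC⟩ := φ.exists_norm_iteratedFDeriv_le i
  obtain ⟨A, hA0, hA⟩ := hu.exists_norm_iteratedFDeriv_le (i + 1) j
  refine ⟨2 ^ k * (C * A) * 2 ^ (i + 1), fun R hR ξ => ?_⟩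
  have hR0 : 0 < R := by linarith
  have h1 := norm_iteratedFDeriv_comp_smul_le φ.smooth R i ξ
  have h2 : ‖R • ξ‖ = R * ‖ξ‖ := by rw [norm_smul, Real.norm_of_nonneg (by positivity)]
  rw [abs_of_pos hR0] at h1
  rcases lt_or_ge 2 ‖R • ξ‖ with hlt | hge
  · rw [φ.iteratedFDeriv_eq_zero i hlt, norm_zero, zero_mul] at h1
    rw [le_antisymm h1 (norm_nonneg _), zero_mul, mul_zero]
    positivity
  · rw [h2] at hge
    have h3 : ‖ξ‖ ≤ 2 := by nlinarith [norm_nonneg ξ]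
    calc ‖ξ‖ ^ k * (‖iteratedFDeriv ℝ i (fun y => φ.toFun (R • y)) ξ‖ * ‖iteratedFDeriv ℝ j u ξ‖)
        ≤ 2 ^ k * ((C * R ^ i) * (A * ‖ξ‖ ^ (i + 1))) := by
          gcongr
          · refine h1.trans ?_
            gcongr
            exact hC _
          · exact hA ξ
      _ = 2 ^ k * (C * A) * (R * ‖ξ‖) ^ (i + 1) / R := by field_simp; ring
      _ ≤ 2 ^ k * (C * A) * 2 ^ (i + 1) / R := by gcongr

theorem smulLeft_coord_mem_SDot {h : 𝓢(Bd d, ℂ)} (hh : h ∈ SDot d) (i : Fin d) :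
    SchwartzMap.smulLeftCLM ℂ (fun z : Bd d => z i) h ∈ SDot d := by
  intro γ
  have hc : (fun z : Bd d => z i).HasTemperateGrowth :=
    (EuclideanSpace.proj (𝕜 := ℝ) i).hasTemperateGrowth
  rw [← hh (γ + Pi.single i 1)]
  refine integral_congr_ae (Filter.Eventually.of_forall fun z => ?_)
  simp only [SchwartzMap.smulLeftCLM_apply_apply hc, smul_smul, monomial, Pi.add_apply, pow_add,
    Finset.prod_mul_distrib]
  congr 2
  rw [Finset.prod_eq_single i (fun j _ hj => by simp [hj]) (by simp)]
  simp

theorem smulLeft_inner_mem_SDot {h : 𝓢(Bd d, ℂ)} (hh : h ∈ SDot d) (m : Bd d) :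
    SchwartzMap.smulLeftCLM ℂ (fun z : Bd d => inner ℝ z m) h ∈ SDot d := by
  have hm : (fun z : Bd d => (inner ℝ z m : ℝ)).HasTemperateGrowth :=
    ((innerSL ℝ).flip m).hasTemperateGrowth
  have h1 : SchwartzMap.smulLeftCLM ℂ (fun z : Bd d => (inner ℝ z m : ℝ)) h
      = ∑ i, (m i : ℂ) • SchwartzMap.smulLeftCLM ℂ (fun z : Bd d => z i) h := by
    ext z
    have hc : ∀ i, (fun z : Bd d => z i).HasTemperateGrowth := fun i =>
      (EuclideanSpace.proj (𝕜 := ℝ) i).hasTemperateGrowth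
    rw [SchwartzMap.smulLeftCLM_apply_apply hm, PiLp.inner_apply, Finset.sum_smul, sum_apply]
    refine Finset.sum_congr rfl fun i _ => ?_
    rw [smul_apply, SchwartzMap.smulLeftCLM_apply_apply (hc i)]
    simp only [RCLike.inner_apply, conj_trivial, Complex.real_smul, smul_eq_mul]
    push_cast
    ring
  rw [h1]
  exact Submodule.sum_mem _ fun i _ => Submodule.smul_mem _ _ (smulLeft_coord_mem_SDot hh i)

/-- Derivatives on the Fourier side are multiplications by coordinates, which preserve `𝒮̇`. -/
theorem exists_iteratedLineDerivOp_fourierInv {h : 𝓢(Bd d, ℂ)} (hh : h ∈ SDot d) {n : ℕ}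
    (m : Fin n → Bd d) : ∃ g ∈ SDot d, ∂^{m} (𝓕⁻ h : 𝓢(Bd d, ℂ)) = 𝓕⁻ g := by
  induction n with
  | zero => exact ⟨h, hh, by simp⟩
  | succ n ih =>
    obtain ⟨g, hg, hgm⟩ := ih (Fin.tail m)
    refine ⟨_, Submodule.smul_mem _ (2 * (Real.pi : ℂ) * Complex.I)
      (smulLeft_inner_mem_SDot hg (m 0)), ?_⟩
    rw [LineDeriv.iteratedLineDerivOp_succ_left, hgm, SchwartzMap.lineDerivOp_fourierInv_eq]

/-- The moments of `h` are the derivatives of its Fourier transform at the origin. -/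
theorem isFlat_fourierInv {h : 𝓢(Bd d, ℂ)} (hh : h ∈ SDot d) : IsFlat (𝓕⁻ h) := by
  intro n
  ext m
  obtain ⟨g, hg, hgm⟩ := exists_iteratedLineDerivOp_fourierInv hh m
  rw [← SchwartzMap.iteratedLineDerivOp_eq_iteratedFDeriv, hgm, SchwartzMap.fourierInv_coe,
    Real.fourierInv_eq]
  have h0 := hg 0
  simp only [monomial, Pi.zero_apply, pow_zero, Finset.prod_const_one, one_smul] at h0
  simpa using h0

/-- The sum telescopes, since `ψ_k(ξ) = φ(2^{-k}ξ) - φ(2^{1-k}ξ)`. -/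
theorem sum_psi (φ : Cutoff d) (N : ℕ) (ξ : Bd d) :
    ∑ k ∈ Finset.Ico (-N : ℤ) N, psi φ k ξ
      = φ.toFun ((2 * ((2 : ℝ) ^ N)⁻¹) • ξ) - φ.toFun ((2 * (2 : ℝ) ^ N) • ξ) := by
  have h1 := Finset.sum_Ico_int_sub N fun k : ℤ => - φ.toFun ((2 * (2 : ℝ) ^ (-k)) • ξ)
  have h2 : ∀ k : ℤ, psi φ k ξ
      = - φ.toFun ((2 * (2 : ℝ) ^ (-k)) • ξ) - - φ.toFun ((2 * (2 : ℝ) ^ (-(k + 1))) • ξ) := by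
    intro k
    have e : (2 : ℝ) * 2 ^ (-(k + 1)) = 2 ^ (-k) := by
      rw [← zpow_one_add₀ two_ne_zero]; congr 1; ring
    rw [e, psi, smul_smul]
    ring
  rw [Finset.sum_congr rfl fun k _ => h2 k, h1]
  simp only [neg_neg, zpow_natCast, zpow_neg]
  ring

theorem tendsto_finset_Ico_int :
    Filter.Tendsto (fun N : ℕ => Finset.Ico (-N : ℤ) N) Filter.atTop Filter.atTop := by
  refine Filter.tendsto_atTop_finset_of_monotone (fun a b hab => ?_) fun k =>
    ⟨k.natAbs + 1, Finset.mem_Ico.mpr (by omega)⟩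
  have : (a : ℤ) ≤ b := by exact_mod_cast hab
  exact Finset.Ico_subset_Ico (by omega) this

/-- For `h ∈ 𝒮̇`, the Littlewood-Paley decomposition of `h` converges in `𝒮`, here tested against a
tempered distribution. On the Fourier side the remainder is the part of a flat function outside an
annulus. -/
theorem tendsto_sum_tempered_sconv (φ : Cutoff d) (B : 𝓢(Bd d, ℂ) →L[ℂ] ℂ) (h : SDot d) :
    Filter.Tendsto (fun N : ℕ => ∑ k ∈ Finset.Ico (-N : ℤ) N,
      B (sconv (h : 𝓢(Bd d, ℂ)) (lpTest φ k 0 : 𝓢(Bd d, ℂ)))) Filter.atTop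
      (nhds (B (h : 𝓢(Bd d, ℂ)))) := by
  set u : 𝓢(Bd d, ℂ) := 𝓕⁻ (h : 𝓢(Bd d, ℂ)) with hu
  set S : ℕ → 𝓢(Bd d, ℂ) := fun N => ∑ k ∈ Finset.Ico (-N : ℤ) N,
    𝓕⁻ (sconv (h : 𝓢(Bd d, ℂ)) (lpTest φ k 0 : 𝓢(Bd d, ℂ))) with hS
  have hSu : Filter.Tendsto S Filter.atTop (nhds u) := by
    rw [(schwartz_withSeminorms ℂ (Bd d) ℂ).tendsto_nhds]
    rintro ⟨k, n⟩ ε hε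
    obtain ⟨C₁, hC₁⟩ := exists_norm_iteratedFDeriv_high_le φ u k n
    obtain ⟨C₂, hC₂⟩ := exists_norm_iteratedFDeriv_low_le φ (isFlat_fourierInv h.2) k n
    have hpow : Filter.Tendsto (fun N : ℕ => (2 : ℝ) ^ N) Filter.atTop Filter.atTop :=
      tendsto_pow_atTop_atTop_of_one_lt one_lt_two
    have hlim : Filter.Tendsto (fun N : ℕ => C₁ / ((2 : ℝ) ^ N / 2) + C₂ / (2 * (2 : ℝ) ^ N))
        Filter.atTop (nhds (0 + 0)) :=
      ((hpow.atTop_div_const two_pos).const_div_atTop C₁).add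
        ((hpow.const_mul_atTop two_pos).const_div_atTop C₂)
    rw [add_zero] at hlim
    filter_upwards [hlim.eventually (gt_mem_nhds hε), Filter.eventually_ge_atTop 1] with N hN hN1
    refine lt_of_le_of_lt ?_ hN
    have hR1 : (1 : ℝ) ≤ 2 ^ N / 2 := by
      rw [le_div_iff₀ two_pos, one_mul]
      simpa using pow_le_pow_right₀ (one_le_two : (1 : ℝ) ≤ 2) hN1
    have hR2 : (1 : ℝ) ≤ 2 * 2 ^ N := by linarith [one_le_pow₀ (one_le_two : (1 : ℝ) ≤ 2) (n := N)]
    have e1 : ((S N - u : 𝓢(Bd d, ℂ)) : Bd d → ℂ)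
        = (fun ξ => -(φ.compl (((2 : ℝ) ^ N / 2)⁻¹ • ξ) • u ξ))
          - fun ξ => φ.toFun ((2 * (2 : ℝ) ^ N) • ξ) • u ξ := by
      funext ξ
      have e2 : S N ξ = u ξ * (∑ k ∈ Finset.Ico (-N : ℤ) N, psi φ k ξ : ℝ) := by
        simp only [hS, sum_apply, fourierInv_sconv_apply, fourierInv_lpTest_zero_apply,
          ← Finset.mul_sum]
        push_cast
        rfl
      change S N ξ - u ξ = -(φ.compl (((2 : ℝ) ^ N / 2)⁻¹ • ξ) • u ξ)
        - φ.toFun ((2 * (2 : ℝ) ^ N) • ξ) • u ξ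
      rw [e2, sum_psi, inv_div, ← div_eq_mul_inv, Cutoff.compl, Complex.real_smul,
        Complex.real_smul]
      push_cast
      ring
    have hs1 : ContDiff ℝ ∞ fun ξ => φ.compl (((2 : ℝ) ^ N / 2)⁻¹ • ξ) • u ξ :=
      (φ.contDiff_compl.comp (contDiff_const_smul _)).smul (u.smooth ⊤)
    have hs2 : ContDiff ℝ ∞ fun ξ => φ.toFun ((2 * (2 : ℝ) ^ N) • ξ) • u ξ :=
      (φ.smooth.comp (contDiff_const_smul _)).smul (u.smooth ⊤)
    have hb : ∀ ξ, ‖ξ‖ ^ k * ‖iteratedFDeriv ℝ n (S N - u : 𝓢(Bd d, ℂ)) ξ‖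
        ≤ C₁ / ((2 : ℝ) ^ N / 2) + C₂ / (2 * (2 : ℝ) ^ N) := by
      intro ξ
      rw [e1, iteratedFDeriv_sub_apply (hs1.neg.of_le (mod_cast le_top)).contDiffAt
        (hs2.of_le (mod_cast le_top)).contDiffAt]
      have e3 := iteratedFDeriv_neg_apply (𝕜 := ℝ) (i := n) (x := ξ)
        (f := fun ξ => φ.compl (((2 : ℝ) ^ N / 2)⁻¹ • ξ) • u ξ)
      change iteratedFDeriv ℝ n (fun ξ => -(φ.compl (((2 : ℝ) ^ N / 2)⁻¹ • ξ) • u ξ)) ξ = _ at e3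
      rw [e3]
      calc _ ≤ ‖ξ‖ ^ k * (‖iteratedFDeriv ℝ n (fun ξ => φ.compl (((2 : ℝ) ^ N / 2)⁻¹ • ξ) • u ξ) ξ‖
            + ‖iteratedFDeriv ℝ n (fun ξ => φ.toFun ((2 * (2 : ℝ) ^ N) • ξ) • u ξ) ξ‖) := by
            gcongr
            refine (norm_sub_le _ _).trans ?_
            rw [norm_neg]
        _ ≤ _ := by
            rw [mul_add]
            exact add_le_add (hC₁ _ hR1 ξ) (hC₂ _ hR2 ξ)
    exact SchwartzMap.seminorm_le_bound ℂ k n _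
      ((mul_nonneg (by positivity) (norm_nonneg _)).trans (hb 0)) hb
  have hcont := ((B.comp (FourierTransform.fourierCLM ℂ 𝓢(Bd d, ℂ))).continuous.tendsto u).comp hSu
  have e4 : (B.comp (FourierTransform.fourierCLM ℂ 𝓢(Bd d, ℂ))) u = B (h : 𝓢(Bd d, ℂ)) := by
    rw [ContinuousLinearMap.comp_apply, FourierTransform.fourierCLM_apply, hu,
      FourierTransform.fourier_fourierInv_eq]
  rw [e4] at hcont
  refine hcont.congr fun N => ?_
  simp only [Function.comp_apply, hS, map_sum, ContinuousLinearMap.comp_apply,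
    FourierTransform.fourierCLM_apply, FourierTransform.fourier_fourierInv_eq]

/-! ### Kernels with symbol-type bounds -/

/-- The Japanese bracket `(1 + |x|²)^{1/2}`. -/
def jap (x : Bd d) : ℝ := Real.sqrt (1 + ‖x‖ ^ 2)

theorem jap_pos (x : Bd d) : 0 < jap x := Real.sqrt_pos.mpr (by positivity)

theorem abs_coord_le_jap (x : Bd d) (i : Fin d) : |x i| ≤ jap x := by
  refine Real.le_sqrt_of_sq_le ?_
  have h : |x i| ≤ ‖x‖ := by simpa using PiLp.norm_apply_le x i
  nlinarith [abs_nonneg (x i)]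

theorem one_le_jap (x : Bd d) : 1 ≤ jap x :=
  Real.le_sqrt_of_sq_le (by nlinarith [sq_nonneg ‖x‖])

theorem one_add_norm_le_jap (x : Bd d) : 1 + ‖x‖ ≤ 2 * jap x := by
  have h1 := one_le_jap x
  have h2 : ‖x‖ ≤ jap x := Real.le_sqrt_of_sq_le (by linarith)
  linarith

theorem hasFDerivAt_jap (x : Bd d) : HasFDerivAt jap ((jap x)⁻¹ • innerSL ℝ x) x := by
  have h1 : HasFDerivAt (fun y : Bd d => 1 + ‖y‖ ^ 2) (2 • innerSL ℝ x) x :=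
    (hasStrictFDerivAt_norm_sq x).hasFDerivAt.const_add 1
  have h2 := h1.sqrt (by positivity)
  refine h2.congr_fderiv ?_
  ext v
  simp only [smul_apply, smul_eq_mul, nsmul_eq_mul]
  rw [jap]
  push_cast
  field_simp

/-- Linear combinations of products of coordinates with negative powers of `(1 + |x|²)^{1/2}`, of
total order at most `-k`. A derivative is again of order `-k`; that it is even of order `-k - 1` is
not needed. -/
inductive KernelClass : ℕ → (Bd d → ℝ) → Prop
  | jap_pow (k : ℕ) : KernelClass k fun x => (jap x ^ k)⁻¹
  | coord_mul {k : ℕ} {κ : Bd d → ℝ} (i : Fin d) (h : KernelClass (k + 1) κ) :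
      KernelClass k fun x => x i * κ x
  | add {k : ℕ} {κ κ' : Bd d → ℝ} (h : KernelClass k κ) (h' : KernelClass k κ') :
      KernelClass k fun x => κ x + κ' x
  | const_mul {k : ℕ} {κ : Bd d → ℝ} (c : ℝ) (h : KernelClass k κ) : KernelClass k fun x => c * κ x
  | of_succ {k : ℕ} {κ : Bd d → ℝ} (h : KernelClass (k + 1) κ) : KernelClass k κ

theorem KernelClass.exists_abs_le {k : ℕ} {κ : Bd d → ℝ} (h : KernelClass k κ) :
    ∃ C : ℝ, 0 ≤ C ∧ ∀ x, |κ x| ≤ C * (jap x ^ k)⁻¹ := by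
  induction h with
  | jap_pow k => exact ⟨1, zero_le_one, fun x => by
      rw [one_mul, abs_of_nonneg (inv_nonneg.mpr (pow_nonneg (jap_pos x).le k))]⟩
  | coord_mul i h ih =>
    obtain ⟨C, hC0, hC⟩ := ih
    refine ⟨C, hC0, fun x => ?_⟩
    have hj := jap_pos x
    rw [abs_mul]
    calc _ ≤ jap x * (C * (jap x ^ (_ + 1))⁻¹) :=
          mul_le_mul (abs_coord_le_jap x i) (hC x) (abs_nonneg _) hj.le
      _ = _ := by rw [pow_succ]; field_simp
  | add h h' ih ih' =>
    obtain ⟨C, hC0, hC⟩ := ih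
    obtain ⟨C', hC0', hC'⟩ := ih'
    exact ⟨C + C', by positivity, fun x => (abs_add_le _ _).trans (by
      rw [add_mul]; exact add_le_add (hC x) (hC' x))⟩
  | const_mul c h ih =>
    obtain ⟨C, hC0, hC⟩ := ih
    exact ⟨|c| * C, by positivity, fun x => by
      rw [abs_mul, mul_assoc]; exact mul_le_mul_of_nonneg_left (hC x) (abs_nonneg c)⟩
  | of_succ h ih =>
    obtain ⟨C, hC0, hC⟩ := ih
    refine ⟨C, hC0, fun x => (hC x).trans ?_⟩
    gcongr
    · exact pow_pos (jap_pos x) _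
    · exact one_le_jap x
    · exact Nat.le_succ _

theorem KernelClass.exists_abs_le_pw {κ : Bd d → ℝ} (h : KernelClass (d + 1) κ) :
    ∃ C : ℝ, 0 ≤ C ∧ ∀ x, |κ x| ≤ C * pw 1 x := by
  obtain ⟨C, hC0, hC⟩ := h.exists_abs_le
  refine ⟨C * 2 ^ (d + 1), by positivity, fun x => (hC x).trans ?_⟩
  have hj := jap_pos x
  rw [mul_assoc, pw]
  refine mul_le_mul_of_nonneg_left ?_ hC0
  rw [← one_div, mul_one_div, div_le_div_iff₀ (by positivity) (by positivity), one_mul, ← mul_pow]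
  exact pow_le_pow_left₀ (by positivity) (one_add_norm_le_jap x) _

/-- The class is stable under differentiation. -/
theorem KernelClass.differentiable_and_fderiv {k : ℕ} {κ : Bd d → ℝ} (h : KernelClass k κ) :
    Differentiable ℝ κ ∧ ∀ j : Fin d,
      KernelClass k fun x => fderiv ℝ κ x (EuclideanSpace.single j 1) := by
  induction h with
  | jap_pow k =>
    have hd : ∀ x : Bd d, HasFDerivAt (fun x => (jap x ^ k)⁻¹)
        (-((jap x ^ k) ^ 2)⁻¹ • ((k : ℝ) * jap x ^ (k - 1)) • (jap x)⁻¹ • innerSL ℝ x) x := by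
      intro x
      have h1 := ((hasFDerivAt_jap x).pow k)
      have h2 := (hasDerivAt_inv (pow_pos (jap_pos x) k).ne').comp_hasFDerivAt x h1
      refine h2.congr_fderiv ?_
      simp only [nsmul_eq_mul]
    refine ⟨fun x => (hd x).differentiableAt, fun j => ?_⟩
    have e : (fun x => fderiv ℝ (fun x : Bd d => (jap x ^ k)⁻¹) x (EuclideanSpace.single j 1))
        = fun x => (-k : ℝ) * (x j * (jap x ^ (k + 1 + 1))⁻¹) := by
      funext x
      have hj := (jap_pos x).ne'
      rw [(hd x).fderiv]
      simp only [smul_apply, smul_eq_mul, innerSL_apply_apply, EuclideanSpace.inner_single_right]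
      rcases k with _ | k
      · simp
      · simp only [conj_trivial, one_mul, Nat.add_sub_cancel]
        field_simp
        ring
    rw [e]
    exact .const_mul _ (.of_succ (.coord_mul j (.jap_pow _)))
  | @coord_mul k κ i h ih =>
    have hd : ∀ x : Bd d, HasFDerivAt (fun x : Bd d => x i * κ x)
        (x i • fderiv ℝ κ x + κ x • EuclideanSpace.proj (𝕜 := ℝ) i) x := fun x =>
      (EuclideanSpace.proj (𝕜 := ℝ) i : Bd d →L[ℝ] ℝ).hasFDerivAt.mul (ih.1 x).hasFDerivAt
    refine ⟨fun x => (hd x).differentiableAt, fun j => ?_⟩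
    have e : (fun x => fderiv ℝ (fun x : Bd d => x i * κ x) x (EuclideanSpace.single j 1))
        = fun x => x i * fderiv ℝ κ x (EuclideanSpace.single j 1)
          + (if i = j then 1 else 0) * κ x := by
      funext x
      rw [(hd x).fderiv]
      have hp : (EuclideanSpace.proj (𝕜 := ℝ) i : Bd d →L[ℝ] ℝ) (EuclideanSpace.single j 1)
          = if i = j then 1 else 0 := PiLp.single_apply 2 ..
      simp only [add_apply, smul_apply, smul_eq_mul, hp]
      ring
    rw [e]
    exact .add (.coord_mul i (ih.2 j)) (.const_mul _ (.of_succ h))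
  | @add k κ κ' h h' ih ih' =>
    refine ⟨ih.1.add ih'.1, fun j => ?_⟩
    have e : (fun x => fderiv ℝ (fun x : Bd d => κ x + κ' x) x (EuclideanSpace.single j 1))
        = fun x => fderiv ℝ κ x (EuclideanSpace.single j 1)
          + fderiv ℝ κ' x (EuclideanSpace.single j 1) := by
      funext x
      rw [fderiv_fun_add (ih.1 x) (ih'.1 x)]
      rfl
    rw [e]
    exact .add (ih.2 j) (ih'.2 j)
  | @const_mul k κ c h ih =>
    refine ⟨ih.1.const_mul c, fun j => ?_⟩
    have e : (fun x => fderiv ℝ (fun x : Bd d => c * κ x) x (EuclideanSpace.single j 1))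
        = fun x => c * fderiv ℝ κ x (EuclideanSpace.single j 1) := by
      funext x
      rw [fderiv_const_mul (ih.1 x)]
      rfl
    rw [e]
    exact .const_mul c (ih.2 j)
  | of_succ h ih => exact ⟨ih.1, fun j => .of_succ (ih.2 j)⟩

/-! ### Convolution of kernels with functions whose Fourier transform lives on an annulus -/

/-- Inverse Fourier transforms of smooth functions supported in an annulus. -/
def IsAnnular (Φ : 𝓢(Bd d, ℂ)) : Prop :=
  ∃ (m : Bd d → ℂ) (hm : ContDiff ℝ ∞ m) (hc : HasCompactSupport m),
    (∀ᶠ ξ in nhds 0, m ξ = 0) ∧ Φ = 𝓕⁻ (hc.toSchwartzMap hm)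

theorem isAnnular_wideKer (φ : Cutoff d) : IsAnnular (wideKer φ) :=
  ⟨_, contDiff_wide φ, hasCompactSupport_wide φ, wide_eventually_eq_zero φ, rfl⟩

/-- Functions with Fourier transform in an annulus are divergences of such functions: on the Fourier
side, divide by `|ξ|²`. -/
theorem IsAnnular.exists_eq_sum_lineDerivOp {Φ : 𝓢(Bd d, ℂ)} (h : IsAnnular Φ) :
    ∃ Θ : Fin d → 𝓢(Bd d, ℂ), (∀ i, IsAnnular (Θ i)) ∧
      Φ = ∑ i, ∂_{(EuclideanSpace.single i 1 : Bd d)} (Θ i) := by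
  obtain ⟨m, hm, hc, h0, rfl⟩ := h
  let a : Fin d → Bd d → ℂ := fun i ξ =>
    m ξ * (((ξ i / ‖ξ‖ ^ 2 : ℝ) : ℂ) * (2 * (Real.pi : ℂ) * Complex.I)⁻¹)
  have ha : ∀ i, ContDiff ℝ ∞ (a i) := by
    intro i
    refine contDiff_iff_contDiffAt.mpr fun ξ => ?_
    by_cases hξ : ξ = 0
    · have h1 : a i =ᶠ[nhds ξ] fun _ => (0 : ℂ) := by
        rw [hξ]
        filter_upwards [h0] with η hη
        simp only [a, hη, zero_mul]
      exact contDiffAt_const.congr_of_eventuallyEq h1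
    · refine hm.contDiffAt.mul (ContDiffAt.mul ?_ contDiffAt_const)
      have h2 : ContDiffAt ℝ ∞ (fun ξ : Bd d => ξ i) ξ :=
        (EuclideanSpace.proj (𝕜 := ℝ) i : Bd d →L[ℝ] ℝ).contDiff.contDiffAt
      have h3 : ContDiffAt ℝ ∞ (fun ξ : Bd d => ξ i / ‖ξ‖ ^ 2) ξ :=
        h2.div (contDiff_norm_sq ℝ).contDiffAt (by simpa using hξ)
      exact Complex.ofRealCLM.contDiff.contDiffAt.comp ξ h3
  have hac : ∀ i, HasCompactSupport (a i) := fun i => hc.mul_right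
  refine ⟨fun i => 𝓕⁻ ((hac i).toSchwartzMap (ha i)), fun i =>
    ⟨a i, ha i, hac i, h0.mono fun ξ hξ => by simp only [a, hξ, zero_mul], rfl⟩, ?_⟩
  have h1 : ∀ i : Fin d, ∂_{(EuclideanSpace.single i 1 : Bd d)}
      (𝓕⁻ ((hac i).toSchwartzMap (ha i)) : 𝓢(Bd d, ℂ))
      = 𝓕⁻ ((2 * (Real.pi : ℂ) * Complex.I) • SchwartzMap.smulLeftCLM ℂ
        (fun z : Bd d => z i) ((hac i).toSchwartzMap (ha i))) := by
    intro i
    rw [SchwartzMap.lineDerivOp_fourierInv_eq]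
    simp only [EuclideanSpace.inner_single_right, conj_trivial, one_mul]
  simp only [h1]
  have h2 : (hc.toSchwartzMap hm : 𝓢(Bd d, ℂ)) = ∑ i, (2 * (Real.pi : ℂ) * Complex.I) •
      SchwartzMap.smulLeftCLM ℂ (fun z : Bd d => z i) ((hac i).toSchwartzMap (ha i)) := by
    ext ξ
    have hco : ∀ i : Fin d, (fun z : Bd d => z i).HasTemperateGrowth := fun i =>
      (EuclideanSpace.proj (𝕜 := ℝ) i).hasTemperateGrowth
    have hpi : (2 * (Real.pi : ℂ) * Complex.I) ≠ 0 := by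
      simp [Real.pi_ne_zero, Complex.I_ne_zero]
    rw [sum_apply]
    have h3 : ∀ i : Fin d, ((2 * (Real.pi : ℂ) * Complex.I) • SchwartzMap.smulLeftCLM ℂ
        (fun z : Bd d => z i) ((hac i).toSchwartzMap (ha i)) : 𝓢(Bd d, ℂ)) ξ
        = m ξ * ((ξ i ^ 2 / ‖ξ‖ ^ 2 : ℝ) : ℂ) := by
      intro i
      rw [smul_apply, SchwartzMap.smulLeftCLM_apply_apply (hco i)]
      change (2 * (Real.pi : ℂ) * Complex.I) • (ξ i • (m ξ * (((ξ i / ‖ξ‖ ^ 2 : ℝ) : ℂ) *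
        (2 * (Real.pi : ℂ) * Complex.I)⁻¹))) = _
      rw [smul_eq_mul, Complex.real_smul]
      push_cast
      field_simp
    rw [Finset.sum_congr rfl fun i _ => h3 i, ← Finset.mul_sum, ← Complex.ofReal_sum,
      ← Finset.sum_div]
    change m ξ = _
    by_cases hξ : ξ = 0
    · rw [hξ, h0.self_of_nhds, zero_mul]
    · have h4 : ∑ i, ξ i ^ 2 = ‖ξ‖ ^ 2 := by
        rw [EuclideanSpace.norm_sq_eq]
        simp
      rw [h4, div_self (by simpa using hξ), Complex.ofReal_one, mul_one]
  conv_lhs => rw [h2]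
  exact map_sum (FourierTransform.fourierInvCLM ℂ 𝓢(Bd d, ℂ)) _ _

theorem integral_pw_le {t : ℝ} (ht : 0 < t) : ∫ y : Bd d, pw t y ≤ (pwMass d).toReal := by
  rw [integral_eq_lintegral_of_nonneg_ae (Filter.Eventually.of_forall fun y => pw_nonneg ht y)
    (integrable_pw ht).aestronglyMeasurable]
  refine ENNReal.toReal_mono pwMass_ne_top ?_
  have h := lintegral_pw_sub_le ht (0 : Bd d)
  simpa only [zero_sub, pw_neg] using h

/-- Peetre's inequality for the weight. -/
theorem pw_one_sub_le {s : ℝ} (hs : 1 ≤ s) (x y : Bd d) :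
    pw 1 (x - y) ≤ pw 1 x * (1 + ‖s • y‖) ^ (d + 1) := by
  unfold pw
  have h1 : ‖x‖ ≤ ‖x - y‖ + ‖y‖ := by simpa using norm_add_le (x - y) y
  have h2 : ‖y‖ ≤ ‖s • y‖ := by
    rw [norm_smul, Real.norm_of_nonneg (by linarith)]
    nlinarith [norm_nonneg y]
  rw [div_mul_eq_mul_div, one_mul, div_le_div_iff₀ (by positivity) (by positivity), one_mul,
    ← mul_pow]
  refine pow_le_pow_left₀ (by positivity) ?_ _
  nlinarith [norm_nonneg (x - y), norm_nonneg (s • y)]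

/-- The convolution of a kernel with a function whose Fourier transform lives where `|ξ| ∼ s ≥ 1`
is `O(s^{-M})` for every `M`, with the same spatial decay: integrate by parts `M` times. -/
theorem KernelClass.exists_norm_integral_dilate_le (M : ℕ) : ∀ {κ : Bd d → ℝ},
    KernelClass (d + 1) κ → ∀ {Φ : 𝓢(Bd d, ℂ)}, IsAnnular Φ →
    ∃ C : ℝ, 0 ≤ C ∧ ∀ s : ℝ, 1 ≤ s → ∀ x : Bd d,
      (Integrable fun y => κ (x - y) • s ^ d • Φ (s • y)) ∧
      ‖∫ y, κ (x - y) • s ^ d • Φ (s • y)‖ ≤ C * (s ^ M)⁻¹ * pw 1 x := by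
  -- the case `M = 0`, also needed for the integrability of all terms in the induction step
  have hint : ∀ {κ : Bd d → ℝ}, KernelClass (d + 1) κ → ∀ Φ : 𝓢(Bd d, ℂ), ∃ C : ℝ, 0 ≤ C ∧
      ∀ s : ℝ, 1 ≤ s → ∀ x : Bd d, (Integrable fun y => κ (x - y) • s ^ d • Φ (s • y)) ∧
        ‖∫ y, κ (x - y) • s ^ d • Φ (s • y)‖ ≤ C * pw 1 x := by
    intro κ hκ Φ
    obtain ⟨A, hA0, hA⟩ := hκ.exists_abs_le_pw
    obtain ⟨B, hB0, hB⟩ := exists_weighted_dilate_le_pw Φ (d + 1)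
    refine ⟨A * B * (pwMass d).toReal, by positivity, fun s hs x => ?_⟩
    have hs0 : 0 < s := by linarith
    have hp1 := pw_nonneg one_pos x
    have hb : ∀ y, ‖κ (x - y) • s ^ d • Φ (s • y)‖ ≤ A * pw 1 x * B * pw s⁻¹ y := by
      intro y
      rw [norm_smul, norm_smul, Real.norm_eq_abs, Real.norm_of_nonneg (by positivity)]
      calc |κ (x - y)| * (s ^ d * ‖Φ (s • y)‖)
          ≤ (A * (pw 1 x * (1 + ‖s • y‖) ^ (d + 1))) * (s ^ d * ‖Φ (s • y)‖) := by
            gcongr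
            exact (hA _).trans (mul_le_mul_of_nonneg_left (pw_one_sub_le hs x y) hA0)
        _ = A * pw 1 x * ((1 + ‖s • y‖) ^ (d + 1) * (s ^ d * ‖Φ (s • y)‖)) := by ring
        _ ≤ A * pw 1 x * (B * pw s⁻¹ y) :=
          mul_le_mul_of_nonneg_left (hB s hs0 y) (by positivity)
        _ = _ := by ring
    have hbi := (integrable_pw (d := d) (inv_pos.mpr hs0)).const_mul (A * pw 1 x * B)
    have hκc := hκ.differentiable_and_fderiv.1.continuous
    have hΦc := Φ.continuous
    have hc : Continuous fun y => κ (x - y) • s ^ d • Φ (s • y) := by fun_prop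
    refine ⟨hbi.mono' hc.aestronglyMeasurable (Filter.Eventually.of_forall hb), ?_⟩
    refine (norm_integral_le_of_norm_le hbi (Filter.Eventually.of_forall hb)).trans ?_
    rw [integral_const_mul]
    calc _ ≤ A * pw 1 x * B * (pwMass d).toReal := by
          gcongr
          exact integral_pw_le (inv_pos.mpr hs0)
      _ = _ := by ring
  induction M with
  | zero =>
    intro κ hκ Φ _
    simpa only [pow_zero, inv_one, mul_one] using hint hκ Φ
  | succ M ih =>
    intro κ hκ Φ hΦ
    obtain ⟨Θ, hΘ, rfl⟩ := hΦ.exists_eq_sum_lineDerivOp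
    have hκ' := hκ.differentiable_and_fderiv
    have h1 := fun i => ih (hκ'.2 i) (hΘ i)
    choose C hC0 hC using h1
    choose C₁ _ hC₁ using fun i : Fin d =>
      hint hκ (∂_{(EuclideanSpace.single i 1 : Bd d)} (Θ i) : 𝓢(Bd d, ℂ))
    choose C₂ _ hC₂ using fun i : Fin d => hint hκ (Θ i)
    refine ⟨∑ i, C i, Finset.sum_nonneg fun i _ => hC0 i, fun s hs x => ?_⟩
    have hs0 : 0 < s := by linarith
    have hsum : (fun y => κ (x - y) • s ^ d •
        (∑ i, ∂_{(EuclideanSpace.single i 1 : Bd d)} (Θ i) : 𝓢(Bd d, ℂ)) (s • y))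
        = fun y => ∑ i, κ (x - y) • s ^ d •
          (∂_{(EuclideanSpace.single i 1 : Bd d)} (Θ i) : 𝓢(Bd d, ℂ)) (s • y) := by
      funext y
      rw [sum_apply, Finset.smul_sum, Finset.smul_sum]
    rw [hsum]
    refine ⟨integrable_finsetSum _ fun i _ => (hC₁ i s hs x).1, ?_⟩
    rw [integral_finsetSum _ fun i _ => (hC₁ i s hs x).1, Finset.sum_mul, Finset.sum_mul]
    refine (norm_sum_le _ _).trans (Finset.sum_le_sum fun i _ => ?_)
    -- the chain rule produces the factor `s` gained at each step
    have hf : ∀ y, HasFDerivAt (fun y => κ (x - y)) (-fderiv ℝ κ (x - y)) y := fun y => by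
      have := (hκ'.1 (x - y)).hasFDerivAt.comp y ((hasFDerivAt_id y).const_sub x)
      refine this.congr_fderiv ?_
      ext v
      simp
    have hg : ∀ y, HasFDerivAt (fun y => s ^ d • Θ i (s • y))
        (s ^ d • s • fderiv ℝ (Θ i) (s • y)) y := fun y => by
      have h2 : HasFDerivAt (fun y : Bd d => s • y) (s • ContinuousLinearMap.id ℝ (Bd d)) y :=
        (hasFDerivAt_id y).const_smul s
      have := (((Θ i).differentiableAt (x := s • y)).hasFDerivAt.comp y h2).const_smul (s ^ d)
      refine this.congr_fderiv ?_
      ext v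
      simp
    have hibp := integral_bilinear_hasFDerivAt_right_eq_neg_left_of_integrable
      (μ := (volume : Measure (Bd d))) (f := fun y => κ (x - y)) (g := fun y => s ^ d • Θ i (s • y))
      (v := EuclideanSpace.single i 1) (B := ContinuousLinearMap.lsmul ℝ ℝ)
      (f' := fun y => -fderiv ℝ κ (x - y))
      (g' := fun y => s ^ d • s • fderiv ℝ (Θ i) (s • y))
      (by
        have := (hC i s hs x).1.neg
        refine this.congr (Filter.Eventually.of_forall fun y => ?_)
        simp)
      (by
        have := (hC₁ i s hs x).1.const_mul (s : ℂ)
        refine this.congr (Filter.Eventually.of_forall fun y => ?_)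
        simp only [SchwartzMap.lineDerivOp_apply_eq_fderiv, ContinuousLinearMap.lsmul_apply,
          smul_apply, Complex.real_smul]
        ring)
      (hC₂ i s hs x).1 (fun y _ => hf y) (fun y _ => hg y)
    have e1 : ∫ y, κ (x - y) • s ^ d •
        (∂_{(EuclideanSpace.single i 1 : Bd d)} (Θ i) : 𝓢(Bd d, ℂ)) (s • y)
        = s⁻¹ • ∫ y, fderiv ℝ κ (x - y) (EuclideanSpace.single i 1) • s ^ d • Θ i (s • y) := by
      have e2 : ∫ y, fderiv ℝ κ (x - y) (EuclideanSpace.single i 1) • s ^ d • Θ i (s • y)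
          = -∫ y, ContinuousLinearMap.lsmul ℝ ℝ (-fderiv ℝ κ (x - y) (EuclideanSpace.single i 1))
            (s ^ d • Θ i (s • y)) := by
        rw [← integral_neg]
        congr 1
        funext y
        simp
      rw [e2]
      change _ = s⁻¹ • -∫ y, ContinuousLinearMap.lsmul ℝ ℝ
        ((-fderiv ℝ κ (x - y)) (EuclideanSpace.single i 1)) (s ^ d • Θ i (s • y))
      rw [← hibp, ← integral_smul]
      congr 1
      funext y
      simp only [SchwartzMap.lineDerivOp_apply_eq_fderiv, ContinuousLinearMap.lsmul_apply,
        smul_apply, Complex.real_smul]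
      have : (s : ℂ) ≠ 0 := by exact_mod_cast hs0.ne'
      push_cast
      field_simp
    rw [e1, norm_smul, Real.norm_of_nonneg (by positivity)]
    calc s⁻¹ * _ ≤ s⁻¹ * (C i * (s ^ M)⁻¹ * pw 1 x) := by
          gcongr
          exact (hC i s hs x).2
      _ = C i * (s ^ (M + 1))⁻¹ * pw 1 x := by rw [pow_succ, mul_inv]; ring

/-! ### Convolution of a dilated kernel with a Littlewood-Paley block -/

/-- The dilate `t^{-d} κ(x/t)`. -/
def dil (κ : Bd d → ℝ) (t : ℝ) (x : Bd d) : ℝ := (t ^ d)⁻¹ * κ (t⁻¹ • x)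

theorem abs_dil_le {κ : Bd d → ℝ} {A : ℝ} (hA : ∀ x, |κ x| ≤ A * pw 1 x) {t : ℝ} (ht : 0 < t)
    (x : Bd d) : |dil κ t x| ≤ A * pw t x := by
  have h := hA (t⁻¹ • x)
  rw [dil, abs_mul, abs_of_pos (by positivity), pw_eq_scale ht]
  rw [pw_eq_scale one_pos, inv_one, one_smul, one_pow, inv_one, one_mul] at h
  calc _ ≤ (t ^ d)⁻¹ * (A * ((1 + ‖t⁻¹ • x‖) ^ (d + 1))⁻¹) := by gcongr
    _ = _ := by ring

theorem KernelClass.continuous {k : ℕ} {κ : Bd d → ℝ} (h : KernelClass k κ) : Continuous κ :=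
  h.differentiable_and_fderiv.1.continuous

theorem KernelClass.continuous_dil {k : ℕ} {κ : Bd d → ℝ} (h : KernelClass k κ) (t : ℝ) :
    Continuous (dil κ t) :=
  continuous_const.mul (h.continuous.comp (continuous_const_smul _))

theorem integrable_dil_smul {κ : Bd d → ℝ} (hκ : KernelClass (d + 1) κ) {t : ℝ} (ht : 0 < t)
    {g : Bd d → ℂ} (hg : Continuous g) {b : ℝ} (hb : ∀ y, ‖g y‖ ≤ b) (x : Bd d) :
    Integrable fun y => dil κ t (x - y) • g y := by
  obtain ⟨A, hA0, hA⟩ := hκ.exists_abs_le_pw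
  have hi : Integrable fun y : Bd d => A * b * pw t (x - y) :=
    ((integrable_pw ht).comp_sub_left x).const_mul _
  have hc := hκ.continuous_dil t
  refine hi.mono' (by fun_prop) (Filter.Eventually.of_forall fun y => ?_)
  rw [norm_smul, Real.norm_eq_abs]
  calc _ ≤ A * pw t (x - y) * b := by
        have := pw_nonneg ht (x - y)
        gcongr
        · exact abs_dil_le hA ht _
        · exact hb y
    _ = _ := by ring

theorem enorm_integral_dil_smul_le {κ : Bd d → ℝ} {A : ℝ} (hA0 : 0 ≤ A)
    (hA : ∀ x, |κ x| ≤ A * pw 1 x) {t : ℝ} (ht : 0 < t) (g : Bd d → ℂ) (x : Bd d) :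
    ‖∫ y, dil κ t (x - y) • g y‖ₑ ≤ ENNReal.ofReal A * pwConv t (fun y => ‖g y‖ₑ) x := by
  refine (enorm_integral_le_lintegral_enorm _).trans ?_
  rw [pwConv, ← lintegral_const_mul' _ _ ENNReal.ofReal_ne_top]
  refine lintegral_mono fun y => ?_
  rw [enorm_smul, ← mul_assoc, ← ENNReal.ofReal_mul hA0]
  refine mul_le_mul_left ?_ _
  rw [Real.enorm_eq_ofReal_abs]
  exact ENNReal.ofReal_le_ofReal (abs_dil_le hA ht _)

/-- An integrability criterion for the applications of Fubini's theorem. -/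
theorem integrable_prod_of_norm_le_pw {t : ℝ} (ht : 0 < t) {F : Bd d × Bd d → ℂ}
    (hF : Continuous F) {G : Bd d → ℝ} (hG : Integrable G)
    (hb : ∀ x y, ‖F (x, y)‖ ≤ G x * pw t (x - y)) : Integrable F (volume.prod volume) := by
  have h1 := (hG.convolution_integrand (ContinuousLinearMap.mul ℝ ℝ)
    (integrable_pw (d := d) ht)).swap
  refine h1.mono' hF.aestronglyMeasurable (Filter.Eventually.of_forall fun p => ?_)
  refine (hb p.1 p.2).trans (le_of_eq ?_)
  rw [pw_sub_comm]
  rfl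

/-- The convolution of the dilated kernels `κ_t` and `s^d Φ(s ·)` at scale `s = r / t`. -/
theorem integral_dil_smul_dilate {κ : Bd d → ℝ} {t r : ℝ} (ht : 0 < t) (Φ : Bd d → ℂ) (x z : Bd d) :
    ∫ y, dil κ t (x - y) • ((r / t) ^ d • Φ ((r / t) • (y - z)))
      = (t ^ d)⁻¹ • ∫ y, κ (t⁻¹ • (x - z) - y) • r ^ d • Φ (r • y) := by
  have h1 := integral_sub_right_eq_self (μ := (volume : Measure (Bd d)))
    (fun y => dil κ t (x - z - y) • ((r / t) ^ d • Φ ((r / t) • y))) z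
  have h2 := Measure.integral_comp_smul (volume : Measure (Bd d))
    (fun y => dil κ t (x - z - y) • ((r / t) ^ d • Φ ((r / t) • y))) t
  rw [finrank_euclideanSpace, Fintype.card_fin, abs_of_pos (by positivity)] at h2
  have h3 : ∀ y, x - z - (y - z) = x - y := fun y => by abel
  simp only [h3] at h1
  have h4 : ∫ y, dil κ t (x - z - y) • ((r / t) ^ d • Φ ((r / t) • y))
      = t ^ d • ∫ y, dil κ t (x - z - t • y) • ((r / t) ^ d • Φ ((r / t) • t • y)) := by
    rw [h2, smul_smul, mul_inv_cancel₀ (by positivity), one_smul]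
  rw [h1, h4, ← integral_smul, ← integral_smul]
  congr 1
  funext y
  have e1 : t⁻¹ • (x - z - t • y) = t⁻¹ • (x - z) - y := by
    rw [smul_sub, smul_smul, inv_mul_cancel₀ ht.ne', one_smul]
  have e2 : (r / t) • t • y = r • y := by rw [smul_smul, div_mul_cancel₀ _ ht.ne']
  rw [dil, e1, e2, smul_smul, smul_smul, smul_smul, smul_smul]
  congr 1
  rw [div_pow]
  field_simp

/-- The decisive gain: at scale `t`, the blocks of frequency `2^k` with `2^k t ≥ 1` contribute only
`O((2^k t)^{-M})`. Writing the block as its own convolution with `2^{kd} Φ(2^k ·)`, one may replace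
`κ_t` by its convolution with that kernel, which is small by `exists_norm_integral_dilate_le`. For
`2^k t ≤ 1` the size of `κ_t` suffices. The boundedness of the blocks is only used qualitatively, in
Fubini's theorem. -/
theorem exists_enorm_integral_dil_lpBlock_le {κ : Bd d → ℝ} (hκ : KernelClass (d + 1) κ) (M : ℕ)
    (φ : Cutoff d) : ∃ C : ℝ≥0, ∀ (f : SDot' d) (k : ℤ), (∃ b : ℝ, ∀ y, ‖lpBlock φ k f y‖ ≤ b) →
      ∀ t : ℝ, 0 < t → ∀ x, ‖∫ y, dil κ t (x - y) • lpBlock φ k f y‖ₑ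
        ≤ C * (ENNReal.ofReal (decay M ((2 : ℝ) ^ k * t)) *
          pwConv t (fun y => ‖lpBlock φ k f y‖ₑ) x) := by
  obtain ⟨A, hA0, hA⟩ := hκ.exists_abs_le_pw
  obtain ⟨B, hB0, hB⟩ := hκ.exists_norm_integral_dilate_le M (isAnnular_wideKer φ)
  obtain ⟨D, hD⟩ := exists_dilate_le_pw (wideKer φ)
  refine ⟨(max A B).toNNReal, fun f k hfb t ht x => ?_⟩
  obtain ⟨b, hb⟩ := hfb
  set g := lpBlock φ k f with hgdef
  set s : ℝ := (2 : ℝ) ^ k * t with hs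
  have h2k : (0 : ℝ) < 2 ^ k := by positivity
  have hs0 : 0 < s := by positivity
  change _ ≤ ENNReal.ofReal (max A B) * _
  rcases le_total s 1 with hs1 | hs1
  · have hdec : decay M s = 1 := by
      rw [decay, min_eq_left]
      exact (one_le_inv₀ (by positivity)).mpr (pow_le_one₀ hs0.le hs1)
    rw [hdec, ENNReal.ofReal_one, one_mul]
    exact (enorm_integral_dil_smul_le hA0 hA ht g x).trans
      (mul_le_mul_left (ENNReal.ofReal_le_ofReal (le_max_left _ _)) _)
  · have hdec : decay M s = (s ^ M)⁻¹ := by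
      rw [decay, min_eq_right]
      exact inv_le_one_of_one_le₀ (one_le_pow₀ hs1)
    have hst : s / t = 2 ^ k := by rw [hs, mul_div_cancel_right₀ _ ht.ne']
    set Ψ : Bd d → ℂ := fun w => (s / t) ^ d • wideKer φ ((s / t) • w) with hΨ
    have hΨc : Continuous Ψ := by
      have := (wideKer φ).continuous
      fun_prop
    have hgc : Continuous g := continuous_lpBlock φ k f
    have hκc := hκ.continuous_dil t
    have hrep : ∀ y, g y = ∫ z, Ψ (y - z) * g z := fun y => by
      have := (lpBlock_eq_integral φ k f y).2
      rw [← hgdef] at this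
      rw [← this, hΨ, hst]
      simp only [Complex.real_smul]
    have hΨb : ∀ w, ‖Ψ w‖ ≤ D * pw (s / t)⁻¹ w := fun w => by
      rw [hΨ, norm_smul, Real.norm_of_nonneg (by positivity)]
      exact hD _ (by positivity) w
    -- Fubini's theorem, the double integral being dominated by two Poisson weights
    have hprod : Integrable (fun p : Bd d × Bd d => dil κ t (x - p.1) • (Ψ (p.1 - p.2) * g p.2))
        (volume.prod volume) := by
      have hc : Continuous fun p : Bd d × Bd d =>
          dil κ t (x - p.1) • (Ψ (p.1 - p.2) * g p.2) := by fun_prop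
      have hb0 : 0 ≤ b := (norm_nonneg _).trans (hb 0)
      have hr : 0 < (s / t)⁻¹ := by positivity
      refine integrable_prod_of_norm_le_pw hr hc
        (((integrable_pw ht).comp_sub_left x).const_mul (A * (D * b))) fun y z => ?_
      have := pw_nonneg ht (x - y)
      have := pw_nonneg hr (y - z)
      rw [norm_smul, norm_mul, Real.norm_eq_abs]
      calc _ ≤ (A * pw t (x - y)) * ((D * pw (s / t)⁻¹ (y - z)) * b) := by
            gcongr
            · exact abs_dil_le hA ht _
            · exact hΨb _
            · exact hb z
        _ = _ := by ring
    have hmain : ∫ y, dil κ t (x - y) • g y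
        = ∫ z, (∫ y, dil κ t (x - y) • Ψ (y - z)) * g z := by
      calc ∫ y, dil κ t (x - y) • g y = ∫ y, ∫ z, dil κ t (x - y) • (Ψ (y - z) * g z) := by
            congr 1
            funext y
            rw [integral_smul, ← hrep y]
        _ = ∫ z, ∫ y, dil κ t (x - y) • (Ψ (y - z) * g z) := integral_integral_swap hprod
        _ = _ := by
            congr 1
            funext z
            rw [← integral_mul_const]
            simp only [smul_mul_assoc]
    have hker : ∀ z,
        ‖∫ y, dil κ t (x - y) • Ψ (y - z)‖ ≤ B * (s ^ M)⁻¹ * pw t (x - z) := fun z => by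
      rw [hΨ, integral_dil_smul_dilate ht, norm_smul, Real.norm_of_nonneg (by positivity)]
      have h6 := (hB s hs1 (t⁻¹ • (x - z))).2
      rw [pw_eq_scale one_pos, inv_one, one_smul, one_pow, inv_one, one_mul] at h6
      rw [pw_eq_scale ht]
      calc _ ≤ (t ^ d)⁻¹ * (B * (s ^ M)⁻¹ * ((1 + ‖t⁻¹ • (x - z)‖) ^ (d + 1))⁻¹) := by gcongr
        _ = _ := by ring
    rw [hmain, hdec]
    refine (enorm_integral_le_lintegral_enorm _).trans ?_
    calc ∫⁻ z, ‖(∫ y, dil κ t (x - y) • Ψ (y - z)) * g z‖ₑ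
        ≤ ∫⁻ z, ENNReal.ofReal (B * (s ^ M)⁻¹) * (ENNReal.ofReal (pw t (x - z)) * ‖g z‖ₑ) := by
          refine lintegral_mono fun z => ?_
          rw [enorm_mul, ← mul_assoc, ← ENNReal.ofReal_mul (by positivity)]
          refine mul_le_mul_left ?_ _
          rw [← ofReal_norm]
          exact ENNReal.ofReal_le_ofReal (hker z)
      _ = ENNReal.ofReal (B * (s ^ M)⁻¹) * pwConv t (fun y => ‖g y‖ₑ) x := by
          rw [lintegral_const_mul' _ _ ENNReal.ofReal_ne_top, pwConv]
      _ ≤ _ := by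
          rw [← mul_assoc, ← ENNReal.ofReal_mul (le_max_of_le_left hA0)]
          refine mul_le_mul_left (ENNReal.ofReal_le_ofReal ?_) _
          gcongr
          exact le_max_right _ _

/-! ### Convolution of a dilated kernel with a distribution -/

theorem exists_norm_lpBlock_le (hd : 1 ≤ d) {q : ℝ} (hq : ((d : ℝ) + 1) / d < q) (φ : Cutoff d)
    {f : SDot' d} (hf : tlNorm φ (-1 / q) (expP d q) q f < ⊤) (k : ℤ) :
    ∃ b : ℝ, ∀ y, ‖lpBlock φ k f y‖ ≤ b := by
  obtain ⟨C, hC⟩ := exists_enorm_lpBlock_le hd hq φ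
  have h1 : ENNReal.ofReal (((2 : ℝ) ^ k) ^ (1 / (q - 1))) *
      (C * tlNorm φ (-1 / q) (expP d q) q f) ≠ ⊤ :=
    ENNReal.mul_ne_top ENNReal.ofReal_ne_top (ENNReal.mul_ne_top ENNReal.coe_ne_top hf.ne)
  refine ⟨(ENNReal.ofReal (((2 : ℝ) ^ k) ^ (1 / (q - 1))) *
    (C * tlNorm φ (-1 / q) (expP d q) q f)).toReal, fun y => ?_⟩
  rw [← toReal_enorm]
  exact ENNReal.toReal_mono h1 (hC f k y)

/-- The sizes of the Littlewood-Paley blocks. -/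
def blockSize (φ : Cutoff d) (f : SDot' d) (k : ℤ) (x : Bd d) : ℝ≥0∞ := ‖lpBlock φ k f x‖ₑ

theorem measurable_blockSize (φ : Cutoff d) (f : SDot' d) (k : ℤ) :
    Measurable (blockSize φ f k) :=
  (continuous_lpBlock φ k f).measurable.enorm

/-- The series defining `κ_t ∗ f` converges absolutely wherever the majorant is finite, and is
controlled by it. -/
theorem exists_tsum_enorm_le_majorant {κ : Bd d → ℝ} (hκ : KernelClass (d + 1) κ) (M : ℕ)
    (φ : Cutoff d) : ∃ C : ℝ≥0, ∀ f : SDot' d, (∀ k, ∃ b : ℝ, ∀ y, ‖lpBlock φ k f y‖ ≤ b) →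
      ∀ t : ℝ, 0 < t → ∀ x, ∑' k : ℤ, ‖∫ y, dil κ t (x - y) • lpBlock φ k f y‖ₑ
        ≤ C * majorant M (blockSize φ f) t x := by
  obtain ⟨C, hC⟩ := exists_enorm_integral_dil_lpBlock_le hκ M φ
  refine ⟨C, fun f hf t ht x => ?_⟩
  rw [majorant, ← ENNReal.tsum_mul_left]
  exact ENNReal.tsum_le_tsum fun k => hC f k (hf k) t ht x

theorem exists_majorant_blockSize_le (hd : 1 ≤ d) {q : ℝ} (hq : ((d : ℝ) + 1) / d < q) {M : ℕ}
    (hM : 1 / (q - 1) < M) (φ : Cutoff d) : ∃ C : ℝ≥0, ∀ (f : SDot' d) (t : ℝ), 0 < t →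
      ∀ x, majorant M (blockSize φ f) t x ≤ ENNReal.ofReal (t ^ (-(1 / (q - 1)))) *
        (C * tlNorm φ (-1 / q) (expP d q) q f) := by
  have hq1 := (one_lt_expP hd hq).1
  obtain ⟨C, hC⟩ := exists_enorm_lpBlock_le hd hq φ
  obtain ⟨D, hD⟩ := exists_majorant_le (d := d) (M := M) (a := 1 / (q - 1))
    (one_div_pos.mpr (by linarith)) hM
  refine ⟨D * C, fun f t ht x => (hD _ _ (hC f) t ht x).trans (le_of_eq ?_)⟩
  rw [ENNReal.coe_mul]
  ring

theorem summable_norm_of_tsum_enorm_ne_top {ι E : Type*} [NormedAddCommGroup E] {g : ι → E}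
    (h : ∑' i, ‖g i‖ₑ ≠ ⊤) : Summable fun i => ‖g i‖ := by
  simpa only [toReal_enorm] using ENNReal.summable_toReal h

theorem exists_tsum_enorm_integral_dil_le (hd : 1 ≤ d) {q : ℝ} (hq : ((d : ℝ) + 1) / d < q)
    {κ : Bd d → ℝ} (hκ : KernelClass (d + 1) κ) (φ : Cutoff d) {f : SDot' d}
    (hf : tlNorm φ (-1 / q) (expP d q) q f < ⊤) {t : ℝ} (ht : 0 < t) :
    ∃ D : ℝ≥0, ∀ x, ∑' k : ℤ, ‖∫ y, dil κ t (x - y) • lpBlock φ k f y‖ₑ ≤ D := by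
  obtain ⟨M, hM⟩ := exists_nat_gt (1 / (q - 1))
  obtain ⟨C, hC⟩ := exists_tsum_enorm_le_majorant hκ M φ
  obtain ⟨C', hC'⟩ := exists_majorant_blockSize_le hd hq hM φ
  have hfin : (C : ℝ≥0∞) * (ENNReal.ofReal (t ^ (-(1 / (q - 1)))) *
      (C' * tlNorm φ (-1 / q) (expP d q) q f)) ≠ ⊤ :=
    ENNReal.mul_ne_top ENNReal.coe_ne_top (ENNReal.mul_ne_top ENNReal.ofReal_ne_top
      (ENNReal.mul_ne_top ENNReal.coe_ne_top hf.ne))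
  lift (C : ℝ≥0∞) * (ENNReal.ofReal (t ^ (-(1 / (q - 1)))) *
      (C' * tlNorm φ (-1 / q) (expP d q) q f)) to ℝ≥0 using hfin with D hD
  refine ⟨D, fun x => ?_⟩
  rw [hD]
  exact (hC f (exists_norm_lpBlock_le hd hq φ hf) t ht x).trans
    (mul_le_mul_right (hC' f t ht x) _)

theorem convConverges_dil (hd : 1 ≤ d) {q : ℝ} (hq : ((d : ℝ) + 1) / d < q)
    {κ : Bd d → ℝ} (hκ : KernelClass (d + 1) κ) (φ : Cutoff d) {f : SDot' d}
    (hf : tlNorm φ (-1 / q) (expP d q) q f < ⊤) {t : ℝ} (ht : 0 < t) (x : Bd d) :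
    ConvConverges φ (dil κ t) f x := by
  refine ⟨fun k => ?_, ?_⟩
  · obtain ⟨b, hb⟩ := exists_norm_lpBlock_le hd hq φ hf k
    exact integrable_dil_smul hκ ht (continuous_lpBlock φ k f) hb x
  · obtain ⟨D, hD⟩ := exists_tsum_enorm_integral_dil_le hd hq hκ φ hf ht
    exact summable_norm_of_tsum_enorm_ne_top ((hD x).trans_lt ENNReal.coe_lt_top).ne

/-- Only almost everywhere: `tsum` has the value `0` where the series diverges, so the function is
the limit of its partial sums only where the series converges. -/
theorem aestronglyMeasurable_tsum_integral {α : Type*} [MeasurableSpace α] (μ : Measure α)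
    {K : α × Bd d → ℝ} (hK : Measurable K) (φ : Cutoff d) (f : SDot' d)
    (hs : ∀ᵐ a ∂μ, Summable fun k : ℤ => ∫ y, K (a, y) • lpBlock φ k f y) :
    AEStronglyMeasurable (fun a => ∑' k : ℤ, ∫ y, K (a, y) • lpBlock φ k f y) μ := by
  have hk : ∀ k : ℤ, StronglyMeasurable fun a => ∫ y, K (a, y) • lpBlock φ k f y := fun k => by
    have hm : Measurable fun p : α × Bd d => K p • lpBlock φ k f p.2 :=
      hK.smul ((continuous_lpBlock φ k f).measurable.comp measurable_snd)
    exact hm.stronglyMeasurable.integral_prod_right'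
  refine aestronglyMeasurable_of_tendsto_ae Filter.atTop
    (f := fun (N : ℕ) a => ∑ k ∈ Finset.Ico (-N : ℤ) N, ∫ y, K (a, y) • lpBlock φ k f y)
    (fun N => (Finset.stronglyMeasurable_fun_sum _ fun k _ => hk k).aestronglyMeasurable) ?_
  filter_upwards [hs] with a ha
  exact ha.hasSum.comp tendsto_finset_Ico_int

theorem integral_integral_dil_mul {κ : Bd d → ℝ} (hκ : KernelClass (d + 1) κ) {t : ℝ} (ht : 0 < t)
    {v : Bd d → ℂ} (hv : Continuous v) {b : ℝ} (hb : ∀ y, ‖v y‖ ≤ b) (g : 𝓢(Bd d, ℂ)) :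
    ∫ x, (∫ y, dil κ t (x - y) • v y) * g x = ∫ y, (∫ x, dil κ t (x - y) • g x) * v y := by
  obtain ⟨A, hA0, hA⟩ := hκ.exists_abs_le_pw
  have hκc := hκ.continuous_dil t
  have hgc := g.continuous
  have hprod : Integrable (fun p : Bd d × Bd d => dil κ t (p.1 - p.2) • (v p.2 * g p.1))
      (volume.prod volume) := by
    refine integrable_prod_of_norm_le_pw ht (by fun_prop)
      ((g.integrable (μ := volume)).norm.const_mul (A * b)) fun x y => ?_
    have := pw_nonneg ht (x - y)
    rw [norm_smul, norm_mul, Real.norm_eq_abs]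
    calc _ ≤ (A * pw t (x - y)) * (b * ‖g x‖) := by
          gcongr
          · exact abs_dil_le hA ht _
          · exact hb y
      _ = _ := by ring
  calc ∫ x, (∫ y, dil κ t (x - y) • v y) * g x
      = ∫ x, ∫ y, dil κ t (x - y) • (v y * g x) := by
        congr 1; funext x
        rw [← integral_mul_const]
        simp only [smul_mul_assoc]
    _ = ∫ y, ∫ x, dil κ t (x - y) • (v y * g x) := integral_integral_swap hprod
    _ = _ := by
        congr 1; funext y
        rw [← integral_mul_const]
        simp only [smul_mul_assoc, mul_comm (v y)]

/-- The series defining `κ_t ∗ f` represents the distributional convolution: exchange the sum over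
the blocks with the pairing, and sum the Littlewood-Paley decomposition of the test function. -/
theorem isConv_dil (hd : 1 ≤ d) {q : ℝ} (hq : ((d : ℝ) + 1) / d < q)
    {κ : Bd d → ℝ} (hκ : KernelClass (d + 1) κ) (φ : Cutoff d) {f : SDot' d}
    (hf : tlNorm φ (-1 / q) (expP d q) q f < ⊤) {t : ℝ} (ht : 0 < t) :
    IsConv (dil κ t) f (conv φ (dil κ t) f) := by
  intro g
  obtain ⟨D, hD⟩ := exists_tsum_enorm_integral_dil_le hd hq hκ φ hf ht
  set w : ℤ → Bd d → ℂ := fun k x => ∫ y, dil κ t (x - y) • lpBlock φ k f y with hw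
  have hsum : ∀ x, Summable fun k => w k x := fun x =>
    (convConverges_dil hd hq hκ φ hf ht x).2.of_norm
  have hKm : Measurable fun p : Bd d × Bd d => dil κ t (p.1 - p.2) :=
    ((hκ.continuous_dil t).comp (continuous_fst.sub continuous_snd)).measurable
  have hwm : ∀ k, Measurable (w k) := fun k => by
    have hm : Measurable fun p : Bd d × Bd d => dil κ t (p.1 - p.2) • lpBlock φ k f p.2 :=
      hKm.smul ((continuous_lpBlock φ k f).measurable.comp measurable_snd)
    exact hm.stronglyMeasurable.integral_prod_right'.measurable
  have hgi : Integrable (g : 𝓢(Bd d, ℂ)) := SchwartzMap.integrable _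
  have hgm : Measurable fun x => (g : 𝓢(Bd d, ℂ)) x := (g : 𝓢(Bd d, ℂ)).continuous.measurable
  have hwD : ∀ k x, ‖w k x‖ ≤ D := fun k x => by
    have h1 : ‖w k x‖ₑ ≤ D := (ENNReal.le_tsum k).trans (hD x)
    exact enorm_le_coe.mp h1
  have hFi : ∀ k, Integrable fun x => w k x * (g : 𝓢(Bd d, ℂ)) x := fun k =>
    hgi.bdd_mul (c := D) (hwm k).aestronglyMeasurable (Filter.Eventually.of_forall (hwD k))
  have hcm : AEStronglyMeasurable (conv φ (dil κ t) f) volume :=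
    aestronglyMeasurable_tsum_integral volume hKm φ f (Filter.Eventually.of_forall hsum)
  have hcD : ∀ x, ‖conv φ (dil κ t) f x‖ ≤ D := fun x =>
    enorm_le_coe.mp (enorm_tsum_le_tsum_enorm.trans (hD x))
  refine ⟨hgi.bdd_mul (c := D) hcm (Filter.Eventually.of_forall hcD), fun h hh => ?_⟩
  obtain ⟨B, hB⟩ := exists_tempered_extension f
  -- the sum over `k` and the integral may be exchanged, the series being bounded uniformly in `x`
  have hFsum : Summable fun k => ∫ x, ‖w k x * (g : 𝓢(Bd d, ℂ)) x‖ := by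
    have h1 : ∑' k, ∫⁻ x, ‖w k x * (g : 𝓢(Bd d, ℂ)) x‖ₑ ≠ ⊤ := by
      have hm : ∀ k, AEMeasurable (fun x => ‖w k x * (g : 𝓢(Bd d, ℂ)) x‖ₑ) volume :=
        fun k => ((hwm k).mul hgm).enorm.aemeasurable
      rw [← lintegral_tsum hm]
      refine ne_top_of_le_ne_top (ENNReal.mul_ne_top (ENNReal.coe_ne_top (r := D)) hgi.2.ne) ?_
      rw [← lintegral_const_mul' _ _ ENNReal.coe_ne_top]
      refine lintegral_mono fun x => ?_
      simp only [enorm_mul, ENNReal.tsum_mul_right]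
      exact mul_le_mul_left (hD x) _
    have h2 := ENNReal.summable_toReal h1
    refine h2.congr fun k => ?_
    rw [integral_norm_eq_lintegral_enorm (hFi k).aestronglyMeasurable]
  have hHS := hasSum_integral_of_summable_integral_norm hFi hFsum
  have hterm : ∀ k, ∫ x, w k x * (g : 𝓢(Bd d, ℂ)) x
      = B (sconv (h : 𝓢(Bd d, ℂ)) (lpTest φ k 0 : 𝓢(Bd d, ℂ))) := fun k => by
    obtain ⟨b, hb⟩ := exists_norm_lpBlock_le hd hq φ hf k
    rw [hw, integral_integral_dil_mul hκ ht (continuous_lpBlock φ k f) hb,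
      ← (integral_mul_lpBlock φ k hB (h : 𝓢(Bd d, ℂ))).2]
    simp only [hh]
  simp only [hterm, tsum_mul_right] at hHS
  have h1 := hHS.comp tendsto_finset_Ico_int
  have h2 := tendsto_sum_tempered_sconv φ B h
  rw [← hB h]
  exact tendsto_nhds_unique h1 h2

/-! ### The Odqvist kernels as dilates -/

theorem point_castSucc (x : Bd d) (t : ℝ) (i : Fin d) : point x t i.castSucc = x i := by
  simp [point]

theorem point_last (x : Bd d) (t : ℝ) : point x t (Fin.last d) = t := by
  simp [point]

theorem point_eq_smul (x : Bd d) {t : ℝ} (ht : 0 < t) : point x t = t • point (t⁻¹ • x) 1 := by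
  ext i
  refine Fin.lastCases ?_ (fun i => ?_) i
  · rw [PiLp.smul_apply, point_last, point_last, smul_eq_mul, mul_one]
  · rw [PiLp.smul_apply, point_castSucc, point_castSucc, PiLp.smul_apply, smul_smul,
      mul_inv_cancel₀ ht.ne', one_smul]

theorem norm_point_one (x : Bd d) : ‖point x 1‖ = jap x := by
  rw [EuclideanSpace.norm_eq, jap, EuclideanSpace.norm_sq_eq, Fin.sum_univ_castSucc]
  simp only [point_castSucc, point_last]
  rw [add_comm]
  simp

theorem point_one_ne_zero (x : Bd d) : point x 1 ≠ 0 := by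
  rw [← norm_ne_zero_iff, norm_point_one]
  exact (jap_pos x).ne'

theorem velKernel_smul (i j : Fin (d + 1)) {t : ℝ} (ht : 0 < t)
    (z : EuclideanSpace ℝ (Fin (d + 1))) :
    velKernel i j (t • z) = (t ^ d)⁻¹ * velKernel i j z := by
  simp only [velKernel, PiLp.smul_apply, smul_eq_mul, norm_smul, Real.norm_of_nonneg ht.le, mul_pow]
  by_cases hz : ‖z‖ = 0
  · simp [hz]
  · field_simp
    ring

theorem presKernel_smul (j : Fin (d + 1)) {t : ℝ} (ht : 0 < t)
    {z : EuclideanSpace ℝ (Fin (d + 1))} (hz : z ≠ 0) :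
    presKernel j (t • z) = t⁻¹ * ((t ^ d)⁻¹ * presKernel j z) := by
  have hn : ‖z‖ ≠ 0 := norm_ne_zero_iff.mpr hz
  rw [presKernel_eq j _ (smul_ne_zero ht.ne' hz), presKernel_eq j z hz]
  simp only [PiLp.smul_apply, smul_eq_mul, norm_smul, Real.norm_of_nonneg ht.le, mul_pow]
  by_cases hs : sphereArea d = 0
  · simp [hs]
  · field_simp
    ring

theorem velKernel_point (i j : Fin (d + 1)) {t : ℝ} (ht : 0 < t) :
    (fun x : Bd d => velKernel i j (point x t)) = dil (fun x => velKernel i j (point x 1)) t := by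
  funext x
  rw [point_eq_smul x ht, velKernel_smul i j ht, dil]

/-- The pressure kernel has one more degree of singularity, whence the factor `t⁻¹`. -/
theorem presKernel_point (j : Fin (d + 1)) {t : ℝ} (ht : 0 < t) :
    (fun x : Bd d => presKernel j (point x t))
      = dil (fun x => t⁻¹ * presKernel j (point x 1)) t := by
  funext x
  rw [point_eq_smul x ht, presKernel_smul j ht (point_one_ne_zero _), dil]
  ring

theorem KernelClass.point_mul {k : ℕ} {κ : Bd d → ℝ} (h : KernelClass (k + 1) κ)
    (i : Fin (d + 1)) : KernelClass k fun x => point x 1 i * κ x := by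
  refine Fin.lastCases ?_ (fun i => ?_) i
  · simp only [point_last, one_mul]
    exact .of_succ h
  · simp only [point_castSucc]
    exact .coord_mul i h

/-- At height `1` the kernel is `x_i x_j (1 + |x'|²)^{-(d+3)/2}` with `x_n = 1`, up to a constant.
-/
theorem kernelClass_velKernel (i j : Fin (d + 1)) :
    KernelClass (d + 1) fun x : Bd d => velKernel i j (point x 1) := by
  have h := KernelClass.const_mul (2 * ((d : ℝ) + 1) / sphereArea d)
    (((KernelClass.jap_pow (d := d) (d + 1 + 1 + 1)).point_mul j).point_mul i)
  convert h using 2 with x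
  rw [velKernel, point_last, norm_point_one]
  ring

theorem kernelClass_presKernel (j : Fin (d + 1)) :
    KernelClass (d + 1) fun x : Bd d => presKernel j (point x 1) := by
  have h := KernelClass.const_mul (4 / sphereArea d) (KernelClass.add
    (KernelClass.const_mul (if j = Fin.last d then 1 else 0) (KernelClass.jap_pow (d := d) (d + 1)))
    (KernelClass.const_mul (-((d : ℝ) + 1))
      (KernelClass.of_succ ((KernelClass.jap_pow (d := d) (d + 1 + 1 + 1)).point_mul j))))
  convert h using 2 with x
  rw [presKernel_eq j _ (point_one_ne_zero x), point_last, norm_point_one]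
  ring

/-! ### The estimates for the extensions -/

theorem majorant_mono {M : ℕ} {v w : ℤ → Bd d → ℝ≥0∞} (h : ∀ k x, v k x ≤ w k x) (t : ℝ)
    (x : Bd d) : majorant M v t x ≤ majorant M w t x :=
  ENNReal.tsum_le_tsum fun k => mul_le_mul_right
    (lintegral_mono fun y => mul_le_mul_right (h k y) _) _

/-- The total size of the blocks of frequency `2^k` of a vector of distributions. -/
def vecSize (φ : Cutoff d) (f : Fin (d + 1) → SDot' d) (k : ℤ) (x : Bd d) : ℝ≥0∞ :=
  ∑ j, blockSize φ (f j) k x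

theorem measurable_vecSize (φ : Cutoff d) (f : Fin (d + 1) → SDot' d) (k : ℤ) :
    Measurable (vecSize φ f k) :=
  Finset.measurable_fun_sum _ fun j _ => measurable_blockSize φ (f j) k

theorem exists_enorm_conv_le_majorant (hd : 1 ≤ d) {q : ℝ} (hq : ((d : ℝ) + 1) / d < q)
    {κ : Bd d → ℝ} (hκ : KernelClass (d + 1) κ) (M : ℕ) (φ : Cutoff d) :
    ∃ C : ℝ≥0, ∀ f : Fin (d + 1) → SDot' d,
      (∀ j, tlNorm φ (-1 / q) (expP d q) q (f j) < ⊤) → ∀ (j : Fin (d + 1)) (t : ℝ), 0 < t →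
        ∀ x, ‖conv φ (dil κ t) (f j) x‖ₑ ≤ C * majorant M (vecSize φ f) t x := by
  obtain ⟨C, hC⟩ := exists_tsum_enorm_le_majorant hκ M φ
  refine ⟨C, fun f hf j t ht x => enorm_tsum_le_tsum_enorm.trans
    ((hC (f j) (exists_norm_lpBlock_le hd hq φ (hf j)) t ht x).trans
      (mul_le_mul_right (majorant_mono (fun k y => ?_) t x) _))⟩
  exact Finset.single_le_sum (f := fun j => blockSize φ (f j) k y) (fun _ _ => zero_le)
    (Finset.mem_univ j)

theorem enorm_toLp_le {n : ℕ} (w : Fin n → ℂ) :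
    ‖(WithLp.toLp 2 w : EuclideanSpace ℂ (Fin n))‖ₑ ≤ ∑ i, ‖w i‖ₑ := by
  have h : (WithLp.toLp 2 w : EuclideanSpace ℂ (Fin n)) = ∑ i, EuclideanSpace.single i (w i) := by
    ext j
    simp
  rw [h]
  refine (enorm_sum_le _ _).trans (Finset.sum_le_sum fun i _ => le_of_eq ?_)
  rw [← ofReal_norm, PiLp.norm_single, ofReal_norm]

theorem exists_enorm_stokesExt_le (hd : 1 ≤ d) {q : ℝ} (hq : ((d : ℝ) + 1) / d < q) (M : ℕ)
    (φ : Cutoff d) : ∃ C : ℝ≥0, ∀ f : Fin (d + 1) → SDot' d,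
      (∀ j, tlNorm φ (-1 / q) (expP d q) q (f j) < ⊤) → ∀ (t : ℝ), 0 < t →
        ∀ x, ‖stokesExt φ f (x, t)‖ₑ ≤ C * majorant M (vecSize φ f) t x := by
  choose C hC using fun i j : Fin (d + 1) =>
    exists_enorm_conv_le_majorant hd hq (kernelClass_velKernel (d := d) i j) M φ
  refine ⟨∑ i, ∑ j, C i j, fun f hf t ht x => (enorm_toLp_le _).trans ?_⟩
  push_cast
  rw [Finset.sum_mul]
  refine Finset.sum_le_sum fun i _ => (enorm_sum_le _ _).trans ?_
  rw [Finset.sum_mul]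
  refine Finset.sum_le_sum fun j _ => ?_
  simp only [velKernel_point i j ht]
  exact hC i j f hf j t ht x

theorem conv_const_mul (φ : Cutoff d) (c : ℝ) (κ : Bd d → ℝ) (f : SDot' d) (x : Bd d) :
    conv φ (fun y => c * κ y) f x = c • conv φ κ f x := by
  rw [conv, conv, ← tsum_const_smul'']
  congr 1
  funext k
  rw [← integral_smul]
  simp only [smul_smul]

/-- The factor `t` compensates the extra singularity of the pressure kernel, so that velocity and
pressure satisfy the same bound. -/
theorem exists_enorm_smul_presExt_le (hd : 1 ≤ d) {q : ℝ} (hq : ((d : ℝ) + 1) / d < q) (M : ℕ)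
    (φ : Cutoff d) : ∃ C : ℝ≥0, ∀ f : Fin (d + 1) → SDot' d,
      (∀ j, tlNorm φ (-1 / q) (expP d q) q (f j) < ⊤) → ∀ (t : ℝ), 0 < t →
        ∀ x, ‖t • presExt φ f (x, t)‖ₑ ≤ C * majorant M (vecSize φ f) t x := by
  choose C hC using fun j : Fin (d + 1) =>
    exists_enorm_conv_le_majorant hd hq (kernelClass_presKernel (d := d) j) M φ
  refine ⟨∑ j, C j, fun f hf t ht x => ?_⟩
  rw [presExt, Finset.smul_sum]
  push_cast
  refine (enorm_sum_le _ _).trans ?_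
  rw [Finset.sum_mul]
  refine Finset.sum_le_sum fun j _ => ?_
  have h1 : dil (fun x : Bd d => t⁻¹ * presKernel j (point x 1)) t
      = fun x => t⁻¹ * dil (fun x => presKernel j (point x 1)) t x := by
    funext x
    simp only [dil]
    ring
  simp only [presKernel_point j ht]
  rw [h1, conv_const_mul, smul_smul, mul_inv_cancel₀ ht.ne', one_smul]
  exact hC j f hf j t ht x

theorem exists_majorant_vecSize_le (hd : 1 ≤ d) {q : ℝ} (hq : ((d : ℝ) + 1) / d < q) {M : ℕ}
    (hM : 1 / (q - 1) < M) (φ : Cutoff d) : ∃ C : ℝ≥0, ∀ (f : Fin (d + 1) → SDot' d) (t : ℝ),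
      0 < t → ∀ x, majorant M (vecSize φ f) t x ≤ C * ENNReal.ofReal (t ^ (-(1 / (q - 1)))) *
        ∑ j, tlNorm φ (-1 / q) (expP d q) q (f j) := by
  have hq1 := (one_lt_expP hd hq).1
  obtain ⟨C, hC⟩ := exists_enorm_lpBlock_le hd hq φ
  obtain ⟨D, hD⟩ := exists_majorant_le (d := d) (M := M) (a := 1 / (q - 1))
    (one_div_pos.mpr (by linarith)) hM
  refine ⟨D * C, fun f t ht x => (hD _ (C * ∑ j, tlNorm φ (-1 / q) (expP d q) q (f j))
    (fun k y => ?_) t ht x).trans (le_of_eq ?_)⟩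
  · rw [vecSize, Finset.mul_sum, Finset.mul_sum]
    exact Finset.sum_le_sum fun j _ => hC (f j) k y
  · rw [ENNReal.coe_mul]
    ring

theorem weightedSup_le {V : Type*} [NormedAddCommGroup V] [NormedSpace ℝ V] {a : ℝ}
    {F : Bd d × ℝ → V} {B : ℝ≥0∞}
    (h : ∀ t : ℝ, 0 < t → ∀ x, ‖F (x, t)‖ₑ ≤ ENNReal.ofReal (t ^ (-a)) * B) :
    weightedSup a F ≤ B := by
  refine iSup₂_le fun t ht => ?_
  rw [eLpNorm_exponent_top]
  refine (mul_le_mul_right (eLpNormEssSup_le_of_ae_enorm_bound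
    (Filter.Eventually.of_forall (h t ht))) _).trans ?_
  rw [← mul_assoc, ← ENNReal.ofReal_mul (by positivity), ← Real.rpow_add ht, add_neg_cancel,
    Real.rpow_zero, ENNReal.ofReal_one, one_mul]

theorem tentNorm_rpow {V : Type*} [NormedAddCommGroup V] [NormedSpace ℝ V] {p q : ℝ} (hp : 0 < p)
    (F : Bd d × ℝ → V) : tentNorm p q F ^ p = ∫⁻ x, (∫⁻ y in cone x,
      ‖F y‖ₑ ^ q * ENNReal.ofReal (y.2 ^ (-(d : ℝ)))) ^ (p / q) := by
  have hp0 : ENNReal.ofReal p ≠ 0 := by simpa using hp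
  rw [tentNorm, eLpNorm_eq_lintegral_rpow_enorm_toReal hp0 ENNReal.ofReal_ne_top,
    ENNReal.toReal_ofReal hp.le, ← ENNReal.rpow_mul, one_div_mul_cancel hp.ne', ENNReal.rpow_one]
  simp only [enorm_eq_self, conical, ← ENNReal.rpow_mul, one_div_mul_eq_div]

/-- The Triebel-Lizorkin norm of `vecSize` is controlled by the sum of the norms of the components.
-/
theorem exists_lintegral_vecSize_le {p q : ℝ} (hq : 1 < q) (hqp : q < p) (φ : Cutoff d) :
    ∃ C : ℝ≥0, ∀ f : Fin (d + 1) → SDot' d,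
      ∫⁻ x, (∑' k : ℤ, ENNReal.ofReal (((2 : ℝ) ^ k)⁻¹) * vecSize φ f k x ^ q) ^ (p / q)
        ≤ C * (∑ j, tlNorm φ (-1 / q) p q (f j)) ^ p := by
  have hq0 : 0 < q := by linarith
  have hp0 : 0 < p := by linarith
  have hs : 1 ≤ p / q := (one_le_div hq0).mpr hqp.le
  set n : ℝ≥0∞ := ((Finset.univ : Finset (Fin (d + 1))).card : ℝ≥0∞) with hn
  have hnt : n ≠ ⊤ := ENNReal.natCast_ne_top _
  have hc : (n ^ (q - 1)) ^ (p / q) * (n ^ (p / q - 1) * n) ≠ ⊤ := by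
    refine ENNReal.mul_ne_top (ENNReal.rpow_ne_top_of_nonneg (by linarith)
      (ENNReal.rpow_ne_top_of_nonneg (by linarith) hnt))
      (ENNReal.mul_ne_top (ENNReal.rpow_ne_top_of_nonneg (by linarith) hnt) hnt)
  refine ⟨((n ^ (q - 1)) ^ (p / q) * (n ^ (p / q - 1) * n)).toNNReal, fun f => ?_⟩
  rw [ENNReal.coe_toNNReal hc]
  set g : Fin (d + 1) → Bd d → ℝ≥0∞ := fun j x =>
    ∑' k : ℤ, ENNReal.ofReal (((2 : ℝ) ^ k)⁻¹) * blockSize φ (f j) k x ^ q with hg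
  have hgm : ∀ j, Measurable (g j) := fun j => Measurable.tsum fun k =>
    ((measurable_blockSize φ (f j) k).pow_const q).const_mul _
  have hgi : ∀ j, ∫⁻ x, g j x ^ (p / q) = tlNorm φ (-1 / q) p q (f j) ^ p := fun j => by
    rw [tlNorm_rpow φ hp0]
    refine lintegral_congr fun x => ?_
    rw [← ENNReal.rpow_mul, one_div_mul_eq_div]
    congr 1
    refine tsum_congr fun k => ?_
    rw [ENNReal.mul_rpow_of_nonneg _ _ hq0.le, ENNReal.ofReal_rpow_of_pos (by positivity),
      ← Real.rpow_mul zero_le_two, mul_assoc, div_mul_cancel₀ _ hq0.ne', mul_neg_one, Real.rpow_neg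
      zero_le_two, Real.rpow_intCast]
    rfl
  have hpt : ∀ x, (∑' k : ℤ, ENNReal.ofReal (((2 : ℝ) ^ k)⁻¹) * vecSize φ f k x ^ q) ^ (p / q)
      ≤ (n ^ (q - 1)) ^ (p / q) * (n ^ (p / q - 1) * ∑ j, g j x ^ (p / q)) := fun x => by
    have h1 : ∑' k : ℤ, ENNReal.ofReal (((2 : ℝ) ^ k)⁻¹) * vecSize φ f k x ^ q
        ≤ n ^ (q - 1) * ∑ j, g j x := by
      have h2 : ∑ j, g j x = ∑' k : ℤ, ∑ j, ENNReal.ofReal (((2 : ℝ) ^ k)⁻¹) *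
          blockSize φ (f j) k x ^ q :=
        (Summable.tsum_finsetSum fun j _ => ENNReal.summable).symm
      rw [h2, ← ENNReal.tsum_mul_left]
      refine ENNReal.tsum_le_tsum fun k => ?_
      rw [← Finset.mul_sum, mul_left_comm]
      exact mul_le_mul_right (ENNReal.rpow_sum_le_const_mul_sum_rpow _ _ hq.le) _
    refine (ENNReal.rpow_le_rpow h1 (by linarith)).trans ?_
    rw [ENNReal.mul_rpow_of_nonneg _ _ (by linarith)]
    exact mul_le_mul_right (ENNReal.rpow_sum_le_const_mul_sum_rpow _ _ hs) _
  refine (lintegral_mono hpt).trans ?_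
  have hm : ∀ j ∈ (Finset.univ : Finset (Fin (d + 1))), Measurable fun x => g j x ^ (p / q) :=
    fun j _ => (hgm j).pow_const _
  have hm2 : Measurable fun x => ∑ j, g j x ^ (p / q) := Finset.measurable_fun_sum _ hm
  rw [lintegral_const_mul _ (hm2.const_mul _), lintegral_const_mul _ hm2, lintegral_finsetSum _ hm,
    mul_assoc, mul_assoc]
  refine mul_le_mul_right (mul_le_mul_right ?_ _) _
  simp only [hgi]
  rw [hn, ← nsmul_eq_mul]
  refine Finset.sum_le_card_nsmul _ _ _ fun j hj => ENNReal.rpow_le_rpow ?_ hp0.le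
  exact Finset.single_le_sum (f := fun j => tlNorm φ (-1 / q) p q (f j)) (fun _ _ => zero_le) hj

/-- A function dominated by the majorant has tent norm bounded by the data. -/
theorem exists_tentNorm_le (hd : 1 ≤ d) {q : ℝ} (hq : ((d : ℝ) + 1) / d < q) {M : ℕ}
    (hM : 1 / (2 * (q - 1)) < M) (hM2 : 2 ≤ M) (φ : Cutoff d) (A : ℝ≥0) :
    ∃ C : ℝ≥0, ∀ {V : Type} [NormedAddCommGroup V] [NormedSpace ℝ V]
      (f : Fin (d + 1) → SDot' d) (F : Bd d × ℝ → V),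
      (∀ t, 0 < t → ∀ x, ‖F (x, t)‖ₑ ≤ A * majorant M (vecSize φ f) t x) →
      tentNorm (expP d q) q F ≤ C * ∑ j, tlNorm φ (-1 / q) (expP d q) q (f j) := by
  obtain ⟨hq1, hdq, hqp⟩ := one_lt_expP hd hq
  set p := expP d q with hp
  have hq0 : 0 < q := by linarith
  have hp0 : 0 < p := by linarith
  have hs : 1 < p / q := (one_lt_div hq0).mpr hqp
  obtain ⟨C₁, hC₁⟩ := exists_lintegral_cone_majorant_le hd hq1 hs hM hM2
  obtain ⟨C₂, hC₂⟩ := exists_lintegral_vecSize_le hq1 hqp φ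
  have hfin : ((A : ℝ≥0∞) ^ q) ^ (p / q) * ((C₁ : ℝ≥0∞) ^ (p / q) * C₂) ≠ ⊤ := by
    refine ENNReal.mul_ne_top (ENNReal.rpow_ne_top_of_nonneg (by linarith)
      (ENNReal.rpow_ne_top_of_nonneg (by linarith) ENNReal.coe_ne_top))
      (ENNReal.mul_ne_top (ENNReal.rpow_ne_top_of_nonneg (by linarith) ENNReal.coe_ne_top)
        ENNReal.coe_ne_top)
  have hfin2 := ENNReal.rpow_ne_top_of_nonneg (inv_nonneg.mpr hp0.le) hfin
  refine ⟨((((A : ℝ≥0∞) ^ q) ^ (p / q) * ((C₁ : ℝ≥0∞) ^ (p / q) * C₂)) ^ p⁻¹).toNNReal,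
    fun {V} _ _ f F hF => ?_⟩
  rw [ENNReal.coe_toNNReal hfin2, ← ENNReal.rpow_le_rpow_iff hp0,
    ENNReal.mul_rpow_of_nonneg _ _ hp0.le, ← ENNReal.rpow_mul, inv_mul_cancel₀ hp0.ne',
    ENNReal.rpow_one, tentNorm_rpow hp0]
  have h1 : ∀ x : Bd d, ∫⁻ y in cone x, ‖F y‖ₑ ^ q * ENNReal.ofReal (y.2 ^ (-(d : ℝ)))
      ≤ (A : ℝ≥0∞) ^ q * ∫⁻ y in cone x,
        majorant M (vecSize φ f) y.2 y.1 ^ q * ENNReal.ofReal (y.2 ^ (-(d : ℝ))) := fun x => by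
    rw [← lintegral_const_mul' _ _ (ENNReal.rpow_ne_top_of_nonneg hq0.le ENNReal.coe_ne_top)]
    refine setLIntegral_mono' (measurableSet_cone x) fun y hy => ?_
    rw [← mul_assoc, ← ENNReal.mul_rpow_of_nonneg _ _ hq0.le]
    exact mul_le_mul_left (ENNReal.rpow_le_rpow (hF y.2 hy.1 y.1) hq0.le) _
  have h2 := hC₁ (vecSize φ f) (measurable_vecSize φ f)
  have hs0 : 0 < p / q := by linarith
  rw [one_div, ENNReal.rpow_inv_le_iff hs0, ENNReal.mul_rpow_of_nonneg _ _ hs0.le,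
    ← ENNReal.rpow_mul, inv_mul_cancel₀ hs0.ne', ENNReal.rpow_one] at h2
  calc _ ≤ ∫⁻ x, ((A : ℝ≥0∞) ^ q) ^ (p / q) * (∫⁻ y in cone x,
        majorant M (vecSize φ f) y.2 y.1 ^ q * ENNReal.ofReal (y.2 ^ (-(d : ℝ)))) ^ (p / q) := by
        refine lintegral_mono fun x => ?_
        rw [← ENNReal.mul_rpow_of_nonneg _ _ hs0.le]
        exact ENNReal.rpow_le_rpow (h1 x) hs0.le
    _ ≤ _ := by
        rw [lintegral_const_mul' _ _ (ENNReal.rpow_ne_top_of_nonneg hs0.le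
          (ENNReal.rpow_ne_top_of_nonneg hq0.le ENNReal.coe_ne_top)), mul_assoc, mul_assoc]
        exact mul_le_mul_right (h2.trans (mul_le_mul_right (hC₂ f) _)) _

/-! ### Measurability and the final estimate -/

theorem measurableSet_halfSpace : MeasurableSet (halfSpace d) :=
  measurableSet_lt measurable_const measurable_snd

theorem aestronglyMeasurable_conv_halfSpace (hd : 1 ≤ d) {q : ℝ} (hq : ((d : ℝ) + 1) / d < q)
    {κ : ℝ → Bd d → ℝ} {κ₀ : Bd d → ℝ} {c : ℝ → ℝ} (hc : Measurable c)
    (hκ₀ : KernelClass (d + 1) κ₀) (hκ : ∀ t, 0 < t → κ t = dil (fun x => c t * κ₀ x) t)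
    (φ : Cutoff d) {f : SDot' d} (hf : tlNorm φ (-1 / q) (expP d q) q f < ⊤) :
    AEStronglyMeasurable (fun y : Bd d × ℝ => conv φ (κ y.2) f y.1)
      (volume.restrict (halfSpace d)) := by
  have hK : Measurable fun a : (Bd d × ℝ) × Bd d => dil (fun x => c a.1.2 * κ₀ x) a.1.2
      (a.1.1 - a.2) := by
    have := hκ₀.continuous.measurable
    unfold dil
    fun_prop
  have h := aestronglyMeasurable_tsum_integral (volume.restrict (halfSpace d)) hK φ f
    ((ae_restrict_iff' measurableSet_halfSpace).mpr (Filter.Eventually.of_forall fun a ha =>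
      (convConverges_dil hd hq (hκ₀.const_mul (c a.2)) φ hf ha a.1).2.of_norm))
  refine h.congr ((ae_restrict_iff' measurableSet_halfSpace).mpr
    (Filter.Eventually.of_forall fun a ha => ?_))
  simp only [conv, hκ a.2 ha]

theorem aestronglyMeasurable_stokesExt (hd : 1 ≤ d) {q : ℝ} (hq : ((d : ℝ) + 1) / d < q)
    (φ : Cutoff d) {f : Fin (d + 1) → SDot' d}
    (hf : ∀ j, tlNorm φ (-1 / q) (expP d q) q (f j) < ⊤) :
    AEStronglyMeasurable (stokesExt φ f) (volume.restrict (halfSpace d)) := by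
  have h1 : AEStronglyMeasurable (fun (y : Bd d × ℝ) (i : Fin (d + 1)) => ∑ j,
      conv φ (fun x => velKernel i j (point x y.2)) (f j) y.1)
      (volume.restrict (halfSpace d)) := by
    refine (aemeasurable_pi_lambda _ fun i => ?_).aestronglyMeasurable
    refine (Finset.aestronglyMeasurable_fun_sum _ fun j _ => ?_).aemeasurable
    exact aestronglyMeasurable_conv_halfSpace hd hq (c := fun _ => 1)
      (κ := fun t x => velKernel i j (point x t)) measurable_const (kernelClass_velKernel i j)
      (fun t ht => by simpa only [one_mul] using velKernel_point i j ht) φ (hf j)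
  exact (PiLp.continuous_toLp 2 _).comp_aestronglyMeasurable h1

theorem aestronglyMeasurable_presExt (hd : 1 ≤ d) {q : ℝ} (hq : ((d : ℝ) + 1) / d < q)
    (φ : Cutoff d) {f : Fin (d + 1) → SDot' d}
    (hf : ∀ j, tlNorm φ (-1 / q) (expP d q) q (f j) < ⊤) :
    AEStronglyMeasurable (presExt φ f) (volume.restrict (halfSpace d)) :=
  Finset.aestronglyMeasurable_fun_sum _ fun j _ =>
    aestronglyMeasurable_conv_halfSpace hd hq (c := fun t => t⁻¹)
      (κ := fun t x => presKernel j (point x t)) measurable_inv (kernelClass_presKernel j)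
      (fun _ ht => presKernel_point j ht) φ (hf j)

/-- The decay exponent `M` of the majorant is fixed here: `M > 1/(q-1)` is needed for the supremum
and `M ≥ 2` for the tent norms. -/
theorem exists_norm_ext_le (hd : 1 ≤ d) {q : ℝ} (hq : ((d : ℝ) + 1) / d < q) (φ : Cutoff d) :
    ∃ C : ℝ≥0, 0 < C ∧ ∀ f : Fin (d + 1) → SDot' d,
      (∀ j, tlNorm φ (-1 / q) (expP d q) q (f j) < ⊤) →
      xNorm q (stokesExt φ f) + zNorm q (presExt φ f) + weightedSup (q / (q - 1)) (presExt φ f)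
        ≤ C * ∑ j, tlNorm φ (-1 / q) (expP d q) q (f j) := by
  have hq1 := (one_lt_expP hd hq).1
  have hd0 : (d : ℝ) ≠ 0 := by exact_mod_cast (by omega : d ≠ 0)
  obtain ⟨M, hM⟩ := exists_nat_gt (max (1 / (q - 1)) 2)
  have hM1 : 1 / (q - 1) < M := (le_max_left _ _).trans_lt hM
  have hM2 : 2 ≤ M := by exact_mod_cast ((le_max_right _ _).trans_lt hM).le
  have hM3 : 1 / (2 * (q - 1)) < M := by
    refine lt_of_le_of_lt ?_ hM1
    exact one_div_le_one_div_of_le (by linarith) (by linarith)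
  obtain ⟨A, hA⟩ := exists_enorm_stokesExt_le hd hq M φ
  obtain ⟨B, hB⟩ := exists_enorm_smul_presExt_le hd hq M φ
  obtain ⟨D, hD⟩ := exists_majorant_vecSize_le hd hq hM1 φ
  obtain ⟨E, hE⟩ := exists_tentNorm_le hd hq hM3 hM2 φ A
  obtain ⟨E', hE'⟩ := exists_tentNorm_le hd hq hM3 hM2 φ B
  refine ⟨(A * D + E) + E' + B * D + 1, by positivity, fun f hf => ?_⟩
  set T := ∑ j, tlNorm φ (-1 / q) (expP d q) q (f j) with hT
  have h1 : weightedSup (1 / (q - 1)) (stokesExt φ f) ≤ A * D * T :=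
    weightedSup_le fun t ht x => by
      refine (hA f hf t ht x).trans ((mul_le_mul_right (hD f t ht x) _).trans (le_of_eq ?_))
      ring
  have h2 : weightedSup (q / (q - 1)) (presExt φ f) ≤ B * D * T :=
    weightedSup_le fun t ht x => by
      have h3 : presExt φ f (x, t) = t⁻¹ • t • presExt φ f (x, t) := by
        rw [smul_smul, inv_mul_cancel₀ ht.ne', one_smul]
      -- `q / (q - 1) = 1 + 1 / (q - 1)`
      have h4 : t ^ (-(q / (q - 1))) = t⁻¹ * t ^ (-(1 / (q - 1))) := by
        rw [← Real.rpow_neg_one, ← Real.rpow_add ht]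
        congr 1
        have : q - 1 ≠ 0 := by linarith
        field_simp
        ring
      rw [h3, enorm_smul, Real.enorm_of_nonneg (by positivity), h4,
        ENNReal.ofReal_mul (by positivity), mul_assoc]
      refine mul_le_mul_right ((hB f hf t ht x).trans
        ((mul_le_mul_right (hD f t ht x) _).trans (le_of_eq ?_))) _
      ring
  have h5 := hE f (stokesExt φ f) (hA f hf)
  have h6 : zNorm q (presExt φ f) ≤ E' * T := by
    refine hE' f _ fun t ht x => ?_
    -- the weight in `zNorm` is `y_n` to the power `-d * (-1/d)`
    have e : -(d : ℝ) * (-1 / d) = 1 := by field_simp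
    simp only [e, Real.rpow_one]
    exact hB f hf t ht x
  push_cast
  calc _ ≤ (A * D * T + E * T) + E' * T + B * D * T :=
        add_le_add (add_le_add (add_le_add h1 h5) h6) h2
    _ ≤ (A * D * T + E * T) + E' * T + B * D * T + T := le_self_add
    _ = _ := by ring

end StokesLin

end

open StokesLin
theorem mainTheorem7 (d : ℕ) (hd : 1 ≤ d) (q : ℝ) (hq : ((d : ℝ) + 1) / d < q) (φ : Cutoff d) :
    ∃ C : ℝ≥0, 0 < C ∧ ∀ f : Fin (d + 1) → SDot' d,
      (∀ j, tlNorm φ (-1 / q) (expP d q) q (f j) < ⊤) →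
      -- the convolutions defining `ℋf` and `ℰf` are meaningful
      (∀ t : ℝ, 0 < t → ∀ j,
        (∀ i, (∀ x, ConvConverges φ (fun x' => velKernel i j (point x' t)) (f j) x) ∧
          IsConv (fun x' => velKernel i j (point x' t)) (f j)
            (conv φ (fun x' => velKernel i j (point x' t)) (f j))) ∧
        (∀ x, ConvConverges φ (fun x' => presKernel j (point x' t)) (f j) x) ∧
          IsConv (fun x' => presKernel j (point x' t)) (f j)
            (conv φ (fun x' => presKernel j (point x' t)) (f j))) ∧
      AEStronglyMeasurable (stokesExt φ f) (volume.restrict (halfSpace d)) ∧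
      AEStronglyMeasurable (presExt φ f) (volume.restrict (halfSpace d)) ∧
      -- the estimate
      xNorm q (stokesExt φ f) + zNorm q (presExt φ f) + weightedSup (q / (q - 1)) (presExt φ f)
        ≤ C * ∑ j, tlNorm φ (-1 / q) (expP d q) q (f j) := by
  obtain ⟨C, hC0, hC⟩ := exists_norm_ext_le hd hq φ
  refine ⟨C, hC0, fun f hf => ⟨fun t ht j => ⟨fun i => ?_, ?_⟩,
    aestronglyMeasurable_stokesExt hd hq φ hf, aestronglyMeasurable_presExt hd hq φ hf, hC f hf⟩⟩
  · rw [velKernel_point i j ht]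
    exact ⟨convConverges_dil hd hq (kernelClass_velKernel i j) φ (hf j) ht,
      isConv_dil hd hq (kernelClass_velKernel i j) φ (hf j) ht⟩
  · rw [presKernel_point j ht]
    exact ⟨convConverges_dil hd hq ((kernelClass_presKernel j).const_mul t⁻¹) φ (hf j) ht,
      isConv_dil hd hq ((kernelClass_presKernel j).const_mul t⁻¹) φ (hf j) ht⟩
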